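/- Let $A$ be an algebra of smooth complex-valued functions on $\mathbb{R}^N$ (pointwise product) that is closed under partial derivatives and complex conjugation and contains the constants and the coordinate functions $x^i$, for example all smooth functions or all polynomials. Let $P^{ij}=-P^{ji}\in A$ be a real bivector field; the Jacobi identity is not assumed. Sums over repeated indices are understood, and $\alpha$ is a real formal parameter, $\alpha^*=\alpha$. A star product on $A$ is a product $f\star g=fg+\sum_{r\ge1}(\mathrm{i}\alpha)^rC_r(f,g)$ with bidifferential operators $C_r$, extended linearly over formal power series in $\alpha$; $\hat f$ denotes the formal differential operator $g\mapsto f\star g$ on $A[[\alpha]]$. We say that it * quantizes $\{f,g\}=P^{ij}\partial_if\,\partial_jg$ if $C_1(f,g)-C_1(g,f)=2\{f,g\}$; * satisfies stability of unity if $f\star1=1\star f=f$ for all $f$; * is Weyl-ordered if $(x^{i_1}\cdots x^{i_n})\star f=\frac1{n!}\sum_{\sigma\in S_n}x^{i_{\sigma(1)}}\star(\cdots\star(x^{i_{\sigma(n)}}\star f)\cdots)$ for all $n$, all indices and all $f\in A$; * is strictly triangular if $C_r$ contains at most $r$ derivatives of $f$ and at most $r$ derivatives of $g$, so that one can write $$\hat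 x^i=x^i+\sum_{m\ge1}\sum_{k\ge0}(\mathrm{i}\alpha)^{k+m}\,\Gamma_k^{i i_1\dots i_m}\,\partial_{i_1}\cdots\partial_{i_m}$$ with $\Gamma_k^{ii_1\dots i_m}\in A$ symmetric in $i_1,\dots,i_m$, and if moreover $\Gamma_k^{ij}=0$ for all $k\ge1$; * is weakly Hermitian if $(x^j\star f)^*=f^*\star x^j$ for all $j$ and all $f\in A$. For $p\in\mathbb{R}^N$ write $\Gamma_k^{i(m)}(p)^m=\Gamma_k^{ii_1\dots i_m}p_{i_1}\cdots p_{i_m}$. For any family $\Gamma=(\Gamma_k^{ii_1\dots i_m})_{k\ge0,\,m\ge1}$ in $A$ define $\hat x^i$ by the formula above, put $\mathcal A=-\mathrm{i}p_jx^j$ and $\mathcal B=-\mathrm{i}p_j(\hat x^j-x^j)$, and define $F_k^{i(m)}(p)^m$ as $\mathrm{i}^{-k}$ times the coefficient of $\alpha^{m+k}$ in the part of degree $m$ in $p$ of $$\Bigl(e^{-\mathcal A}\bigl[e^{\mathcal A+\mathcal B}\bigr]_{\ge2}\Bigr)\,x^i ,$$ where $[\,\cdot\,]_{\ge2}$ means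 that the terms of degree $0$ and $1$ in $\mathcal B$ are omitted from the expansion of $e^{\mathcal A+\mathcal B}=\sum_n(\mathcal A+\mathcal B)^n/n!$. Then: 1. There is exactly one star product on $A$ that quantizes $\{f,g\}=P^{ij}\partial_if\,\partial_jg$, is Weyl-ordered, strictly triangular and weakly Hermitian, and satisfies stability of unity. 2. The coefficients $\Gamma$ of the operators $\hat x^i$ of this star product are real and traceless, i.e. $p_i\,\Gamma_k^{i(m)}(p)^m=0$ for all $k\ge 0$, $m\ge 1$, $p$. They satisfy $\Gamma_0^{ij}=P^{ij}$, $\Gamma_k^{ij}=0$ for $k\ge1$, and $$\Gamma_k^{i(m)}(p)^m=\frac{m}{1+(-1)^{m+k}m}\,F_k^{i(m)}(p)^m\qquad(m\ge2,\ k\ge0,\ p\in\mathbb{R}^N).$$ 3. For every family $\Gamma$, $F_k^{i(m)}(p)^m$ depends only on the coefficients $\Gamma_{k'}^{j(m')}$ with $m'\ge1$ and $k'+m'<k+m$; if $\Gamma$ is traceless, then so is $F$: $p_i\,F_k^{i(m)}(p)^m=0$ for all $k,m,p$. Hence the relations in 2 determine all $\Gamma_k^{i(m)}$ order by order in $k+m$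 from $P^{ij}$. -/

import Mathlib

noncomputable section

namespace WeylStar

/-- An algebra `A` of smooth complex-valued functions on `ℝ^N` with the pointwise product, closed
under partial derivatives and complex conjugation and containing the coordinate functions; for
example all smooth functions, or all polynomials. -/
structure FunctionAlgebra (N : ℕ) where
  carrier : Subalgebra ℂ ((Fin N → ℝ) → ℂ)
  smooth : ∀ f ∈ carrier, ContDiff ℝ ((⊤ : ℕ∞) : WithTop ℕ∞) f
  pderiv_mem : ∀ f ∈ carrier, ∀ i : Fin N,
    (fun x => fderiv ℝ f x (Pi.single i 1)) ∈ carrier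
  conj_mem : ∀ f ∈ carrier, (fun x => (starRingEnd ℂ) (f x)) ∈ carrier
  coord_mem : ∀ i : Fin N, (fun x => ((x i : ℝ) : ℂ)) ∈ carrier

namespace FunctionAlgebra

variable {N : ℕ} (A : FunctionAlgebra N)

/-- The elements of the function algebra. -/
abbrev Fn : Type := A.carrier

/-- The coordinate function `x^i`. -/
def coord (i : Fin N) : A.Fn := ⟨fun x => ((x i : ℝ) : ℂ), A.coord_mem i⟩

/-- Pointwise complex conjugation. -/
def conj (f : A.Fn) : A.Fn := ⟨fun x => (starRingEnd ℂ) (f.1 x), A.conj_mem f.1 f.2⟩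

/-- The partial derivative `∂_i` on `A`. -/
def pderiv (i : Fin N) : Module.End ℂ A.Fn where
  toFun f := ⟨fun x => fderiv ℝ f.1 x (Pi.single i 1), A.pderiv_mem f.1 f.2 i⟩
  map_add' f g := by
    apply Subtype.ext
    funext x
    have hf : DifferentiableAt ℝ f.1 x := ((A.smooth f.1 f.2).differentiable (by simp)) x
    have hg : DifferentiableAt ℝ g.1 x := ((A.smooth g.1 g.2).differentiable (by simp)) x
    change fderiv ℝ (f.1 + g.1) x (Pi.single i 1) = _
    rw [fderiv_add hf hg]
    rfl
  map_smul' c f := by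
    apply Subtype.ext
    funext x
    have hf : DifferentiableAt ℝ f.1 x := ((A.smooth f.1 f.2).differentiable (by simp)) x
    change fderiv ℝ (c • f.1) x (Pi.single i 1) = _
    rw [fderiv_const_smul hf]
    rfl

/-- The iterated derivative `∂_{i_1} ⋯ ∂_{i_n}`. -/
def pderivs {n : ℕ} (I : Fin n → Fin N) : Module.End ℂ A.Fn :=
  (List.ofFn fun a => A.pderiv (I a)).prod

/-- Formal power series `A[[α]]`; the variable is the deformation parameter `α`. -/
abbrev Series : Type := PowerSeries A.Fn

/-- Complex conjugation on `A[[α]]`, with `α` real. -/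
def conjSeries (F : A.Series) : A.Series := PowerSeries.mk fun n => A.conj (PowerSeries.coeff n F)

/-- For linear operators `D_0, D_1, …` on `A`, the operator `∑_r (iα)^r D_r` on `A[[α]]`. -/
def opSeries (D : ℕ → Module.End ℂ A.Fn) : Module.End ℂ A.Series where
  toFun F := PowerSeries.mk fun n =>
    ∑ q ∈ Finset.HasAntidiagonal.antidiagonal n, Complex.I ^ q.1 • D q.1 (PowerSeries.coeff q.2 F)
  map_add' F G := by
    ext1 n
    simp [Finset.sum_add_distrib]
  map_smul' c F := by
    ext1 n
    simp [Finset.smul_sum, smul_comm c]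

/-- The operator of multiplication by `x^i` on `A[[α]]`. -/
def mulCoord (i : Fin N) : Module.End ℂ A.Series :=
  LinearMap.mulLeft ℂ (PowerSeries.C (A.coord i))

/-- `C` is a bidifferential operator on `A` with at most `a` derivatives on the first argument and
at most `b` derivatives on the second one. -/
def IsBidiffOfOrder (a b : ℕ) (C : A.Fn →ₗ[ℂ] A.Fn →ₗ[ℂ] A.Fn) : Prop :=
  ∃ c : (s t : ℕ) → (Fin s → Fin N) → (Fin t → Fin N) → A.Fn, ∀ f g : A.Fn,
    C f g = ∑ s ∈ Finset.range (a + 1), ∑ t ∈ Finset.range (b + 1),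
      ∑ I : Fin s → Fin N, ∑ J : Fin t → Fin N, c s t I J * A.pderivs I f * A.pderivs J g

/-- The quasi-Poisson bracket `{f, g} = P^{ij} ∂_i f ∂_j g`. -/
def bracket (P : Fin N → Fin N → A.Fn) (f g : A.Fn) : A.Fn :=
  ∑ i, ∑ j, P i j * A.pderiv i f * A.pderiv j g

end FunctionAlgebra

/-- A star product `f ⋆ g = f g + ∑_{r ≥ 1} (iα)^r C_r(f, g)` with bidifferential operators `C_r`,
extended to `A[[α]]` linearly over formal series in `α`. -/
@[ext]
structure StarProduct {N : ℕ} (A : FunctionAlgebra N) where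
  C : ℕ → A.Fn →ₗ[ℂ] A.Fn →ₗ[ℂ] A.Fn
  C_zero : ∀ f g, C 0 f g = f * g
  bidiff : ∀ r, ∃ a b, A.IsBidiffOfOrder a b (C r)

/-- A family of coefficients: `Γ i k m ![i_1, …, i_m]` stands for `Γ_k^{i i_1 … i_m}`. Only the
entries with `m ≥ 1` are used. -/
abbrev Coeffs {N : ℕ} (A : FunctionAlgebra N) : Type :=
  Fin N → (k m : ℕ) → (Fin m → Fin N) → A.Fn

namespace Coeffs

variable {N : ℕ} {A : FunctionAlgebra N} (Γ : Coeffs A)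

/-- Symmetry of `Γ_k^{i i_1 … i_m}` in the last `m` indices. -/
def IsSymm : Prop :=
  ∀ i k m (I : Fin m → Fin N) (σ : Equiv.Perm (Fin m)), Γ i k m (I ∘ σ) = Γ i k m I

/-- All coefficients are real-valued functions. -/
def IsReal : Prop :=
  ∀ i k m (I : Fin m → Fin N), 1 ≤ m → A.conj (Γ i k m I) = Γ i k m I

/-- The contraction `Γ_k^{i(m)} (p)^m = Γ_k^{i i_1 … i_m} p_{i_1} ⋯ p_{i_m}`. -/
def contract (i : Fin N) (k m : ℕ) (p : Fin N → ℝ) : A.Fn :=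
  ∑ I : Fin m → Fin N, (∏ a, ((p (I a) : ℝ) : ℂ)) • Γ i k m I

/-- Tracelessness: `p_i p_{i_1} ⋯ p_{i_m} Γ_k^{i i_1 … i_m} = 0`. -/
def IsTraceless : Prop :=
  ∀ k m, 1 ≤ m → ∀ p : Fin N → ℝ, ∑ i, ((p i : ℝ) : ℂ) • Γ.contract i k m p = 0

/-- The operator `x̂^i = x^i + ∑_{m ≥ 1} ∑_{k ≥ 0} (iα)^k Γ_k^{i i_1 … i_m} (iα)^m ∂_{i_1} ⋯ ∂_{i_m}`
on `A[[α]]`. -/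
def xhat (i : Fin N) : Module.End ℂ A.Series :=
  A.mulCoord i + A.opSeries fun r => ∑ m ∈ Finset.Icc 1 r, ∑ I : Fin m → Fin N,
    LinearMap.mulLeft ℂ (Γ i (r - m) m I) * A.pderivs I

/-- `A(p) = -i p_j x^j`, as an operator on `A[[α]]`. -/
def _root_.WeylStar.FunctionAlgebra.opA (A : FunctionAlgebra N) (p : Fin N → ℝ) :
    Module.End ℂ A.Series :=
  ∑ j, (-Complex.I * ((p j : ℝ) : ℂ)) • A.mulCoord j

/-- `B(p) = -i p_j (x̂^j - x^j)`, as an operator on `A[[α]]`. -/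
def opB (p : Fin N → ℝ) : Module.End ℂ A.Series :=
  ∑ j, (-Complex.I * ((p j : ℝ) : ℂ)) • (Γ.xhat j - A.mulCoord j)

/-- The part of degree `m` in `p` of `exp(-A) exp(A + B) = exp(i p_j x^j) exp(-i p_j x̂^j)`,
without the terms of degree zero and one in `B`. -/
def expTail (m : ℕ) (p : Fin N → ℝ) : Module.End ℂ A.Series :=
  ∑ q ∈ Finset.HasAntidiagonal.antidiagonal m, (((q.1.factorial : ℂ) * (q.2.factorial : ℂ))⁻¹) •
    ((-A.opA p) ^ q.1 * ((A.opA p + Γ.opB p) ^ q.2 - A.opA p ^ q.2 -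
      ∑ j ∈ Finset.range q.2, A.opA p ^ j * Γ.opB p * A.opA p ^ (q.2 - 1 - j)))

/-- `F_k^{i(m)} (p)^m`: the part of degree `m` in `p` of the at least `B`-quadratic terms of
`exp(-A) exp(A + B) ▷ x^i` is expanded as `∑_k α^{m+k} i^k F_k^{i(m)} (p)^m`. -/
def F (i : Fin N) (k m : ℕ) (p : Fin N → ℝ) : A.Fn :=
  (Complex.I ^ k)⁻¹ •
    PowerSeries.coeff (m + k) (Γ.expTail m p (PowerSeries.C (A.coord i)))

end Coeffs

namespace StarProduct

variable {N : ℕ} {A : FunctionAlgebra N} (S : StarProduct A)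

/-- The formal differential operator `f̂` on `A[[α]]`, with `f ⋆ g = f̂ ▷ g`. -/
def hat (f : A.Fn) : Module.End ℂ A.Series := A.opSeries fun r => S.C r f

/-- The star product `f ⋆ g` of two functions. -/
def star (f g : A.Fn) : A.Series := S.hat f (PowerSeries.C g)

/-- The star product quantizes the bracket of `P`: `C_1(f, g) - C_1(g, f) = 2 {f, g}`. -/
def Quantizes (P : Fin N → Fin N → A.Fn) : Prop :=
  ∀ f g, S.C 1 f g - S.C 1 g f = (2 : ℂ) • A.bracket P f g

/-- Stability of unity: `f ⋆ 1 = 1 ⋆ f = f`. -/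
def StableUnity : Prop :=
  ∀ f : A.Fn, S.star f 1 = PowerSeries.C f ∧ S.star 1 f = PowerSeries.C f

/-- Weyl ordering:
`(x^{i_1} ⋯ x^{i_n}) ⋆ f = (1/n!) ∑_σ x^{i_σ(1)} ⋆ (⋯ ⋆ (x^{i_σ(n)} ⋆ f) ⋯)`. -/
def IsWeyl : Prop :=
  ∀ (n : ℕ) (I : Fin n → Fin N) (f : A.Fn),
    S.star (∏ a, A.coord (I a)) f = ((n.factorial : ℂ)⁻¹) • ∑ σ : Equiv.Perm (Fin n),
      (List.ofFn fun a => S.hat (A.coord (I (σ a)))).prod (PowerSeries.C f)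

/-- Triangularity: in `C_r` at most `r` derivatives act on each argument. -/
def IsTriangular : Prop := ∀ r, A.IsBidiffOfOrder r r (S.C r)

/-- `Γ` is the family of coefficients of the operators `x̂^i` of the star product. -/
def HasCoeffs (Γ : Coeffs A) : Prop :=
  Γ.IsSymm ∧ ∀ i, S.hat (A.coord i) = Γ.xhat i

/-- Strict triangularity: triangular, and the coefficient `Γ^{ij}(α, x)` of the first derivatives
in `x̂^i` has no `α`-corrections, `Γ^{ij}(α, x) = Γ_0^{ij}(x)`. -/
def IsStrictlyTriangular : Prop :=
  S.IsTriangular ∧ ∃ Γ : Coeffs A, S.HasCoeffs Γ ∧ ∀ i k j, 1 ≤ k → Γ i k 1 j = 0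

/-- Weak Hermiticity: `(x^j ⋆ f)^* = f^* ⋆ x^j`. -/
def IsWeaklyHermitian : Prop :=
  ∀ (j : Fin N) (f : A.Fn),
    A.conjSeries (S.star (A.coord j) f) = S.star (A.conj f) (A.coord j)

/-- The star product quantizes `P`, satisfies stability of unity, and is a weakly Hermitian
strictly triangular Weyl star product. -/
structure IsWeylQuantization (P : Fin N → Fin N → A.Fn) : Prop where
  quantizes : S.Quantizes P
  weyl : S.IsWeyl
  strictlyTriangular : S.IsStrictlyTriangular
  weaklyHermitian : S.IsWeaklyHermitian
  stableUnity : S.StableUnity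

end StarProduct

end WeylStar

end

noncomputable section

namespace WeylStar

/-! ### Calculus in the function algebra. -/

namespace FunctionAlgebra

variable {N : ℕ} (A : FunctionAlgebra N)

/-! Powers $(p\cdot x)^q$ of linear functions replace the exponential $e^{p\cdot x}$, which need not
lie in $A$. A differential operator acts on them through its symbol at $p$, so they detect symmetric
coefficient tensors, differential operators, and bidifferential operators in one argument. Write
$E=p_ix^i$ and $Y=p_i(\hat x^i-x^i)$. Weyl ordering contracted with $p$ reads $(p\cdot x)^n\star
g=(E+Y)^ng$, so a Weyl star product is determined by $\Gamma$. Stability of unity then gives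
$Y(p\cdot x)^q=0$ for all $q$, which is tracelessness.

The central computation (`coeff_expOp_coord`) is the degree $m$ part of $e^{-E}e^{E+Y}x^l$. The
terms at least quadratic in $Y$ give $F^{l(m)}_k$ by definition. For the terms linear in $Y$,
differentiating $p_i\Gamma^{i(m)}(p)^m=0$ in $p_l$ replaces the contraction
$p_i\,\partial\Gamma^{i(m)}/\partial p_l$ by $-\Gamma^{l(m)}$, and summing over the position of $Y$
produces $1/m$. The result is $F-\Gamma/m$. Weak Hermiticity evaluates the same quantity from
$x^l\star f$ as $(-1)^{m+k}\overline\Gamma$. For $m\ge2$, induction on $k+m$ shows that $\Gamma$ is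
real, and solving the equation gives the stated recursion. For $m=1$ the equation does not fix
$\Gamma$; there quantization, with the antisymmetry contained in tracelessness, and strict
triangularity supply the values. Each term of $F$ has at least two factors $Y=O(\alpha)$, so $F$
sees lower orders only (`F_congr`) and the recursion has one solution. This proves uniqueness.

For existence, solve the recursion. The solution is traceless because $F$ inherits tracelessness
from lower orders, and real because its conjugate solves the same recursion. Put
$C_r(f,g)=\sum_{m\le r}\frac1{m!}\partial_If\cdot(V^I)_r\,g$, where $V^I$ contracts with $p$ to $m!$
times the degree $m$ part of $e^{-E}e^{E+Y}$. A binomial identity (`pow_eq_sum_twist`) gives Weyl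
ordering, provided that cutting the sum at $m\le r$ loses nothing. This is `opCoeff_vlin_eq_zero`:
tracelessness lowers the order of $Y$ along $p$ by one, and counting commutators with $E$ shows that
the degree $m$ part is $O(\alpha^m)$. Weak Hermiticity follows by reading the central computation
backwards. -/

theorem differentiableAt (f : A.Fn) (x : Fin N → ℝ) : DifferentiableAt ℝ f.1 x :=
  ((A.smooth f.1 f.2).differentiable (by simp)) x

theorem pderiv_mul (i : Fin N) (f g : A.Fn) :
    A.pderiv i (f * g) = A.pderiv i f * g + f * A.pderiv i g := by
  apply Subtype.ext
  funext x
  change fderiv ℝ (f.1 * g.1) x (Pi.single i 1) = _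
  rw [fderiv_mul (A.differentiableAt f x) (A.differentiableAt g x)]
  change f.1 x * fderiv ℝ g.1 x (Pi.single i 1) + g.1 x * fderiv ℝ f.1 x (Pi.single i 1) =
    fderiv ℝ f.1 x (Pi.single i 1) * g.1 x + f.1 x * fderiv ℝ g.1 x (Pi.single i 1)
  ring

theorem pderiv_one (i : Fin N) : A.pderiv i 1 = 0 := by
  have h := A.pderiv_mul i 1 1
  simpa using h

theorem pderiv_coord (i j : Fin N) : A.pderiv i (A.coord j) = if i = j then 1 else 0 := by
  apply Subtype.ext
  funext x
  change fderiv ℝ (fun x : Fin N → ℝ => ((x j : ℝ) : ℂ)) x (Pi.single i 1) = _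
  have h : HasFDerivAt (fun x : Fin N → ℝ => ((x j : ℝ) : ℂ))
      (Complex.ofRealCLM.comp (ContinuousLinearMap.proj j)) x :=
    (Complex.ofRealCLM.comp (ContinuousLinearMap.proj (R := ℝ) (φ := fun _ : Fin N => ℝ)
      j)).hasFDerivAt
  rw [h.fderiv]
  by_cases hij : i = j
  · subst hij; simp
  · simp [hij, Ne.symm hij]

theorem pderiv_comm (i j : Fin N) : Commute (A.pderiv i) (A.pderiv j) := by
  apply LinearMap.ext
  intro f
  apply Subtype.ext
  funext x
  have hs : ContDiff ℝ ((⊤ : ℕ∞) : WithTop ℕ∞) f.1 := A.smooth f.1 f.2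
  have hd : DifferentiableAt ℝ (fderiv ℝ f.1) x :=
    ((hs.fderiv_right (m := 1) (WithTop.coe_le_coe.2 (le_top : (1 + 1 : ℕ∞) ≤ ⊤))).differentiable
      (by simp)) x
  have hsym : IsSymmSndFDerivAt ℝ f.1 x :=
    hs.contDiffAt.isSymmSndFDerivAt (by
      simpa using WithTop.coe_le_coe.2 (le_top : (2 : ℕ∞) ≤ ⊤))
  have key : ∀ k l : Fin N,
      fderiv ℝ (fun y => fderiv ℝ f.1 y (Pi.single k 1)) x (Pi.single l 1) =
        fderiv ℝ (fderiv ℝ f.1) x (Pi.single l 1) (Pi.single k 1) := by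
    intro k l
    rw [fderiv_clm_apply hd (differentiableAt_const _)]
    simp
  change fderiv ℝ (fun y => fderiv ℝ f.1 y (Pi.single j 1)) x (Pi.single i 1) =
    fderiv ℝ (fun y => fderiv ℝ f.1 y (Pi.single i 1)) x (Pi.single j 1)
  rw [key, key]
  exact hsym _ _

/-- Complex conjugation as a ring homomorphism. -/
def conjHom : A.Fn →+* A.Fn where
  toFun := A.conj
  map_one' := by apply Subtype.ext; funext x; simp [conj]
  map_mul' f g := by apply Subtype.ext; funext x; simp [conj]
  map_zero' := by apply Subtype.ext; funext x; simp [conj]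
  map_add' f g := by apply Subtype.ext; funext x; simp [conj]

@[simp] theorem conjHom_apply (f : A.Fn) : A.conjHom f = A.conj f := rfl

theorem conj_add (f g : A.Fn) : A.conj (f + g) = A.conj f + A.conj g := map_add A.conjHom f g

theorem conj_mul (f g : A.Fn) : A.conj (f * g) = A.conj f * A.conj g := map_mul A.conjHom f g

theorem conj_pow (f : A.Fn) (n : ℕ) : A.conj (f ^ n) = A.conj f ^ n := map_pow A.conjHom f n

theorem conj_zero : A.conj 0 = 0 := map_zero A.conjHom

theorem conj_sum {ι : Type*} (s : Finset ι) (f : ι → A.Fn) :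
    A.conj (∑ i ∈ s, f i) = ∑ i ∈ s, A.conj (f i) := map_sum A.conjHom f s

theorem conj_smul (c : ℂ) (f : A.Fn) : A.conj (c • f) = (starRingEnd ℂ c) • A.conj f := by
  apply Subtype.ext; funext x; simp [conj]

theorem conj_conj (f : A.Fn) : A.conj (A.conj f) = f := by
  apply Subtype.ext; funext x; simp [conj]

theorem conj_coord (i : Fin N) : A.conj (A.coord i) = A.coord i := by
  apply Subtype.ext; funext x; simp [conj, coord]

theorem conj_pderiv (i : Fin N) (f : A.Fn) : A.conj (A.pderiv i f) = A.pderiv i (A.conj f) := by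
  apply Subtype.ext
  funext x
  change (starRingEnd ℂ) (fderiv ℝ f.1 x (Pi.single i 1)) =
    fderiv ℝ (fun y => Complex.conjCLE (f.1 y)) x (Pi.single i 1)
  have h := (Complex.conjCLE.toContinuousLinearMap.hasFDerivAt
    (x := f.1 x)).comp x (A.differentiableAt f x).hasFDerivAt
  have h2 : HasFDerivAt (fun y => Complex.conjCLE (f.1 y)) _ x := h
  rw [h2.fderiv]
  simp

/-- The iterated derivative along a list of indices. -/
def lderiv (L : List (Fin N)) : Module.End ℂ A.Fn := (L.map A.pderiv).prod

@[simp] theorem lderiv_nil : A.lderiv [] = 1 := rfl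

@[simp] theorem lderiv_cons (i : Fin N) (L : List (Fin N)) :
    A.lderiv (i :: L) = A.pderiv i * A.lderiv L := by simp [lderiv]

theorem pderivs_eq_lderiv {n : ℕ} (I : Fin n → Fin N) :
    A.pderivs I = A.lderiv (List.ofFn I) := by
  simp [pderivs, lderiv, List.map_ofFn, Function.comp_def]

theorem lderiv_perm {L L' : List (Fin N)} (h : L.Perm L') : A.lderiv L = A.lderiv L' := by
  apply (h.map A.pderiv).prod_eq'
  rw [List.pairwise_map]
  exact List.pairwise_of_forall A.pderiv_comm

theorem conj_lderiv (L : List (Fin N)) (f : A.Fn) :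
    A.conj (A.lderiv L f) = A.lderiv L (A.conj f) := by
  induction L with
  | nil => rfl
  | cons i L ih =>
    simp only [lderiv_cons, Module.End.mul_apply, conj_pderiv, ih]

/-- The linear function `p_j x^j`. -/
def lin (p : Fin N → ℝ) : A.Fn := ∑ j, ((p j : ℝ) : ℂ) • A.coord j

theorem conj_lin (p : Fin N → ℝ) : A.conj (A.lin p) = A.lin p := by
  simp [lin, conj_sum, conj_smul, conj_coord, -Complex.coe_smul]

theorem pderiv_lin (i : Fin N) (p : Fin N → ℝ) : A.pderiv i (A.lin p) = ((p i : ℝ) : ℂ) • 1 := by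
  simp [lin, pderiv_coord]

theorem pderiv_lin_pow (i : Fin N) (p : Fin N → ℝ) (n : ℕ) :
    A.pderiv i (A.lin p ^ n) = ((n : ℂ) * ((p i : ℝ) : ℂ)) • A.lin p ^ (n - 1) := by
  induction n with
  | zero => simp [pderiv_one]
  | succ n ih =>
    rw [pow_succ, pderiv_mul, ih, pderiv_lin]
    cases n with
    | zero => simp
    | succ n =>
      simp only [Nat.add_sub_cancel, smul_mul_assoc, mul_smul_comm, mul_one, ← pow_succ]
      rw [← add_smul]
      congr 1
      push_cast
      ring

end FunctionAlgebra

/-- The monomial `∏ p_i` over a list of indices. -/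
def mon {N : ℕ} (p : Fin N → ℝ) (L : List (Fin N)) : ℂ := (L.map fun i => ((p i : ℝ) : ℂ)).prod

@[simp] theorem mon_nil {N : ℕ} (p : Fin N → ℝ) : mon p [] = 1 := rfl

@[simp] theorem mon_cons {N : ℕ} (p : Fin N → ℝ) (i : Fin N) (L : List (Fin N)) :
    mon p (i :: L) = ((p i : ℝ) : ℂ) * mon p L := by simp [mon]

theorem mon_append {N : ℕ} (p : Fin N → ℝ) (L L' : List (Fin N)) :
    mon p (L ++ L') = mon p L * mon p L' := by simp [mon]

theorem prod_eq_mon {N n : ℕ} (p : Fin N → ℝ) (I : Fin n → Fin N) :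
    ∏ a, ((p (I a) : ℝ) : ℂ) = mon p (List.ofFn I) := by
  simp [mon, List.map_ofFn, List.prod_ofFn]

theorem mon_perm {N : ℕ} (p : Fin N → ℝ) {L L' : List (Fin N)} (h : L.Perm L') :
    mon p L = mon p L' := (h.map _).prod_eq

theorem conj_mon {N : ℕ} (p : Fin N → ℝ) (L : List (Fin N)) :
    (starRingEnd ℂ) (mon p L) = mon p L := by
  induction L with
  | nil => simp
  | cons i L ih => simp [ih]

/-- The falling factorial records the number of derivatives, and the remaining factor is the symbol
at $p$; letting $q$ vary therefore separates the orders of an operator. -/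
theorem FunctionAlgebra.lderiv_lin_pow {N : ℕ} (A : FunctionAlgebra N) (p : Fin N → ℝ)
    (L : List (Fin N)) (q : ℕ) :
    A.lderiv L (A.lin p ^ q) =
      ((q.descFactorial L.length : ℂ) * mon p L) • A.lin p ^ (q - L.length) := by
  induction L with
  | nil => simp
  | cons i L ih =>
    rw [A.lderiv_cons, Module.End.mul_apply, ih, map_smul, A.pderiv_lin_pow, smul_smul,
      List.length_cons, Nat.descFactorial_succ, mon_cons, Nat.sub_sub]
    congr 1
    push_cast
    ring

/-! ### Symmetric tensors, their contractions, and homogeneous polynomials. -/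

variable {N : ℕ}

/-- Both tuples take each value equally often, so bijections between the fibres glue to a
permutation. -/
theorem exists_perm_of_sum_single_eq {m : ℕ} {I J : Fin m → Fin N}
    (h : ∑ a, Finsupp.single (I a) 1 = ∑ a, Finsupp.single (J a) (1 : ℕ)) :
    ∃ σ : Equiv.Perm (Fin m), J ∘ σ = I := by
  classical
  have hc : ∀ (K : Fin m → Fin N) i,
      (∑ a, Finsupp.single (K a) (1 : ℕ)) i = Fintype.card {a // K a = i} := by
    intro K i
    rw [Finsupp.finsetSum_apply, Fintype.card_subtype, Finset.card_filter]
    exact Finset.sum_congr rfl fun a _ => by rw [Finsupp.single_apply]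
  have he : ∀ i, Nonempty ({a // I a = i} ≃ {a // J a = i}) := fun i =>
    ⟨Fintype.equivOfCardEq (by rw [← hc, ← hc, h])⟩
  refine ⟨Equiv.ofFiberEquiv fun i => (he i).some, ?_⟩
  funext a
  exact Equiv.ofFiberEquiv_map _ a

/-- A symmetric tensor is determined by its contraction with all real vectors. -/
theorem eq_zero_of_contract_eq_zero {V : Type*} [AddCommGroup V] [Module ℂ V] {m : ℕ}
    {c : (Fin m → Fin N) → V} (hc : ∀ I (σ : Equiv.Perm (Fin m)), c (I ∘ σ) = c I)
    (h : ∀ p : Fin N → ℝ, ∑ I, mon p (List.ofFn I) • c I = 0) (J : Fin m → Fin N) : c J = 0 := by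
  classical
  rw [← Module.forall_dual_apply_eq_zero_iff ℂ]
  intro l
  set d : (Fin m → Fin N) → (Fin N →₀ ℕ) := fun I => ∑ a, Finsupp.single (I a) 1 with hd
  set Q : MvPolynomial (Fin N) ℂ := ∑ I, MvPolynomial.monomial (d I) (l (c I)) with hQ
  have hQ0 : Q = 0 := by
    -- The contractions are known at real $p$ only; a complex polynomial vanishing on a product of
    -- infinite sets is zero.
    refine MvPolynomial.funext_set (fun _ => Set.range ((↑) : ℝ → ℂ))
      (fun _ => Set.infinite_range_of_injective Complex.ofReal_injective) ?_
    intro x hx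
    choose p hp using fun i => hx i (Set.mem_univ i)
    obtain rfl : (fun i => ((p i : ℝ) : ℂ)) = x := funext hp
    have hl := congrArg l (h p)
    rw [map_sum, map_zero] at hl
    rw [hQ, map_sum, map_zero, ← hl]
    refine Finset.sum_congr rfl fun I _ => ?_
    rw [map_smul, ← prod_eq_mon, smul_eq_mul, mul_comm, MvPolynomial.eval_monomial, hd]
    congr 1
    rw [← Finsupp.prod_finsetSum_index (by simp) (by intros; rw [pow_add])]
    exact Finset.prod_congr rfl fun a _ => by simp
  have hco : Q.coeff (d J) = 0 := by rw [hQ0, MvPolynomial.coeff_zero]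
  rw [hQ, MvPolynomial.coeff_sum] at hco
  simp only [MvPolynomial.coeff_monomial] at hco
  -- The tuples with the exponent vector of `J` are its rearrangements and carry equal values, so
  -- the coefficient is a positive multiple of `l (c J)`.
  rw [← Finset.sum_filter, Finset.sum_congr rfl (g := fun _ => l (c J)), Finset.sum_const,
    smul_eq_zero] at hco
  · rcases hco with hco | hco
    · exact absurd (Finset.card_eq_zero.1 hco) (Finset.Nonempty.ne_empty ⟨J, by simp⟩)
    · exact hco
  · intro I hI
    obtain ⟨σ, rfl⟩ := exists_perm_of_sum_single_eq (Finset.mem_filter.1 hI).2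
    rw [hc]

theorem ofFn_comp_perm {m : ℕ} (I : Fin m → Fin N) (σ : Equiv.Perm (Fin m)) :
    (List.ofFn (I ∘ σ)).Perm (List.ofFn I) := Equiv.Perm.ofFn_comp_perm σ I

theorem sum_comp_perm {V : Type*} [AddCommMonoid V] {m : ℕ} (σ : Equiv.Perm (Fin m))
    (f : (Fin m → Fin N) → V) : ∑ I, f (I ∘ σ) = ∑ I, f I :=
  Fintype.sum_equiv (Equiv.arrowCongr σ.symm (Equiv.refl _)) _ _ fun I => by
    congr 1

/-- Symmetrization only multiplies contractions by $m!$, so the symmetrized tensor falls under the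
symmetric case. -/
theorem sum_perm_eq_zero_of_contract_eq_zero {V : Type*} [AddCommGroup V] [Module ℂ V] {m : ℕ}
    {c : (Fin m → Fin N) → V} (h : ∀ p : Fin N → ℝ, ∑ I, mon p (List.ofFn I) • c I = 0)
    (J : Fin m → Fin N) : ∑ σ : Equiv.Perm (Fin m), c (J ∘ σ) = 0 := by
  refine eq_zero_of_contract_eq_zero (c := fun J => ∑ σ : Equiv.Perm (Fin m), c (J ∘ σ)) ?_ ?_ J
  · intro I τ
    exact Fintype.sum_equiv (Equiv.mulLeft τ) _ _ fun σ => by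
      simp [Equiv.Perm.coe_mul, Function.comp_assoc]
  · intro p
    simp only [Finset.smul_sum]
    rw [Finset.sum_comm]
    refine Finset.sum_eq_zero fun σ _ => ?_
    rw [← h p, ← sum_comp_perm σ fun I => mon p (List.ofFn I) • c I]
    exact Finset.sum_congr rfl fun I _ => by rw [mon_perm p (ofFn_comp_perm I σ)]

/-- The pairing of a symmetric tensor with a tensor whose symmetrization vanishes is zero. -/
theorem sum_mul_eq_zero_of_contract_eq_zero {V : Type*} [Ring V] [Algebra ℂ V] {m : ℕ}
    {c s : (Fin m → Fin N) → V} (h : ∀ p : Fin N → ℝ, ∑ I, mon p (List.ofFn I) • c I = 0)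
    (hs : ∀ I (σ : Equiv.Perm (Fin m)), s (I ∘ σ) = s I) : ∑ I, s I * c I = 0 := by
  have h1 : (m.factorial : ℂ) • ∑ I, s I * c I = 0 := by
    calc (m.factorial : ℂ) • ∑ I, s I * c I
        = ∑ σ : Equiv.Perm (Fin m), ∑ I, s I * c I := by
          rw [Finset.sum_const, Finset.card_univ, Fintype.card_perm, Fintype.card_fin,
            Nat.cast_smul_eq_nsmul]
      _ = ∑ σ : Equiv.Perm (Fin m), ∑ I, s I * c (I ∘ σ) := by
          refine Finset.sum_congr rfl fun σ _ => ?_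
          rw [← sum_comp_perm σ]
          exact Finset.sum_congr rfl fun I _ => by rw [hs]
      _ = 0 := by
          rw [Finset.sum_comm]
          refine Finset.sum_eq_zero fun I _ => ?_
          rw [← Finset.mul_sum, sum_perm_eq_zero_of_contract_eq_zero h, mul_zero]
  exact (smul_eq_zero.1 h1).resolve_left (Nat.cast_ne_zero.2 m.factorial_ne_zero)

theorem sum_fin_succ {V : Type*} [AddCommMonoid V] (m : ℕ) (f : List (Fin N) → V) :
    ∑ I : Fin (m + 1) → Fin N, f (List.ofFn I) =
      ∑ i, ∑ I : Fin m → Fin N, f (i :: List.ofFn I) := by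
  rw [← Fintype.sum_prod_type', ← (Fin.consEquiv fun _ => Fin N).sum_comp]
  exact Finset.sum_congr rfl fun x _ => by simp [Fin.consEquiv]

/-- Homogeneous polynomial functions of degree `m` in `p`. -/
def homogeneous (N : ℕ) (V : Type*) [AddCommGroup V] [Module ℂ V] (m : ℕ) :
    Submodule ℂ ((Fin N → ℝ) → V) :=
  Submodule.span ℂ {f | ∃ L : List (Fin N), L.length = m ∧ ∃ c : V, f = fun p => mon p L • c}

theorem const_mem_homogeneous {V : Type*} [AddCommGroup V] [Module ℂ V] (c : V) :
    (fun _ => c) ∈ homogeneous N V 0 :=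
  Submodule.subset_span ⟨[], rfl, c, by simp⟩

theorem linear_mem_homogeneous {V : Type*} [AddCommGroup V] [Module ℂ V] (c : Fin N → V) :
    (fun p : Fin N → ℝ => ∑ i, ((p i : ℝ) : ℂ) • c i) ∈ homogeneous N V 1 := by
  have : (fun p : Fin N → ℝ => ∑ i, ((p i : ℝ) : ℂ) • c i) =
      ∑ i, fun p : Fin N → ℝ => ((p i : ℝ) : ℂ) • c i := by
    funext p; rw [Finset.sum_apply]
  rw [this]
  exact Submodule.sum_mem _ fun i _ => Submodule.subset_span ⟨[i], rfl, c i, by simp [mon]⟩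

theorem map_mem_homogeneous {V W : Type*} [AddCommGroup V] [Module ℂ V] [AddCommGroup W]
    [Module ℂ W] (l : V →ₗ[ℂ] W) {m : ℕ} {f : (Fin N → ℝ) → V} (hf : f ∈ homogeneous N V m) :
    (fun p => l (f p)) ∈ homogeneous N W m := by
  induction hf using Submodule.span_induction with
  | mem f hf =>
    obtain ⟨L, hL, c, rfl⟩ := hf
    exact Submodule.subset_span ⟨L, hL, l c, by simp⟩
  | zero =>
    have : (fun p => l ((0 : (Fin N → ℝ) → V) p)) = 0 := by funext p; simp
    exact this ▸ Submodule.zero_mem _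
  | add f g _ _ hf hg =>
    have : (fun p => l ((f + g) p)) = (fun p => l (f p)) + fun p => l (g p) := by
      funext p; simp
    exact this ▸ Submodule.add_mem _ hf hg
  | smul a f _ hf =>
    have : (fun p => l ((a • f) p)) = a • fun p => l (f p) := by funext p; simp
    exact this ▸ Submodule.smul_mem _ a hf

theorem mul_mem_homogeneous {V : Type*} [Ring V] [Algebra ℂ V] {m n : ℕ}
    {f g : (Fin N → ℝ) → V} (hf : f ∈ homogeneous N V m) (hg : g ∈ homogeneous N V n) :
    f * g ∈ homogeneous N V (m + n) := by
  induction hf, hg using Submodule.span_induction₂ with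
  | mem_mem f g hf hg =>
    obtain ⟨L, hL, c, rfl⟩ := hf
    obtain ⟨L', hL', c', rfl⟩ := hg
    refine Submodule.subset_span ⟨L ++ L', by simp [hL, hL'], c * c', ?_⟩
    funext p
    simp [mon_append, smul_smul, mul_comm]
  | zero_left => simp
  | zero_right => simp
  | add_left f g h _ _ _ h1 h2 => rw [add_mul]; exact Submodule.add_mem _ h1 h2
  | add_right f g h _ _ _ h1 h2 => rw [mul_add]; exact Submodule.add_mem _ h1 h2
  | smul_left a f g _ _ h => rw [smul_mul_assoc]; exact Submodule.smul_mem _ a h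
  | smul_right a f g _ _ h => rw [mul_smul_comm]; exact Submodule.smul_mem _ a h

theorem pow_mem_homogeneous {V : Type*} [Ring V] [Algebra ℂ V]
    {f : (Fin N → ℝ) → V} (hf : f ∈ homogeneous N V 1) (n : ℕ) :
    f ^ n ∈ homogeneous N V n := by
  induction n with
  | zero => rw [pow_zero]; exact const_mem_homogeneous (1 : V)
  | succ n ih => rw [pow_succ]; exact mul_mem_homogeneous ih hf

/-- A homogeneous polynomial function is the contraction of a symmetric tensor. -/
theorem exists_symm_of_mem_homogeneous {V : Type*} [AddCommGroup V] [Module ℂ V] {m : ℕ}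
    {f : (Fin N → ℝ) → V} (hf : f ∈ homogeneous N V m) :
    ∃ c : (Fin m → Fin N) → V, (∀ I (σ : Equiv.Perm (Fin m)), c (I ∘ σ) = c I) ∧
      ∀ p, f p = ∑ I, mon p (List.ofFn I) • c I := by
  classical
  induction hf using Submodule.span_induction with
  | mem f hf =>
    obtain ⟨L, rfl, c, rfl⟩ := hf
    set J : Fin L.length → Fin N := L.get with hJ
    -- The symmetrized indicator of the index tuple `L`; each permutation contributes the same
    -- monomial after reindexing.
    refine ⟨fun I => ((L.length.factorial : ℂ)⁻¹) • ∑ σ : Equiv.Perm (Fin L.length),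
      if I ∘ σ = J then c else 0, ?_, ?_⟩
    · intro I τ
      refine congrArg (fun x => ((L.length.factorial : ℂ)⁻¹) • x) ?_
      exact Fintype.sum_equiv (Equiv.mulLeft τ) _ _ fun σ => by
        simp only [Equiv.coe_mulLeft, Equiv.Perm.coe_mul, Function.comp_assoc]
        congr
    · intro p
      have h1 : ∀ σ : Equiv.Perm (Fin L.length),
          (∑ I : Fin L.length → Fin N, mon p (List.ofFn I) • if I ∘ σ = J then c else 0) =
            mon p L • c := by
        intro σ
        have h2 : ∀ I, mon p (List.ofFn I) • (if I ∘ σ = J then c else 0) =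
            mon p (List.ofFn (I ∘ σ)) • if I ∘ σ = J then c else 0 := fun I => by
          rw [mon_perm p (ofFn_comp_perm I σ)]
        simp only [h2]
        rw [sum_comp_perm σ fun I => mon p (List.ofFn I) • if I = J then c else 0]
        simp only [smul_ite, smul_zero, Finset.sum_ite_eq', Finset.mem_univ, if_true]
        rw [hJ, List.ofFn_get]
      simp only [smul_comm (mon p _) (_⁻¹ : ℂ), ← Finset.smul_sum]
      simp only [Finset.smul_sum (s := (Finset.univ : Finset (Equiv.Perm (Fin L.length))))
        (r := mon p _)]
      rw [Finset.sum_comm]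
      simp only [h1]
      rw [Finset.sum_const, Finset.card_univ, Fintype.card_perm, Fintype.card_fin,
        ← Nat.cast_smul_eq_nsmul ℂ, smul_smul, inv_mul_cancel₀, one_smul]
      exact Nat.cast_ne_zero.2 (Nat.factorial_ne_zero _)
  | zero => exact ⟨0, by simp, by simp⟩
  | add f g _ _ hf hg =>
    obtain ⟨c, hc, hf⟩ := hf
    obtain ⟨d, hd, hg⟩ := hg
    exact ⟨c + d, fun I σ => by simp [hc, hd],
      fun p => by simp [hf, hg, Finset.sum_add_distrib]⟩
  | smul a f _ hf =>
    obtain ⟨c, hc, hf⟩ := hf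
    exact ⟨a • c, fun I σ => by simp [hc],
      fun p => by simp [hf, Finset.smul_sum, smul_comm a]⟩

/-! ### Splitting $(E+Y)^n$ by degree in $Y$. -/

section Tail

variable {R : Type*} [Ring R] (E Y : R)

/-- The part of `(E + Y) ^ n` linear in `Y`. -/
def linearPart (n : ℕ) : R := ∑ j ∈ Finset.range n, E ^ j * Y * E ^ (n - 1 - j)

/-- The part of `(E + Y) ^ n` at least quadratic in `Y`. -/
def quadraticPart (n : ℕ) : R := (E + Y) ^ n - E ^ n - linearPart E Y n

theorem linearPart_succ (n : ℕ) : linearPart E Y (n + 1) = E * linearPart E Y n + Y * E ^ n := by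
  rw [linearPart, Finset.sum_range_succ', linearPart, Finset.mul_sum]
  congr 1
  · refine Finset.sum_congr rfl fun j hj => ?_
    rw [pow_succ', mul_assoc, mul_assoc, mul_assoc]
    congr 4
    omega
  · simp

theorem quadraticPart_zero : quadraticPart E Y 0 = 0 := by simp [quadraticPart, linearPart]

theorem quadraticPart_succ (n : ℕ) :
    quadraticPart E Y (n + 1) = (E + Y) * quadraticPart E Y n + Y * linearPart E Y n := by
  rw [quadraticPart, quadraticPart, linearPart_succ, pow_succ', pow_succ' E]
  noncomm_ring

theorem quadraticPart_one : quadraticPart E Y 1 = 0 := by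
  rw [quadraticPart_succ, quadraticPart_zero]
  simp [linearPart]

end Tail

/-! ### Formal series of operators as a model for operators on $A[[\alpha]]$. -/

namespace FunctionAlgebra

variable {N : ℕ} (A : FunctionAlgebra N)

/-- Formal power series of operators on `A`. -/
def Op : Type := PowerSeries (Module.End ℂ A.Fn)

instance : Ring A.Op := inferInstanceAs (Ring (PowerSeries (Module.End ℂ A.Fn)))

instance : Algebra ℂ A.Op := inferInstanceAs (Algebra ℂ (PowerSeries (Module.End ℂ A.Fn)))

/-- The coefficients of a formal series of operators. -/
def opCoeff (r : ℕ) : A.Op →ₗ[ℂ] Module.End ℂ A.Fn where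
  toFun D := PowerSeries.coeff (R := Module.End ℂ A.Fn) r D
  map_add' D D' := map_add (PowerSeries.coeff (R := Module.End ℂ A.Fn) r) D D'
  map_smul' c D := PowerSeries.coeff_smul (S := Module.End ℂ A.Fn) r D c

/-- The formal series with given coefficients. -/
def opMk (D : ℕ → Module.End ℂ A.Fn) : A.Op := PowerSeries.mk D

@[simp] theorem opCoeff_opMk (D : ℕ → Module.End ℂ A.Fn) (r : ℕ) : A.opCoeff r (A.opMk D) = D r :=
  PowerSeries.coeff_mk r D

theorem opCoeff_mul (D D' : A.Op) (r : ℕ) : A.opCoeff r (D * D') =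
    ∑ q ∈ Finset.HasAntidiagonal.antidiagonal r, A.opCoeff q.1 D * A.opCoeff q.2 D' :=
  PowerSeries.coeff_mul (R := Module.End ℂ A.Fn) r D D'

theorem opCoeff_one (r : ℕ) : A.opCoeff r 1 = if r = 0 then 1 else 0 :=
  PowerSeries.coeff_one (R := Module.End ℂ A.Fn) r

variable {A} in
theorem op_ext {D D' : A.Op} (h : ∀ r f, A.opCoeff r D f = A.opCoeff r D' f) : D = D' :=
  PowerSeries.ext (R := Module.End ℂ A.Fn) fun r => LinearMap.ext (h r)

/-- Multiplication operators on `A`. -/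
def mulOp : A.Fn →ₐ[ℂ] Module.End ℂ A.Fn := Algebra.lmul ℂ A.Fn

@[simp] theorem mulOp_apply (f g : A.Fn) : A.mulOp f g = f * g := rfl

theorem opSeries_mul (D D' : A.Op) :
    A.opSeries (fun r => A.opCoeff r (D * D')) =
      A.opSeries (fun r => A.opCoeff r D) * A.opSeries fun r => A.opCoeff r D' := by
  apply LinearMap.ext
  intro F
  ext1 n
  simp only [opSeries, LinearMap.coe_mk, AddHom.coe_mk, PowerSeries.coeff_mk,
    Module.End.mul_apply, opCoeff_mul, LinearMap.sum_apply, Finset.smul_sum,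
    map_sum, map_smul, smul_smul, ← pow_add]
  simp only [Finset.sum_sigma']
  refine Finset.sum_nbij' (fun x => ⟨(x.2.1, x.2.2 + x.1.2), (x.2.2, x.1.2)⟩)
    (fun x => ⟨(x.1.1 + x.2.1, x.2.2), (x.1.1, x.2.1)⟩) ?_ ?_ ?_ ?_ ?_
  · rintro ⟨⟨a, b⟩, c, d⟩ h
    simp only [Finset.mem_sigma, Finset.HasAntidiagonal.mem_antidiagonal] at h ⊢
    obtain ⟨rfl, rfl⟩ := h
    exact ⟨by ring, trivial⟩
  · rintro ⟨⟨a, b⟩, c, d⟩ h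
    simp only [Finset.mem_sigma, Finset.HasAntidiagonal.mem_antidiagonal] at h ⊢
    obtain ⟨rfl, rfl⟩ := h
    exact ⟨by ring, trivial⟩
  · rintro ⟨⟨a, b⟩, c, d⟩ h
    simp only [Finset.mem_sigma, Finset.HasAntidiagonal.mem_antidiagonal] at h
    obtain ⟨-, rfl⟩ := h
    rfl
  · rintro ⟨⟨a, b⟩, c, d⟩ h
    simp only [Finset.mem_sigma, Finset.HasAntidiagonal.mem_antidiagonal] at h
    obtain ⟨-, rfl⟩ := h
    rfl
  · rintro ⟨⟨a, b⟩, c, d⟩ h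
    simp only [Finset.mem_sigma, Finset.HasAntidiagonal.mem_antidiagonal] at h
    obtain ⟨-, rfl⟩ := h
    rfl

theorem coeff_opSeries_C (D : ℕ → Module.End ℂ A.Fn) (g : A.Fn) (n : ℕ) :
    PowerSeries.coeff n (A.opSeries D (PowerSeries.C g)) = Complex.I ^ n • D n g := by
  simp only [opSeries, LinearMap.coe_mk, AddHom.coe_mk, PowerSeries.coeff_mk]
  rw [Finset.sum_eq_single (n, 0)]
  · simp
  · rintro ⟨a, b⟩ h hne
    have hb : b ≠ 0 := by
      rintro rfl
      exact hne (by simpa using h)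
    simp [PowerSeries.coeff_C, hb]
  · simp

theorem opSeries_one : A.opSeries (fun r => A.opCoeff r 1) = 1 := by
  apply LinearMap.ext
  intro F
  ext1 n
  simp only [opSeries, LinearMap.coe_mk, AddHom.coe_mk, PowerSeries.coeff_mk]
  rw [Finset.sum_eq_single (0, n)]
  · simp [opCoeff_one]
  · rintro ⟨a, b⟩ h hne
    have ha : a ≠ 0 := by
      rintro rfl
      exact hne (by simpa using h)
    simp [opCoeff_one, ha]
  · simp

/-- A formal series `∑ α^r D_r` of operators acts on `A[[α]]` as `∑ (iα)^r D_r`. -/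
def toEndLinear : A.Op →ₗ[ℂ] Module.End ℂ A.Series where
  toFun D := A.opSeries fun r => A.opCoeff r D
  map_add' D D' := by
    apply LinearMap.ext
    intro F
    ext1 n
    simp [opSeries, Finset.sum_add_distrib]
  map_smul' c D := by
    apply LinearMap.ext
    intro F
    ext1 n
    simp [opSeries, Finset.smul_sum, smul_comm c]

theorem toEndLinear_apply (D : A.Op) :
    A.toEndLinear D = A.opSeries fun r => A.opCoeff r D := rfl

/-- The algebra homomorphism underlying `toEndLinear`. -/
def toEnd : A.Op →ₐ[ℂ] Module.End ℂ A.Series :=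
  AlgHom.ofLinearMap A.toEndLinear (by rw [toEndLinear_apply, opSeries_one])
    (fun D D' => by
      rw [toEndLinear_apply, toEndLinear_apply, toEndLinear_apply, opSeries_mul])

theorem toEnd_apply (D : A.Op) : A.toEnd D = A.opSeries fun r => A.opCoeff r D := by
  rw [← toEndLinear_apply]
  rfl

theorem toEnd_mk (D : ℕ → Module.End ℂ A.Fn) : A.toEnd (A.opMk D) = A.opSeries D := by
  rw [toEnd_apply]
  simp only [opCoeff_opMk]

theorem coeff_toEnd_C (D : A.Op) (g : A.Fn) (n : ℕ) :
    PowerSeries.coeff n (A.toEnd D (PowerSeries.C g)) =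
      Complex.I ^ n • A.opCoeff n D g :=
  by rw [toEnd_apply, coeff_opSeries_C]

/-- Applying the operator to constant series already recovers each coefficient, up to the nonzero
factor $\mathrm i^n$. Identities on $A[[\alpha]]$ can thus be checked coefficientwise in `Op`, where
no powers of $\mathrm i$ occur. -/
theorem toEnd_injective : Function.Injective A.toEnd := by
  intro D D' h
  refine op_ext fun n g => ?_
  have h1 := A.coeff_toEnd_C D g n
  rw [h, coeff_toEnd_C] at h1
  exact (smul_right_injective _ (pow_ne_zero n Complex.I_ne_zero) h1).symm

/-- Multiplication operators as constant series. -/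
def fnOp : A.Fn →ₐ[ℂ] A.Op :=
  AlgHom.ofLinearMap
    { toFun := fun f => A.opMk fun r => if r = 0 then A.mulOp f else 0
      map_add' := fun f g => op_ext fun r h => by
        simp only [map_add, LinearMap.add_apply, opCoeff_opMk]
        split_ifs <;> simp
      map_smul' := fun c f => op_ext fun r h => by
        simp only [map_smul, RingHom.id_apply, LinearMap.smul_apply, opCoeff_opMk]
        split_ifs <;> simp }
    (op_ext fun r h => by
      simp only [LinearMap.coe_mk, AddHom.coe_mk, opCoeff_opMk, opCoeff_one, map_one])
    (fun f g => op_ext fun r h => by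
      rw [opCoeff_mul]
      simp only [LinearMap.coe_mk, AddHom.coe_mk, opCoeff_opMk]
      rw [Finset.sum_eq_single (0, r)]
      · rw [if_pos rfl]
        split_ifs <;> simp
      · rintro ⟨a, b⟩ hab hne
        have ha : a ≠ 0 := by
          rintro rfl
          exact hne (by simpa using hab)
        simp [ha]
      · simp)

theorem opCoeff_fnOp (f : A.Fn) (r : ℕ) :
    A.opCoeff r (A.fnOp f) = if r = 0 then A.mulOp f else 0 := by
  have h : A.fnOp f = A.opMk fun r => if r = 0 then A.mulOp f else 0 := rfl
  rw [h, opCoeff_opMk]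

theorem fnOp_lin (p : Fin N → ℝ) :
    A.fnOp (A.lin p) = ∑ i, ((p i : ℝ) : ℂ) • A.fnOp (A.coord i) := by
  rw [lin, map_sum]
  simp only [map_smul]

theorem opCoeff_fnOp_mul (f : A.Fn) (D : A.Op) (n : ℕ) :
    A.opCoeff n (A.fnOp f * D) = A.mulOp f * A.opCoeff n D := by
  rw [opCoeff_mul, Finset.sum_eq_single (0, n)]
  · simp [opCoeff_fnOp]
  · rintro ⟨a, b⟩ hab hne
    have ha : a ≠ 0 := by
      rintro rfl
      exact hne (by simpa using hab)
    simp [opCoeff_fnOp, ha]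
  · simp

theorem opCoeff_mul_fnOp (f : A.Fn) (D : A.Op) (n : ℕ) :
    A.opCoeff n (D * A.fnOp f) = A.opCoeff n D * A.mulOp f := by
  rw [opCoeff_mul, Finset.sum_eq_single (n, 0)]
  · simp [opCoeff_fnOp]
  · rintro ⟨a, b⟩ hab hne
    have hb : b ≠ 0 := by
      rintro rfl
      exact hne (by simpa using hab)
    simp [opCoeff_fnOp, hb]
  · simp

theorem toEnd_fnOp_coord (i : Fin N) : A.toEnd (A.fnOp (A.coord i)) = A.mulCoord i := by
  apply LinearMap.ext
  intro F
  ext1 n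
  rw [toEnd_apply]
  simp only [opSeries, LinearMap.coe_mk, AddHom.coe_mk, PowerSeries.coeff_mk]
  rw [Finset.sum_eq_single (0, n)]
  · simp [opCoeff_fnOp, mulCoord]
  · rintro ⟨a, b⟩ h hne
    have ha : a ≠ 0 := by
      rintro rfl
      exact hne (by simpa using h)
    simp [opCoeff_fnOp, ha]
  · simp

end FunctionAlgebra

/-! ### The operators $\hat x^i$ and $F$ without factors of $\mathrm i$. -/

namespace Coeffs

variable {N : ℕ} {A : FunctionAlgebra N} (Γ : Coeffs A)

/-- The series of operators representing `x̂^i - x^i`. -/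
def yop (i : Fin N) : A.Op :=
  A.opMk fun r => ∑ m ∈ Finset.Icc 1 r, ∑ I : Fin m → Fin N,
    LinearMap.mulLeft ℂ (Γ i (r - m) m I) * A.pderivs I

/-- The series of operators representing `x̂^i`. -/
def xop (i : Fin N) : A.Op := A.fnOp (A.coord i) + Γ.yop i

/-- The series of operators representing `p_i (x̂^i - x^i)`. -/
def linY (p : Fin N → ℝ) : A.Op := ∑ i, ((p i : ℝ) : ℂ) • Γ.yop i

/-- The series of operators representing `p_i x̂^i`. -/
def linX (p : Fin N → ℝ) : A.Op := A.fnOp (A.lin p) + Γ.linY p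

theorem linX_eq (p : Fin N → ℝ) : Γ.linX p = ∑ i, ((p i : ℝ) : ℂ) • Γ.xop i := by
  rw [linX, linY, A.fnOp_lin, ← Finset.sum_add_distrib]
  simp only [xop, smul_add]

theorem toEnd_xop (i : Fin N) : A.toEnd (Γ.xop i) = Γ.xhat i := by
  rw [xop, map_add, A.toEnd_fnOp_coord, yop, A.toEnd_mk]
  rfl

theorem toEnd_yop (i : Fin N) : A.toEnd (Γ.yop i) = Γ.xhat i - A.mulCoord i := by
  rw [← toEnd_xop, xop, map_add, A.toEnd_fnOp_coord]
  exact (add_sub_cancel_left (A.mulCoord i) (A.toEnd (Γ.yop i))).symm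

theorem opA_eq (p : Fin N → ℝ) : A.opA p = -Complex.I • A.toEnd (A.fnOp (A.lin p)) := by
  rw [A.fnOp_lin, map_sum, Finset.smul_sum]
  simp only [map_smul, A.toEnd_fnOp_coord, smul_smul]
  rfl

theorem opB_eq (p : Fin N → ℝ) : Γ.opB p = -Complex.I • A.toEnd (Γ.linY p) := by
  rw [linY, map_sum, Finset.smul_sum]
  simp only [map_smul, toEnd_yop, smul_smul]
  rfl

/-- The part of degree `m` in `p` of `exp(-p_j x^j) exp(p_j x̂^j)`, without the terms of degree zero
and one in `x̂ - x`. -/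
def tail (m : ℕ) (p : Fin N → ℝ) : A.Op :=
  ∑ q ∈ Finset.HasAntidiagonal.antidiagonal m, (((q.1.factorial : ℂ) * (q.2.factorial : ℂ))⁻¹) •
    ((-A.fnOp (A.lin p)) ^ q.1 * quadraticPart (A.fnOp (A.lin p)) (Γ.linY p) q.2)

theorem expTail_eq (m : ℕ) (p : Fin N → ℝ) :
    Γ.expTail m p = (-Complex.I) ^ m • A.toEnd (Γ.tail m p) := by
  rw [expTail, tail, map_sum, Finset.smul_sum]
  refine Finset.sum_congr rfl fun q hq => ?_
  obtain rfl := Finset.HasAntidiagonal.mem_antidiagonal.1 hq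
  rw [map_smul, smul_comm _ (_⁻¹ : ℂ)]
  congr 1
  rw [map_mul, map_pow, map_neg, opA_eq, opB_eq, pow_add, ← smul_mul_smul_comm, ← smul_pow,
    smul_neg, ← smul_add, smul_pow, smul_pow]
  congr 1
  rw [quadraticPart, linearPart, map_sub, map_sub, map_pow, map_pow, map_add, map_sum, smul_sub,
    smul_sub, Finset.smul_sum]
  congr 1
  refine Finset.sum_congr rfl fun j hj => ?_
  have hj' : q.2 = j + 1 + (q.2 - 1 - j) := by have := Finset.mem_range.1 hj; omega
  rw [map_mul, map_mul, map_pow, map_pow, smul_pow, smul_pow, smul_mul_smul_comm,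
    smul_mul_smul_comm, ← pow_succ, ← pow_add, ← hj']

/-- The factors $(-\mathrm i)^m$ from $-\mathrm ip$, $\mathrm i^{m+k}$ from $(\mathrm
i\alpha)^{m+k}$ and $\mathrm i^{-k}$ from the definition of $F$ cancel exactly. Hence $F$ is given
by the real exponentials $e^{-p\cdot x}e^{p\cdot\hat x}$, which makes the reality argument possible.
-/
theorem F_eq (i : Fin N) (k m : ℕ) (p : Fin N → ℝ) :
    Γ.F i k m p = A.opCoeff (m + k) (Γ.tail m p) (A.coord i) := by
  rw [F, expTail_eq, LinearMap.smul_apply, PowerSeries.coeff_smul, A.coeff_toEnd_C, smul_smul,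
    smul_smul]
  have : (Complex.I ^ k)⁻¹ * (-Complex.I) ^ m * Complex.I ^ (m + k) = 1 := by
    rw [pow_add, show (Complex.I ^ k)⁻¹ * (-Complex.I) ^ m * (Complex.I ^ m * Complex.I ^ k) =
      ((Complex.I ^ k)⁻¹ * Complex.I ^ k) * (-Complex.I * Complex.I) ^ m by rw [mul_pow]; ring]
    simp
  rw [this, one_smul]

end Coeffs

/-! ### Orders in $\alpha$. -/

section Tail

variable {R : Type*} [Ring R] (E Y Y' : R)

theorem linearPart_succ_sub (k : ℕ) : linearPart E Y (k + 1) - linearPart E Y' (k + 1) =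
    E * (linearPart E Y k - linearPart E Y' k) + (Y - Y') * E ^ k := by
  rw [linearPart_succ, linearPart_succ]
  noncomm_ring

theorem quadraticPart_succ_sub (k : ℕ) : quadraticPart E Y (k + 1) - quadraticPart E Y' (k + 1) =
    (E + Y) * (quadraticPart E Y k - quadraticPart E Y' k) + (Y - Y') * quadraticPart E Y' k +
      (Y * (linearPart E Y k - linearPart E Y' k) + (Y - Y') * linearPart E Y' k) := by
  rw [quadraticPart_succ, quadraticPart_succ]
  noncomm_ring

end Tail

/-- A formal series of operators is `O(α^n)`. -/
def OrderGE {N : ℕ} {A : FunctionAlgebra N} (n : ℕ) (D : A.Op) : Prop :=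
  ∀ r < n, A.opCoeff r D = 0

namespace OrderGE

variable {N : ℕ} {A : FunctionAlgebra N} {D D' : A.Op} {m n : ℕ}

theorem zero_left (D : A.Op) : OrderGE 0 D := fun _ h => absurd h (Nat.not_lt_zero _)

theorem zero (n : ℕ) : OrderGE n (0 : A.Op) := fun _ _ => map_zero _

theorem add (h : OrderGE n D) (h' : OrderGE n D') : OrderGE n (D + D') := fun r hr => by
  rw [map_add, h r hr, h' r hr, add_zero]

theorem mul (h : OrderGE m D) (h' : OrderGE n D') : OrderGE (m + n) (D * D') := fun r hr => by
  rw [A.opCoeff_mul]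
  refine Finset.sum_eq_zero fun q hq => ?_
  have hq' := Finset.HasAntidiagonal.mem_antidiagonal.1 hq
  rcases lt_or_ge q.1 m with h1 | h1
  · rw [h _ h1, zero_mul]
  · rw [h' _ (by omega), mul_zero]

theorem mul_left (h : OrderGE n D') (D : A.Op) : OrderGE n (D * D') := by
  simpa using (zero_left D).mul h

theorem mul_right (h : OrderGE n D) (D' : A.Op) : OrderGE n (D * D') := by
  simpa using h.mul (zero_left D')

theorem linearPart (E : A.Op) {Y : A.Op} (hY : OrderGE n Y) (k : ℕ) :
    OrderGE n (linearPart E Y k) := by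
  induction k with
  | zero => exact zero n
  | succ k ih =>
    rw [linearPart_succ]
    exact (ih.mul_left _).add (hY.mul_right _)

theorem quadraticPart (E : A.Op) {Y : A.Op} (hY : OrderGE n Y) (k : ℕ) :
    OrderGE n (quadraticPart E Y k) := by
  induction k with
  | zero => rw [quadraticPart_zero]; exact zero n
  | succ k ih =>
    rw [quadraticPart_succ]
    exact (ih.mul_left _).add (hY.mul_right _)

/-- Replacing one factor $Y$ by $Y-Y'$ leaves at least one further factor that is $O(\alpha)$, which
gains one order over the linear part. The two claims must be proved together, since the quadratic
recursion contains the linear part. -/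
theorem quadraticPart_sub (E : A.Op) {Y Y' : A.Op} (hY : OrderGE 1 Y)
    (hY' : OrderGE 1 Y') (h : OrderGE n (Y - Y')) (k : ℕ) :
    OrderGE n (WeylStar.linearPart E Y k - WeylStar.linearPart E Y' k) ∧
      OrderGE (n + 1) (WeylStar.quadraticPart E Y k - WeylStar.quadraticPart E Y' k) := by
  induction k with
  | zero => simpa [quadraticPart_zero, WeylStar.linearPart] using ⟨zero n, zero (n + 1)⟩
  | succ k ih =>
    rw [linearPart_succ_sub, quadraticPart_succ_sub]
    refine ⟨(ih.1.mul_left _).add (h.mul_right _), ((ih.2.mul_left _).add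
      (h.mul (hY'.quadraticPart E k))).add (OrderGE.add ?_ (h.mul (hY'.linearPart E k)))⟩
    rw [add_comm]
    exact hY.mul ih.1

end OrderGE

/-! ### Homogeneity in $p$. -/

section Tail

variable {N : ℕ} {V : Type*} [Ring V] [Algebra ℂ V]

theorem quadraticPart_mem_homogeneous {E Y : (Fin N → ℝ) → V} (hE : E ∈ homogeneous N V 1)
    (hY : Y ∈ homogeneous N V 1) (n : ℕ) :
    (fun p => quadraticPart (E p) (Y p) n) ∈ homogeneous N V n := by
  have hL : (fun p => linearPart (E p) (Y p) n) ∈ homogeneous N V n := by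
    have : (fun p => linearPart (E p) (Y p) n) =
        ∑ j ∈ Finset.range n, E ^ j * Y * E ^ (n - 1 - j) := by
      funext p
      simp [linearPart]
    rw [this]
    refine Submodule.sum_mem _ fun j hj => ?_
    have := mul_mem_homogeneous (mul_mem_homogeneous (pow_mem_homogeneous hE j) hY)
      (pow_mem_homogeneous hE (n - 1 - j))
    rwa [show j + 1 + (n - 1 - j) = n by have := Finset.mem_range.1 hj; omega] at this
  exact Submodule.sub_mem _ (Submodule.sub_mem _ (pow_mem_homogeneous
    (Submodule.add_mem _ hE hY) n) (pow_mem_homogeneous hE n)) hL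

theorem tail_mem_homogeneous {E Y : (Fin N → ℝ) → V} (hE : E ∈ homogeneous N V 1)
    (hY : Y ∈ homogeneous N V 1) (m : ℕ) :
    (fun p => ∑ q ∈ Finset.HasAntidiagonal.antidiagonal m,
      (((q.1.factorial : ℂ) * (q.2.factorial : ℂ))⁻¹) •
        ((-E p) ^ q.1 * quadraticPart (E p) (Y p) q.2)) ∈ homogeneous N V m := by
  have : (fun p => ∑ q ∈ Finset.HasAntidiagonal.antidiagonal m,
      (((q.1.factorial : ℂ) * (q.2.factorial : ℂ))⁻¹) •
        ((-E p) ^ q.1 * quadraticPart (E p) (Y p) q.2)) =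
      ∑ q ∈ Finset.HasAntidiagonal.antidiagonal m,
        (((q.1.factorial : ℂ) * (q.2.factorial : ℂ))⁻¹) •
          ((-E) ^ q.1 * fun p => quadraticPart (E p) (Y p) q.2) := by
    funext p
    simp
  rw [this]
  refine Submodule.sum_mem _ fun q hq => Submodule.smul_mem _ _ ?_
  have := mul_mem_homogeneous (pow_mem_homogeneous (Submodule.neg_mem _ hE) q.1)
    (quadraticPart_mem_homogeneous hE hY q.2)
  rwa [Finset.HasAntidiagonal.mem_antidiagonal.1 hq] at this

theorem map_quadraticPart {R S : Type*} [Ring R] [Ring S] (φ : R →+* S) (E Y : R) (n : ℕ) :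
    φ (quadraticPart E Y n) = quadraticPart (φ E) (φ Y) n := by
  simp [quadraticPart, linearPart]

end Tail

/-! ### Lower-order dependence, tracelessness and homogeneity of $F$. -/

namespace Coeffs

variable {N : ℕ} {A : FunctionAlgebra N} (Γ : Coeffs A)

theorem opCoeff_yop (i : Fin N) (r : ℕ) : A.opCoeff r (Γ.yop i) =
    ∑ m ∈ Finset.Icc 1 r, ∑ I : Fin m → Fin N,
      LinearMap.mulLeft ℂ (Γ i (r - m) m I) * A.pderivs I := by
  rw [yop, A.opCoeff_opMk]

theorem coeff_linY (p : Fin N → ℝ) (r : ℕ) : A.opCoeff r (Γ.linY p) =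
    ∑ i, ((p i : ℝ) : ℂ) • A.opCoeff r (Γ.yop i) := by
  rw [linY, map_sum]
  simp only [map_smul]

theorem orderGE_linY (p : Fin N → ℝ) : OrderGE 1 (Γ.linY p) := fun r hr => by
  obtain rfl : r = 0 := by omega
  rw [coeff_linY]
  simp [opCoeff_yop]

theorem coeff_tail (r m : ℕ) (p : Fin N → ℝ) (f : A.Fn) :
    A.opCoeff r (Γ.tail m p) f = ∑ q ∈ Finset.HasAntidiagonal.antidiagonal m,
      (((q.1.factorial : ℂ) * (q.2.factorial : ℂ))⁻¹) • ((-A.lin p) ^ q.1 *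
        A.opCoeff r (quadraticPart (A.fnOp (A.lin p)) (Γ.linY p) q.2) f) := by
  rw [tail, map_sum, LinearMap.sum_apply]
  refine Finset.sum_congr rfl fun q _ => ?_
  rw [map_smul, LinearMap.smul_apply, ← map_neg, ← map_pow, A.opCoeff_fnOp_mul]
  rfl

theorem F_congr {Γ Γ' : Coeffs A} {k m : ℕ}
    (h : ∀ j k' m', 1 ≤ m' → k' + m' < k + m → Γ j k' m' = Γ' j k' m')
    (i : Fin N) (p : Fin N → ℝ) : Γ.F i k m p = Γ'.F i k m p := by
  -- Only $\Gamma_{k'}^{j(m')}$ with $k'+m'=r$ enter the coefficient of $\alpha^r$. The quadratic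
  -- parts then agree one order further, which covers $r=m+k$ itself.
  have hY : OrderGE (m + k) (Γ.linY p - Γ'.linY p) := by
    intro r hr
    rw [map_sub, coeff_linY, coeff_linY, sub_eq_zero]
    refine Finset.sum_congr rfl fun j _ => ?_
    rw [opCoeff_yop, opCoeff_yop]
    congr 1
    refine Finset.sum_congr rfl fun m' hm' => ?_
    rw [Finset.mem_Icc] at hm'
    rw [h j (r - m') m' hm'.1 (by omega)]
  rw [F_eq, F_eq, coeff_tail, coeff_tail]
  refine Finset.sum_congr rfl fun q _ => ?_
  have := (OrderGE.quadraticPart_sub (A.fnOp (A.lin p)) (Γ.orderGE_linY p) (Γ'.orderGE_linY p)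
    hY q.2).2 (m + k) (by omega)
  rw [map_sub, sub_eq_zero] at this
  rw [this]

theorem contract_eq (i : Fin N) (k m : ℕ) (p : Fin N → ℝ) :
    Γ.contract i k m p = ∑ I : Fin m → Fin N, mon p (List.ofFn I) • Γ i k m I := by
  simp only [contract, prod_eq_mon]

theorem coeff_yop_apply (i : Fin N) (r : ℕ) (f : A.Fn) : A.opCoeff r (Γ.yop i) f =
    ∑ m ∈ Finset.Icc 1 r, ∑ I : Fin m → Fin N,
      Γ i (r - m) m I * A.lderiv (List.ofFn I) f := by
  rw [opCoeff_yop]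
  simp only [LinearMap.sum_apply, Module.End.mul_apply, LinearMap.mulLeft_apply,
    A.pderivs_eq_lderiv]

theorem coeff_yop_lin_pow (i : Fin N) (r q : ℕ) (p : Fin N → ℝ) :
    A.opCoeff r (Γ.yop i) (A.lin p ^ q) =
      ∑ m ∈ Finset.Icc 1 r, (q.descFactorial m : ℂ) •
        (Γ.contract i (r - m) m p * A.lin p ^ (q - m)) := by
  rw [coeff_yop_apply]
  refine Finset.sum_congr rfl fun m _ => ?_
  rw [contract_eq, Finset.sum_mul, Finset.smul_sum]
  refine Finset.sum_congr rfl fun I _ => ?_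
  rw [A.lderiv_lin_pow, List.length_ofFn, mul_smul_comm, smul_mul_assoc, smul_smul]

/-- On $(p\cdot x)^q$ each derivative index is contracted with $p$, so every term contains the trace
$p_i\Gamma^{i(m)}(p)^m$. -/
theorem coeff_linY_lin_pow (hΓ : Γ.IsTraceless) (r q : ℕ) (p : Fin N → ℝ) :
    A.opCoeff r (Γ.linY p) (A.lin p ^ q) = 0 := by
  rw [coeff_linY, LinearMap.sum_apply]
  simp only [LinearMap.smul_apply, coeff_yop_lin_pow, Finset.smul_sum]
  rw [Finset.sum_comm]
  refine Finset.sum_eq_zero fun m hm => ?_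
  have : ∀ i, ((p i : ℝ) : ℂ) • (q.descFactorial m : ℂ) •
      (Γ.contract i (r - m) m p * A.lin p ^ (q - m)) = (q.descFactorial m : ℂ) •
      ((((p i : ℝ) : ℂ) • Γ.contract i (r - m) m p) * A.lin p ^ (q - m)) := fun i => by
    rw [smul_comm, smul_mul_assoc]
  simp only [this]
  rw [← Finset.smul_sum, ← Finset.sum_mul, hΓ _ _ (Finset.mem_Icc.1 hm).1, zero_mul, smul_zero]

theorem linY_mul_fnOp_lin_pow_apply (hΓ : Γ.IsTraceless) (D : A.Op) (r q q' : ℕ)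
    (p : Fin N → ℝ) :
    A.opCoeff r (D * Γ.linY p * A.fnOp (A.lin p) ^ q) (A.lin p ^ q') = 0 := by
  rw [← map_pow, A.opCoeff_mul_fnOp, Module.End.mul_apply, A.mulOp_apply, ← pow_add,
    A.opCoeff_mul, LinearMap.sum_apply]
  refine Finset.sum_eq_zero fun x _ => ?_
  rw [Module.End.mul_apply, coeff_linY_lin_pow Γ hΓ, map_zero]

theorem coeff_linearPart_lin_pow (hΓ : Γ.IsTraceless) (r n q : ℕ) (p : Fin N → ℝ) :
    A.opCoeff r (linearPart (A.fnOp (A.lin p)) (Γ.linY p) n) (A.lin p ^ q) = 0 := by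
  rw [linearPart, map_sum, LinearMap.sum_apply]
  exact Finset.sum_eq_zero fun j _ => Γ.linY_mul_fnOp_lin_pow_apply hΓ _ _ _ _ _

theorem coeff_mul_apply_eq_zero {D D' : A.Op} {f : A.Fn}
    (h : ∀ r, A.opCoeff r D' f = 0) (r : ℕ) : A.opCoeff r (D * D') f = 0 := by
  rw [A.opCoeff_mul, LinearMap.sum_apply]
  refine Finset.sum_eq_zero fun x _ => ?_
  rw [Module.End.mul_apply, h, map_zero]

theorem coeff_quadraticPart_lin_pow (hΓ : Γ.IsTraceless) (r n q : ℕ) (p : Fin N → ℝ) :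
    A.opCoeff r (quadraticPart (A.fnOp (A.lin p)) (Γ.linY p) n) (A.lin p ^ q) = 0 := by
  induction n generalizing r with
  | zero => rw [quadraticPart_zero, map_zero, LinearMap.zero_apply]
  | succ n ih =>
    rw [quadraticPart_succ, map_add, LinearMap.add_apply, coeff_mul_apply_eq_zero ih,
      coeff_mul_apply_eq_zero (fun r => Γ.coeff_linearPart_lin_pow hΓ r n q p), add_zero]

/-- Contracting with $p_i$ replaces the argument $x^i$ by $p\cdot x$. A traceless $Y$ kills all
powers of $p\cdot x$, hence so does every word containing a factor $Y$. -/
theorem sum_smul_F_eq_zero (hΓ : Γ.IsTraceless) (k m : ℕ) (p : Fin N → ℝ) :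
    ∑ i, ((p i : ℝ) : ℂ) • Γ.F i k m p = 0 := by
  simp only [F_eq, ← map_smul]
  rw [← map_sum]
  change A.opCoeff (m + k) (Γ.tail m p) (A.lin p) = 0
  rw [coeff_tail]
  refine Finset.sum_eq_zero fun q _ => ?_
  have := Γ.coeff_quadraticPart_lin_pow hΓ (m + k) q.2 1 p
  rw [pow_one] at this
  rw [this, mul_zero, smul_zero]

theorem F_one (i : Fin N) (k : ℕ) (p : Fin N → ℝ) : Γ.F i k 1 p = 0 := by
  rw [F_eq, coeff_tail, Finset.Nat.antidiagonal_succ]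
  simp [quadraticPart_zero, quadraticPart_one]

/-- The linear map `D ↦ D_r f`. -/
def _root_.WeylStar.FunctionAlgebra.coeffEval (A : FunctionAlgebra N) (r : ℕ) (f : A.Fn) :
    A.Op →ₗ[ℂ] A.Fn where
  toFun D := A.opCoeff r D f
  map_add' D D' := by rw [map_add, LinearMap.add_apply]
  map_smul' c D := by rw [map_smul, LinearMap.smul_apply, RingHom.id_apply]

theorem tail_mem (m : ℕ) : (fun p => Γ.tail m p) ∈ homogeneous N A.Op m := by
  have hE : (fun p => A.fnOp (A.lin p)) ∈ homogeneous N A.Op 1 := by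
    have : (fun p => A.fnOp (A.lin p)) =
        fun p : Fin N → ℝ => ∑ i, ((p i : ℝ) : ℂ) • A.fnOp (A.coord i) :=
      funext fun p => A.fnOp_lin p
    rw [this]
    exact linear_mem_homogeneous (V := A.Op) fun i => A.fnOp (A.coord i)
  have hY : (fun p => Γ.linY p) ∈ homogeneous N A.Op 1 :=
    linear_mem_homogeneous (V := A.Op) fun i => Γ.yop i
  exact tail_mem_homogeneous (V := A.Op) hE hY m

/-- This allows $F$, defined pointwise in $p$, to be fed back into the recursion as a symmetric
tensor. -/
theorem F_mem_homogeneous (i : Fin N) (k m : ℕ) :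
    (fun p => Γ.F i k m p) ∈ homogeneous N A.Fn m := by
  have h := map_mem_homogeneous (A.coeffEval (m + k) (A.coord i)) (Γ.tail_mem m)
  have hF : (fun p => Γ.F i k m p) =
      fun p => A.coeffEval (m + k) (A.coord i) (Γ.tail m p) :=
    funext fun p => Γ.F_eq i k m p
  rw [hF]
  exact h

end Coeffs

/-! ### Complex conjugation of operators and coefficients. -/

namespace FunctionAlgebra

variable {N : ℕ} (A : FunctionAlgebra N)

/-- Conjugation of an operator by complex conjugation. -/
def conjEnd : Module.End ℂ A.Fn →+* Module.End ℂ A.Fn where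
  toFun D :=
    { toFun := fun f => A.conj (D (A.conj f))
      map_add' := fun f g => by simp only [conj_add, map_add]
      map_smul' := fun c f => by simp [conj_smul] }
  map_one' := by apply LinearMap.ext; intro f; exact A.conj_conj f
  map_mul' D D' := by
    apply LinearMap.ext
    intro f
    change A.conj (D (D' (A.conj f))) = A.conj (D (A.conj (A.conj (D' (A.conj f)))))
    rw [conj_conj]
  map_zero' := by apply LinearMap.ext; intro f; exact A.conj_zero
  map_add' D D' := by apply LinearMap.ext; intro f; exact A.conj_add _ _

theorem conjEnd_apply (D : Module.End ℂ A.Fn) (f : A.Fn) :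
    A.conjEnd D f = A.conj (D (A.conj f)) := rfl

/-- Coefficientwise `conjEnd`. -/
def conjOp : A.Op →+* A.Op where
  toFun D := A.opMk fun r => A.conjEnd (A.opCoeff r D)
  map_one' := op_ext fun r f => by
    rw [opCoeff_opMk, opCoeff_one]
    split_ifs <;> simp
  map_mul' D D' := op_ext fun r f => by
    rw [opCoeff_opMk, opCoeff_mul, opCoeff_mul, map_sum]
    simp only [opCoeff_opMk, map_mul]
  map_zero' := op_ext fun r f => by
    rw [opCoeff_opMk, map_zero, map_zero]
  map_add' D D' := op_ext fun r f => by
    simp only [opCoeff_opMk, map_add]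

theorem opCoeff_conjOp (D : A.Op) (r : ℕ) (f : A.Fn) :
    A.opCoeff r (A.conjOp D) f = A.conj (A.opCoeff r D (A.conj f)) := by
  change A.opCoeff r (A.opMk _) f = _
  rw [opCoeff_opMk, conjEnd_apply]

theorem conjOp_fnOp (f : A.Fn) : A.conjOp (A.fnOp f) = A.fnOp (A.conj f) := by
  refine op_ext fun r g => ?_
  rw [opCoeff_conjOp, opCoeff_fnOp, opCoeff_fnOp]
  split_ifs
  · rw [mulOp_apply, mulOp_apply, conj_mul, conj_conj]
  · exact A.conj_zero

theorem conjOp_smul (c : ℂ) (D : A.Op) : A.conjOp (c • D) = (starRingEnd ℂ c) • A.conjOp D := by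
  refine op_ext fun r g => ?_
  rw [opCoeff_conjOp, map_smul, map_smul, LinearMap.smul_apply,
    LinearMap.smul_apply, opCoeff_conjOp, conj_smul]

end FunctionAlgebra

namespace Coeffs

variable {N : ℕ} {A : FunctionAlgebra N} (Γ : Coeffs A)

/-- The complex conjugate coefficients. -/
def conj : Coeffs A := fun i k m I => A.conj (Γ i k m I)

theorem conjOp_yop (i : Fin N) : A.conjOp (Γ.yop i) = Γ.conj.yop i := by
  refine FunctionAlgebra.op_ext fun r f => ?_
  rw [A.opCoeff_conjOp, coeff_yop_apply, coeff_yop_apply]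
  simp only [A.conj_sum, A.conj_mul, A.conj_lderiv, A.conj_conj]
  rfl

theorem conjOp_linY (p : Fin N → ℝ) : A.conjOp (Γ.linY p) = Γ.conj.linY p := by
  rw [linY, map_sum]
  simp only [A.conjOp_smul, conjOp_yop, Complex.conj_ofReal]
  rfl

theorem conjOp_tail (m : ℕ) (p : Fin N → ℝ) : A.conjOp (Γ.tail m p) = Γ.conj.tail m p := by
  rw [tail, map_sum]
  refine Finset.sum_congr rfl fun q _ => ?_
  have h : A.conjOp (quadraticPart (A.fnOp (A.lin p)) (Γ.linY p) q.2) =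
      quadraticPart (A.conjOp (A.fnOp (A.lin p))) (A.conjOp (Γ.linY p)) q.2 :=
    map_quadraticPart A.conjOp _ _ _
  rw [A.conjOp_smul, map_mul, map_pow, map_neg, h, A.conjOp_fnOp, A.conj_lin, conjOp_linY,
    map_inv₀, map_mul, Complex.conj_natCast, Complex.conj_natCast]

theorem conj_F (i : Fin N) (k m : ℕ) (p : Fin N → ℝ) :
    A.conj (Γ.F i k m p) = Γ.conj.F i k m p := by
  rw [F_eq, F_eq, ← conjOp_tail, A.opCoeff_conjOp, A.conj_coord]

theorem conj_contract (i : Fin N) (k m : ℕ) (p : Fin N → ℝ) :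
    A.conj (Γ.contract i k m p) = Γ.conj.contract i k m p := by
  rw [contract_eq, contract_eq, A.conj_sum]
  simp only [A.conj_smul, conj_mon]
  rfl

end Coeffs

/-! ### The action of $e^{-p\cdot x}e^{p\cdot\hat x}$ on a coordinate function. -/

/-- This is the coefficient of $s^m$ in $e^{-sx}\cdot s^te^{sx}=s^t$. It extracts the terms with
exactly $m$ derivatives. -/
theorem sum_antidiagonal_descFactorial {V : Type*} [CommRing V] [Algebra ℂ V] (x : V) (m t : ℕ) :
    ∑ q ∈ Finset.HasAntidiagonal.antidiagonal m,
      (((q.1.factorial : ℂ) * (q.2.factorial : ℂ))⁻¹) •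
        ((-x) ^ q.1 * ((q.2.descFactorial t : ℂ) • x ^ (q.2 - t))) = if t = m then 1 else 0 := by
  induction t generalizing m with
  | zero =>
    have h1 : (m.factorial : ℂ) • ∑ q ∈ Finset.HasAntidiagonal.antidiagonal m,
        (((q.1.factorial : ℂ) * (q.2.factorial : ℂ))⁻¹) •
          ((-x) ^ q.1 * ((q.2.descFactorial 0 : ℂ) • x ^ (q.2 - 0))) = (-x + x) ^ m := by
      rw [(Commute.all (-x) x).add_pow', Finset.smul_sum]
      refine Finset.sum_congr rfl fun q hq => ?_
      obtain rfl := Finset.HasAntidiagonal.mem_antidiagonal.1 hq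
      rw [Nat.descFactorial_zero, Nat.cast_one, one_smul, Nat.sub_zero, smul_smul,
        ← Nat.cast_smul_eq_nsmul ℂ, Nat.cast_add_choose, div_eq_mul_inv]
    rw [neg_add_cancel, zero_pow_eq] at h1
    split_ifs with h
    · subst h
      simp
    · rw [if_neg (Ne.symm h)] at h1
      exact (smul_eq_zero.1 h1).resolve_left (Nat.cast_ne_zero.2 m.factorial_ne_zero)
  | succ t ih =>
    cases m with
    | zero => simp
    | succ m =>
      rw [Finset.Nat.antidiagonal_succ', Finset.sum_cons]
      simp only [Nat.zero_descFactorial_succ, Nat.cast_zero, zero_smul, mul_zero, smul_zero,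
        zero_add, Finset.sum_map, Function.Embedding.prodMap, Function.Embedding.coeFn_mk,
        Prod.map, Function.Embedding.refl_apply, Nat.succ_eq_add_one, add_left_inj]
      rw [← ih m]
      refine Finset.sum_congr rfl fun q _ => ?_
      rw [Nat.succ_descFactorial_succ, Nat.add_sub_add_right, mul_smul_comm, mul_smul_comm,
        smul_smul, smul_smul, Nat.factorial_succ]
      congr 1
      have h1 : (q.1.factorial : ℂ) ≠ 0 := Nat.cast_ne_zero.2 q.1.factorial_ne_zero
      have h2 : (q.2.factorial : ℂ) ≠ 0 := Nat.cast_ne_zero.2 q.2.factorial_ne_zero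
      have h3 : (q.2 : ℂ) + 1 ≠ 0 := Nat.cast_add_one_ne_zero q.2
      push_cast
      field_simp

/-- The hockey-stick identity; it is the source of the factor $1/m$ in the linear part. -/
theorem sum_range_descFactorial (n t : ℕ) :
    (t + 1) * ∑ j ∈ Finset.range n, j.descFactorial t = n.descFactorial (t + 1) := by
  induction n with
  | zero => simp
  | succ n ih =>
    rw [Finset.sum_range_succ, mul_add, ih, Nat.succ_descFactorial_succ, Nat.descFactorial_succ,
      ← add_mul]
    rcases le_or_gt t n with h | h
    · congr 1
      omega
    · rw [Nat.descFactorial_of_lt h]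
      simp

theorem sum_fin_succ_cons {N : ℕ} {V : Type*} [AddCommMonoid V] (m : ℕ)
    (f : (Fin (m + 1) → Fin N) → V) :
    ∑ I, f I = ∑ i, ∑ I : Fin m → Fin N, f (Fin.cons i I) := by
  rw [← Fintype.sum_prod_type', ← (Fin.consEquiv fun _ => Fin N).sum_comp]
  exact Finset.sum_congr rfl fun x _ => by simp [Fin.consEquiv]

/-- The derivative of the monomial `mon p L` in `p_l`. -/
def polar {N : ℕ} (p : Fin N → ℝ) (l : Fin N) : List (Fin N) → ℂ
  | [] => 0
  | i :: L => (if i = l then mon p L else 0) + ((p i : ℝ) : ℂ) * polar p l L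

theorem polar_perm {N : ℕ} (p : Fin N → ℝ) (l : Fin N) {L L' : List (Fin N)} (h : L.Perm L') :
    polar p l L = polar p l L' := by
  induction h with
  | nil => rfl
  | cons i h ih => simp only [polar, ih, mon_perm p h]
  | swap i j L =>
    simp only [polar, mon_cons]
    split_ifs <;> ring
  | trans _ _ ih1 ih2 => exact ih1.trans ih2

theorem FunctionAlgebra.neg_mul_fn {N : ℕ} (A : FunctionAlgebra N) (f g : A.Fn) :
    -f * g = -(f * g) := neg_mul f g

theorem FunctionAlgebra.mul_neg_fn {N : ℕ} (A : FunctionAlgebra N) (f g : A.Fn) :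
    f * -g = -(f * g) := mul_neg f g

/-- By Leibniz, at most one derivative hits $x^l$; `polar` sums over which one. For the empty list
`polar` vanishes, so the truncated subtraction there is harmless. -/
theorem FunctionAlgebra.lderiv_lin_pow_mul_coord {N : ℕ} (A : FunctionAlgebra N)
    (p : Fin N → ℝ) (l : Fin N) (L : List (Fin N)) (q : ℕ) :
    A.lderiv L (A.lin p ^ q * A.coord l) =
      ((q.descFactorial L.length : ℂ) * mon p L) • (A.lin p ^ (q - L.length) * A.coord l) +
      ((q.descFactorial (L.length - 1) : ℂ) * polar p l L) • A.lin p ^ (q + 1 - L.length) := by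
  induction L with
  | nil => simp [polar]
  | cons i L ih =>
    rw [A.lderiv_cons, Module.End.mul_apply, ih, map_add, map_smul, map_smul, A.pderiv_mul,
      A.pderiv_lin_pow, A.pderiv_lin_pow, A.pderiv_coord, List.length_cons, mon_cons, polar,
      Nat.add_sub_cancel, Nat.add_sub_add_right, Nat.sub_add_eq, Nat.descFactorial_succ,
      Nat.sub_right_comm]
    rw [show q + 1 - L.length - 1 = q - L.length by omega]
    rw [smul_add, smul_mul_assoc, smul_smul, smul_smul, add_assoc]
    congr 1
    · congr 1
      push_cast
      ring
    · rw [mul_add, add_smul]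
      congr 1
      · split_ifs <;> simp
      · congr 1
        cases L with
        | nil => simp [polar]
        | cons j L =>
          rw [List.length_cons, Nat.add_sub_cancel, Nat.descFactorial_succ,
            Nat.add_sub_add_right]
          push_cast
          ring

namespace Coeffs

variable {N : ℕ} {A : FunctionAlgebra N} (Γ : Coeffs A)

/-- The trace identity differentiated in $p_l$: the derivative falls either on the explicit $p_i$,
giving $\Gamma^l$, or on $\Gamma^{i(m)}(p)^m$. Algebraically, the symmetric tensor `polar` is paired
with a tensor whose symmetrization vanishes. -/
theorem sum_polar_smul (hΓ : Γ.IsTraceless) (k m : ℕ) (hm : 1 ≤ m) (p : Fin N → ℝ) (l : Fin N) :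
    ∑ i, ((p i : ℝ) : ℂ) • ∑ I : Fin m → Fin N, polar p l (List.ofFn I) • Γ i k m I =
      -Γ.contract l k m p := by
  have h := sum_mul_eq_zero_of_contract_eq_zero (N := N) (m := m + 1)
    (c := fun I => Γ (I 0) k m (Fin.tail I))
    (s := fun I => algebraMap ℂ A.Fn (polar p l (List.ofFn I)))
    (fun p' => by
      rw [sum_fin_succ_cons, ← hΓ k m hm p']
      refine Finset.sum_congr rfl fun i _ => ?_
      rw [contract_eq, Finset.smul_sum]
      refine Finset.sum_congr rfl fun I _ => ?_
      rw [List.ofFn_cons, mon_cons, mul_smul, Fin.cons_zero, Fin.tail_cons])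
    (fun I σ => by rw [polar_perm p l (ofFn_comp_perm I σ)])
  rw [sum_fin_succ_cons] at h
  simp only [← Algebra.smul_def, List.ofFn_cons, Fin.cons_zero, Fin.tail_cons, polar, add_smul,
    Finset.sum_add_distrib, mul_smul, ite_smul, zero_smul] at h
  rw [eq_neg_iff_add_eq_zero, ← h, add_comm]
  congr 1
  · rw [contract_eq, Finset.sum_comm]
    refine Finset.sum_congr rfl fun I _ => ?_
    rw [Finset.sum_ite_eq' Finset.univ l, if_pos (Finset.mem_univ l)]
  · simp only [Finset.smul_sum]

theorem coeff_linY_lin_pow_mul_coord (hΓ : Γ.IsTraceless) (r q : ℕ) (p : Fin N → ℝ)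
    (l : Fin N) : A.opCoeff r (Γ.linY p) (A.lin p ^ q * A.coord l) =
      -∑ m ∈ Finset.Icc 1 r, (q.descFactorial (m - 1) : ℂ) •
        (Γ.contract l (r - m) m p * A.lin p ^ (q + 1 - m)) := by
  rw [coeff_linY, LinearMap.sum_apply]
  simp only [LinearMap.smul_apply, coeff_yop_apply]
  simp only [Finset.smul_sum (s := Finset.Icc 1 r)]
  rw [Finset.sum_comm, ← Finset.sum_neg_distrib]
  refine Finset.sum_congr rfl fun m hm => ?_
  have hm1 := (Finset.mem_Icc.1 hm).1
  have h1 : ∀ i, ((p i : ℝ) : ℂ) • ∑ I : Fin m → Fin N, Γ i (r - m) m I *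
      A.lderiv (List.ofFn I) (A.lin p ^ q * A.coord l) =
      (((p i : ℝ) : ℂ) • Γ.contract i (r - m) m p) *
        ((q.descFactorial m : ℂ) • (A.lin p ^ (q - m) * A.coord l)) +
      (((p i : ℝ) : ℂ) • ∑ I : Fin m → Fin N, polar p l (List.ofFn I) • Γ i (r - m) m I) *
        ((q.descFactorial (m - 1) : ℂ) • A.lin p ^ (q + 1 - m)) := by
    intro i
    rw [contract_eq, smul_mul_assoc, smul_mul_assoc, ← smul_add, Finset.sum_mul, Finset.sum_mul,
      ← Finset.sum_add_distrib]
    congr 1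
    refine Finset.sum_congr rfl fun I _ => ?_
    rw [A.lderiv_lin_pow_mul_coord, List.length_ofFn, mul_add]
    simp only [mul_smul_comm, smul_smul, mul_comm]
  simp only [h1, Finset.sum_add_distrib]
  rw [← Finset.sum_mul, ← Finset.sum_mul, hΓ _ _ hm1, Γ.sum_polar_smul hΓ _ _ hm1, zero_mul,
    zero_add, mul_smul_comm, A.neg_mul_fn, smul_neg]

/-- The term with $Y$ in position $j$ acts on $(p\cdot x)^{n-1-j}x^l$ and contributes
$-(n-1-j)^{\underline{m-1}}\,\Gamma^l(p\cdot x)^{n-m}$. Summing over $j$ gives $n^{\underline m}/m$.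
-/
theorem coeff_linearPart_coord (hΓ : Γ.IsTraceless) (r n : ℕ) (p : Fin N → ℝ) (l : Fin N) :
    A.opCoeff r (linearPart (A.fnOp (A.lin p)) (Γ.linY p) n) (A.coord l) =
      -∑ m ∈ Finset.Icc 1 r, ((m : ℂ)⁻¹ * (n.descFactorial m : ℂ)) •
        (Γ.contract l (r - m) m p * A.lin p ^ (n - m)) := by
  rw [linearPart, map_sum, LinearMap.sum_apply]
  have h1 : ∀ j ∈ Finset.range n, A.opCoeff r (A.fnOp (A.lin p) ^ j * Γ.linY p *
      A.fnOp (A.lin p) ^ (n - 1 - j)) (A.coord l) =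
      -∑ m ∈ Finset.Icc 1 r, ((n - 1 - j).descFactorial (m - 1) : ℂ) •
        (Γ.contract l (r - m) m p * A.lin p ^ (n - m)) := by
    intro j hj
    have hj' := Finset.mem_range.1 hj
    rw [← map_pow, ← map_pow, A.opCoeff_mul_fnOp, A.opCoeff_fnOp_mul, Module.End.mul_apply,
      Module.End.mul_apply, A.mulOp_apply, A.mulOp_apply, coeff_linY_lin_pow_mul_coord Γ hΓ,
      A.mul_neg_fn, Finset.mul_sum]
    congr 1
    refine Finset.sum_congr rfl fun m hm => ?_
    have hm1 := (Finset.mem_Icc.1 hm).1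
    rcases lt_or_ge (n - 1 - j) (m - 1) with h | h
    · rw [Nat.descFactorial_of_lt h]
      simp
    · rw [mul_smul_comm, mul_left_comm, ← pow_add,
        show j + (n - 1 - j + 1 - m) = n - m by omega]
  rw [Finset.sum_congr rfl h1, Finset.sum_neg_distrib, Finset.sum_comm]
  congr 1
  refine Finset.sum_congr rfl fun m hm => ?_
  obtain ⟨t, rfl⟩ := Nat.exists_eq_add_of_le' (Finset.mem_Icc.1 hm).1
  rw [← Finset.sum_smul, Nat.add_sub_cancel,
    Finset.sum_range_reflect (fun j => (j.descFactorial t : ℂ)) n, ← sum_range_descFactorial]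
  congr 1
  have : (t : ℂ) + 1 ≠ 0 := Nat.cast_add_one_ne_zero t
  push_cast
  field_simp

/-- The part of degree `m` in `p` of `exp(-p_j x^j) exp(p_j x̂^j)`. -/
def expOp (m : ℕ) (p : Fin N → ℝ) : A.Op :=
  ∑ q ∈ Finset.HasAntidiagonal.antidiagonal m, (((q.1.factorial : ℂ) * (q.2.factorial : ℂ))⁻¹) •
    ((-A.fnOp (A.lin p)) ^ q.1 * Γ.linX p ^ q.2)

theorem coeff_expOp (r m : ℕ) (p : Fin N → ℝ) (f : A.Fn) :
    A.opCoeff r (Γ.expOp m p) f = ∑ q ∈ Finset.HasAntidiagonal.antidiagonal m,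
      (((q.1.factorial : ℂ) * (q.2.factorial : ℂ))⁻¹) • ((-A.lin p) ^ q.1 *
        A.opCoeff r (Γ.linX p ^ q.2) f) := by
  rw [expOp, map_sum, LinearMap.sum_apply]
  refine Finset.sum_congr rfl fun q _ => ?_
  rw [map_smul, LinearMap.smul_apply, ← map_neg, ← map_pow, A.opCoeff_fnOp_mul]
  rfl

/-- The part free of $Y$ has no positive order in $\alpha$, the quadratic part is $F$, and
`sum_antidiagonal_descFactorial` selects the $m$-derivative term of the linear part. With weak
Hermiticity this becomes the recursion. -/
theorem coeff_expOp_coord (hΓ : Γ.IsTraceless) (k m : ℕ) (hm : 1 ≤ m) (p : Fin N → ℝ)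
    (l : Fin N) : A.opCoeff (m + k) (Γ.expOp m p) (A.coord l) =
      Γ.F l k m p - (m : ℂ)⁻¹ • Γ.contract l k m p := by
  have h1 : ∀ n, A.opCoeff (m + k) (Γ.linX p ^ n) (A.coord l) =
      A.opCoeff (m + k) (quadraticPart (A.fnOp (A.lin p)) (Γ.linY p) n) (A.coord l) -
      ∑ m' ∈ Finset.Icc 1 (m + k), ((m' : ℂ)⁻¹ * (n.descFactorial m' : ℂ)) •
        (Γ.contract l (m + k - m') m' p * A.lin p ^ (n - m')) := by
    intro n
    have h2 : Γ.linX p ^ n = quadraticPart (A.fnOp (A.lin p)) (Γ.linY p) n +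
        A.fnOp (A.lin p ^ n) + linearPart (A.fnOp (A.lin p)) (Γ.linY p) n := by
      rw [quadraticPart, linX, map_pow]
      abel
    rw [h2, map_add, map_add, A.opCoeff_fnOp, if_neg (by omega), add_zero, LinearMap.add_apply,
      coeff_linearPart_coord Γ hΓ, sub_eq_add_neg]
  rw [coeff_expOp, F_eq, coeff_tail]
  simp only [h1, mul_sub, smul_sub, Finset.sum_sub_distrib]
  congr 1
  simp only [Finset.mul_sum, Finset.smul_sum]
  rw [Finset.sum_comm]
  have h3 : ∀ m' ∈ Finset.Icc 1 (m + k), ∑ q ∈ Finset.HasAntidiagonal.antidiagonal m,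
      (((q.1.factorial : ℂ) * (q.2.factorial : ℂ))⁻¹) • ((-A.lin p) ^ q.1 *
        ((m' : ℂ)⁻¹ * (q.2.descFactorial m' : ℂ)) •
          (Γ.contract l (m + k - m') m' p * A.lin p ^ (q.2 - m'))) =
      if m' = m then (m : ℂ)⁻¹ • Γ.contract l k m p else 0 := by
    intro m' _
    have h4 : ∀ q : ℕ × ℕ, (((q.1.factorial : ℂ) * (q.2.factorial : ℂ))⁻¹) • ((-A.lin p) ^ q.1 *
        ((m' : ℂ)⁻¹ * (q.2.descFactorial m' : ℂ)) •
          (Γ.contract l (m + k - m') m' p * A.lin p ^ (q.2 - m'))) =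
        ((m' : ℂ)⁻¹ • Γ.contract l (m + k - m') m' p) *
          ((((q.1.factorial : ℂ) * (q.2.factorial : ℂ))⁻¹) •
            ((-A.lin p) ^ q.1 * ((q.2.descFactorial m' : ℂ) • A.lin p ^ (q.2 - m')))) := by
      intro q
      simp only [smul_mul_assoc, mul_smul_comm, smul_smul]
      congr 1
      · ring
      · ring
    simp only [h4]
    rw [← Finset.mul_sum, sum_antidiagonal_descFactorial]
    split_ifs with h
    · subst h
      rw [mul_one, Nat.add_sub_cancel_left]
    · rw [mul_zero]
  rw [Finset.sum_congr rfl h3, Finset.sum_ite_eq', if_pos (by simp; omega)]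

end Coeffs

/-! ### Solving the recursion for the coefficients. -/

/-- The factor relating `Γ` to `F`. -/
def weight (k m : ℕ) : ℂ := (m : ℂ) / (1 + (-1 : ℂ) ^ (m + k) * (m : ℂ))

theorem conj_weight (k m : ℕ) : (starRingEnd ℂ) (weight k m) = weight k m := by
  simp [weight]

/-- The denominator can vanish only at $m=1$, which is why first-derivative coefficients are
prescribed separately. -/
theorem one_add_ne_zero {m : ℕ} (k : ℕ) (hm : 2 ≤ m) :
    1 + (-1 : ℂ) ^ (m + k) * (m : ℂ) ≠ 0 := by
  rcases neg_one_pow_eq_or ℂ (m + k) with h | h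
  · rw [h, one_mul, add_comm]
    exact Nat.cast_add_one_ne_zero m
  · rw [h, neg_one_mul, ← sub_eq_add_neg, sub_ne_zero]
    intro h1
    have : m = 1 := by exact_mod_cast h1.symm
    omega

theorem eq_of_contract_eq {N m : ℕ} {V : Type*} [AddCommGroup V] [Module ℂ V]
    {c d : (Fin m → Fin N) → V} (hc : ∀ I (σ : Equiv.Perm (Fin m)), c (I ∘ σ) = c I)
    (hd : ∀ I (σ : Equiv.Perm (Fin m)), d (I ∘ σ) = d I)
    (h : ∀ p : Fin N → ℝ, ∑ I, mon p (List.ofFn I) • c I = ∑ I, mon p (List.ofFn I) • d I) :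
    c = d := by
  funext J
  rw [← sub_eq_zero]
  refine eq_zero_of_contract_eq_zero (c := fun I => c I - d I) (fun I σ => by rw [hc, hd])
    (fun p => ?_) J
  simp only [smul_sub, Finset.sum_sub_distrib]
  rw [h p, sub_self]

theorem FunctionAlgebra.eq_zero_of_eq_neg {N : ℕ} (A : FunctionAlgebra N) {f : A.Fn}
    (h : f = -f) : f = 0 := by
  have h1 : (2 : ℂ) • f = 0 := by
    rw [two_smul]
    nth_rewrite 1 [h]
    exact neg_add_cancel f
  exact (smul_eq_zero.1 h1).resolve_left two_ne_zero

namespace Coeffs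

variable {N : ℕ} {A : FunctionAlgebra N}

/-- The recursion satisfied by the coefficients of the Weyl star product. -/
structure IsRecursive (P : Fin N → Fin N → A.Fn) (Γ : Coeffs A) : Prop where
  symm : Γ.IsSymm
  base : ∀ i (I : Fin 1 → Fin N), Γ i 0 1 I = P i (I 0)
  one : ∀ i k (I : Fin 1 → Fin N), 1 ≤ k → Γ i k 1 I = 0
  recursion : ∀ i k m, 2 ≤ m → ∀ p : Fin N → ℝ, Γ.contract i k m p = weight k m • Γ.F i k m p

/-- The symmetric tensor whose contractions are `F`. -/
def symF (Γ : Coeffs A) : Coeffs A := fun i k m =>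
  (exists_symm_of_mem_homogeneous (Γ.F_mem_homogeneous i k m)).choose

theorem symF_symm (Γ : Coeffs A) : Γ.symF.IsSymm := fun i k m =>
  (exists_symm_of_mem_homogeneous (Γ.F_mem_homogeneous i k m)).choose_spec.1

theorem symF_contract (Γ : Coeffs A) (i : Fin N) (k m : ℕ) (p : Fin N → ℝ) :
    Γ.symF.contract i k m p = Γ.F i k m p := by
  rw [contract_eq]
  exact ((exists_symm_of_mem_homogeneous (Γ.F_mem_homogeneous i k m)).choose_spec.2 p).symm

theorem ext_contract {Γ Γ' : Coeffs A} (hΓ : Γ.IsSymm) (hΓ' : Γ'.IsSymm) {i : Fin N} {k m : ℕ}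
    (h : ∀ p, Γ.contract i k m p = Γ'.contract i k m p) : Γ i k m = Γ' i k m :=
  eq_of_contract_eq (hΓ i k m) (hΓ' i k m) fun p => by rw [← contract_eq, ← contract_eq, h]

theorem symF_congr {Γ Γ' : Coeffs A} {k m : ℕ}
    (h : ∀ j k' m', 1 ≤ m' → k' + m' < k + m → Γ j k' m' = Γ' j k' m') (i : Fin N) :
    Γ.symF i k m = Γ'.symF i k m :=
  ext_contract Γ.symF_symm Γ'.symF_symm fun p => by
    rw [symF_contract, symF_contract, F_congr h]

/-- One step of the recursion. -/
def step (P : Fin N → Fin N → A.Fn) (Γ : Coeffs A) : Coeffs A := fun i k m =>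
  match m with
  | 0 => fun _ => 0
  | 1 => fun I => if k = 0 then P i (I 0) else 0
  | m + 2 => weight k (m + 2) • Γ.symF i k (m + 2)

theorem step_congr (P : Fin N → Fin N → A.Fn) {Γ Γ' : Coeffs A} {k m : ℕ}
    (h : ∀ j k' m', 1 ≤ m' → k' + m' < k + m → Γ j k' m' = Γ' j k' m') (i : Fin N) :
    step P Γ i k m = step P Γ' i k m := by
  match m with
  | 0 => rfl
  | 1 => rfl
  | m + 2 => simp only [step, symF_congr h i]

/-- A step at order $k+m$ reads strictly lower orders only, so entries stabilize once the iteration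
count exceeds $k+m$. -/
theorem iterate_step_succ (P : Fin N → Fin N → A.Fn) (n : ℕ) (i : Fin N) (k m : ℕ)
    (h : k + m < n) : (step P)^[n + 1] 0 i k m = (step P)^[n] 0 i k m := by
  induction n generalizing i k m with
  | zero => omega
  | succ n ih =>
    rw [Function.iterate_succ_apply' (step P) (n + 1), Function.iterate_succ_apply' (step P) n]
    refine step_congr P (fun j k' m' _ h' => ?_) i
    have h1 := ih j k' m' (by omega)
    rwa [Function.iterate_succ_apply' (step P) n] at h1

theorem iterate_step_eq (P : Fin N → Fin N → A.Fn) {n n' : ℕ} (hn : n ≤ n') (i : Fin N) (k m : ℕ)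
    (h : k + m < n) : (step P)^[n'] 0 i k m = (step P)^[n] 0 i k m := by
  obtain ⟨d, rfl⟩ := Nat.exists_eq_add_of_le hn
  clear hn
  induction d with
  | zero => rw [Nat.add_zero]
  | succ d ih => exact (iterate_step_succ P (n + d) i k m (by omega)).trans ih

/-- The fixed point of the recursion. -/
def solution (P : Fin N → Fin N → A.Fn) : Coeffs A := fun i k m =>
  (step P)^[k + m + 1] 0 i k m

theorem step_solution (P : Fin N → Fin N → A.Fn) (i : Fin N) (k m : ℕ) :
    solution P i k m = step P (solution P) i k m := by
  rw [solution, Function.iterate_succ_apply']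
  refine step_congr P (fun j k' m' _ h' => ?_) i
  exact iterate_step_eq P (n := k' + m' + 1) (by omega) j k' m' (by omega)

theorem solution_isRecursive (P : Fin N → Fin N → A.Fn) : (solution P).IsRecursive P where
  symm i k m I σ := by
    rw [step_solution]
    match m with
    | 0 => rfl
    | 1 => simp only [step, Function.comp_apply, Subsingleton.elim (σ 0) 0]
    | m + 2 => simp only [step, Pi.smul_apply, symF_symm (solution P) i k (m + 2) I σ]
  base i I := by rw [step_solution]; rfl
  one i k I hk := by
    rw [step_solution]
    simp only [step]
    rw [if_neg (by omega)]
  recursion i k m hm p := by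
    obtain ⟨m, rfl⟩ := Nat.exists_eq_add_of_le' hm
    rw [contract_eq, step_solution, ← symF_contract, contract_eq, Finset.smul_sum]
    refine Finset.sum_congr rfl fun I _ => ?_
    rw [smul_comm]
    rfl

theorem IsRecursive.unique {P : Fin N → Fin N → A.Fn} {Γ Γ' : Coeffs A} (h : Γ.IsRecursive P)
    (h' : Γ'.IsRecursive P) (i : Fin N) (k m : ℕ) (hm : 1 ≤ m) : Γ i k m = Γ' i k m := by
  induction hn : k + m using Nat.strong_induction_on generalizing i k m with
  | _ n ih =>
    subst hn
    rcases hm.eq_or_lt with rfl | hm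
    · funext I
      rcases Nat.eq_zero_or_pos k with rfl | hk
      · rw [h.base, h'.base]
      · rw [h.one i k I hk, h'.one i k I hk]
    · refine ext_contract h.symm h'.symm fun p => ?_
      rw [h.recursion i k m hm, h'.recursion i k m hm,
        F_congr (fun j k' m' hm' hlt => ih _ hlt j k' m' hm' rfl)]

/-- The case $m=1$ is antisymmetry of $P$; beyond that, tracelessness passes from lower orders to
$F$ and thence to $\Gamma$. -/
theorem IsRecursive.traceless {P : Fin N → Fin N → A.Fn} {Γ : Coeffs A} (h : Γ.IsRecursive P)
    (hP : ∀ i j, P j i = -P i j) : Γ.IsTraceless := by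
  intro k m hm p
  induction hn : k + m using Nat.strong_induction_on generalizing k m p with
  | _ n ih =>
    subst hn
    rcases hm.eq_or_lt with rfl | hm
    · rcases Nat.eq_zero_or_pos k with rfl | hk
      · have h1 : ∀ i, Γ.contract i 0 1 p = ∑ j, ((p j : ℝ) : ℂ) • P i j := by
          intro i
          rw [contract]
          refine Fintype.sum_equiv (Equiv.funUnique (Fin 1) (Fin N)) _ _ fun I => ?_
          rw [h.base]
          simp
        simp only [h1, Finset.smul_sum]
        have h2 : ∑ i, ∑ j, ((p i : ℝ) : ℂ) • ((p j : ℝ) : ℂ) • P i j =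
            -∑ i, ∑ j, ((p i : ℝ) : ℂ) • ((p j : ℝ) : ℂ) • P i j := by
          conv_lhs => rw [Finset.sum_comm]
          rw [← Finset.sum_neg_distrib]
          refine Finset.sum_congr rfl fun i _ => ?_
          rw [← Finset.sum_neg_distrib]
          refine Finset.sum_congr rfl fun j _ => ?_
          rw [hP i j, smul_neg, smul_neg, smul_comm]
        exact A.eq_zero_of_eq_neg h2
      · have h1 : ∀ i, Γ.contract i k 1 p = 0 := fun i => by
          rw [contract]
          exact Finset.sum_eq_zero fun I _ => by rw [h.one i k I hk, smul_zero]
        simp [h1]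
    -- Tracelessness of $F$ needs a family traceless at every order, whereas the induction provides
    -- lower orders only. Cutting off the higher ones does not change $F$ here.
    · set Γ' : Coeffs A := fun i k' m' => if k' + m' < k + m then Γ i k' m' else 0 with hΓ'
      have hT : Γ'.IsTraceless := by
        intro k' m' hm' p'
        by_cases hlt : k' + m' < k + m
        · have h1 : ∀ i, Γ'.contract i k' m' p' = Γ.contract i k' m' p' := fun i => by
            simp [contract, hΓ', hlt]
          simp only [h1]
          exact ih _ hlt k' m' hm' p' rfl
        · have : ∀ i, Γ'.contract i k' m' p' = 0 := fun i => by
            simp [contract, hΓ', hlt]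
          simp [this]
      have hF : ∀ i, Γ.F i k m p = Γ'.F i k m p := fun i =>
        F_congr (fun j k' m' _ hlt => by simp [hΓ', hlt]) i p
      simp only [h.recursion _ k m hm, hF, smul_comm _ (weight k m)]
      rw [← Finset.smul_sum, sum_smul_F_eq_zero Γ' hT, smul_zero]

/-- Conjugation commutes with $F$ and fixes the weights and $P$, so the conjugate family solves the
same recursion and uniqueness applies. -/
theorem IsRecursive.real {P : Fin N → Fin N → A.Fn} {Γ : Coeffs A} (h : Γ.IsRecursive P)
    (hP : ∀ i j, A.conj (P i j) = P i j) : Γ.IsReal := by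
  have hc : Γ.conj.IsSymm := fun i k m I σ => by
    change A.conj _ = A.conj _
    rw [h.symm]
  have key : Γ.conj.IsRecursive P := by
    refine ⟨hc, fun i I => ?_, fun i k I hk => ?_, fun i k m hm p => ?_⟩
    · change A.conj _ = _
      rw [h.base, hP]
    · change A.conj _ = _
      rw [h.one i k I hk, A.conj_zero]
    · rw [← conj_contract, h.recursion i k m hm, A.conj_smul, conj_weight, conj_F]
  intro i k m I hm
  exact congrFun (key.unique h i k m hm) I

end Coeffs

/-! ### The noncommutative binomial expansion behind $e^{-E}e^G$. -/

section Twist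

variable {R : Type*} [Ring R] (E G : R)

/-- The `m`-th power of `D ↦ D * G - E * D`, applied to `1`. -/
def twist : ℕ → R
  | 0 => 1
  | m + 1 => twist m * G - E * twist m

theorem twist_eq_pow (m : ℕ) :
    twist E G m = ((LinearMap.mulRight ℤ G - LinearMap.mulLeft ℤ E) ^ m) 1 := by
  induction m with
  | zero => rfl
  | succ m ih => rw [pow_succ', Module.End.mul_apply, ← ih]; rfl

/-- Right multiplication by $G$ and left multiplication by $E$ commute although $G$ and $E$ need
not. Hence the ordinary binomial theorem applies to $R_G=(R_G-L_E)+L_E$. -/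
theorem pow_eq_sum_twist (n : ℕ) :
    G ^ n = ∑ m ∈ Finset.range (n + 1), n.choose m • (E ^ (n - m) * twist E G m) := by
  have h1 : G ^ n = (((LinearMap.mulRight ℤ G - LinearMap.mulLeft ℤ E) +
      LinearMap.mulLeft ℤ E) ^ n) 1 := by
    rw [sub_add_cancel, LinearMap.pow_mulRight]
    simp
  have hc : Commute (LinearMap.mulRight ℤ G - LinearMap.mulLeft ℤ E) (LinearMap.mulLeft ℤ E) :=
    ((LinearMap.commute_mulLeft_right E G).symm).sub_left (Commute.refl _)
  rw [h1, hc.add_pow, LinearMap.sum_apply]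
  refine Finset.sum_congr rfl fun m _ => ?_
  rw [(Nat.cast_commute _ _).symm.eq, (hc.pow_pow m (n - m)).eq, Module.End.mul_apply,
    Module.End.mul_apply, ← twist_eq_pow, LinearMap.pow_mulLeft, LinearMap.mulLeft_apply,
    Module.End.natCast_apply]

theorem twist_eq_sum (m : ℕ) : twist E G m =
    ∑ q ∈ Finset.HasAntidiagonal.antidiagonal m, m.choose q.1 • ((-E) ^ q.1 * G ^ q.2) := by
  have hc : Commute (LinearMap.mulLeft ℤ (-E)) (LinearMap.mulRight ℤ G) :=
    LinearMap.commute_mulLeft_right (-E) G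
  have h1 : LinearMap.mulRight ℤ G - LinearMap.mulLeft ℤ E =
      LinearMap.mulLeft ℤ (-E) + LinearMap.mulRight ℤ G := by
    apply LinearMap.ext
    intro x
    simp [sub_eq_add_neg, add_comm]
  rw [twist_eq_pow, h1, hc.add_pow', LinearMap.sum_apply]
  refine Finset.sum_congr rfl fun q _ => ?_
  rw [LinearMap.smul_apply, Module.End.mul_apply, LinearMap.pow_mulLeft, LinearMap.pow_mulRight]
  simp

end Twist

/-! ### Order of an operator measured by iterated commutators. -/

section Nil

variable {R : Type*} [Ring R] (x : R)

/-- `D` is annihilated by the `n`-th power of the commutator with `x`. -/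
def Nil : ℕ → R → Prop
  | 0, D => D = 0
  | n + 1, D => Nil n (x * D - D * x)

namespace Nil

variable {x}

theorem zero (n : ℕ) : Nil x n 0 := by
  induction n with
  | zero => rfl
  | succ n ih => simpa [Nil] using ih

theorem add {n : ℕ} {D D' : R} (h : Nil x n D) (h' : Nil x n D') : Nil x n (D + D') := by
  induction n generalizing D D' with
  | zero => simp only [Nil] at *; rw [h, h', add_zero]
  | succ n ih =>
    have := ih h h'
    simp only [Nil]
    rwa [mul_add, add_mul, add_sub_add_comm]

theorem neg {n : ℕ} {D : R} (h : Nil x n D) : Nil x n (-D) := by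
  induction n generalizing D with
  | zero => simp only [Nil] at *; rw [h, neg_zero]
  | succ n ih =>
    have := ih h
    simp only [Nil]
    rwa [mul_neg, neg_mul, ← neg_sub']

theorem sum {ι : Type*} (s : Finset ι) {n : ℕ} {D : ι → R} (h : ∀ i ∈ s, Nil x n (D i)) :
    Nil x n (∑ i ∈ s, D i) := by
  classical
  induction s using Finset.induction_on with
  | empty => exact zero n
  | insert a s ha ih =>
    rw [Finset.sum_insert ha]
    exact (h a (Finset.mem_insert_self a s)).add
      (ih fun i hi => h i (Finset.mem_insert_of_mem hi))

theorem succ {n : ℕ} {D : R} (h : Nil x n D) : Nil x (n + 1) D := by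
  induction n generalizing D with
  | zero => simp only [Nil] at *; simp [h]
  | succ n ih => exact ih h

theorem mono {m n : ℕ} {D : R} (h : Nil x m D) (hmn : m ≤ n) : Nil x n D := by
  induction n, hmn using Nat.le_induction with
  | base => exact h
  | succ n _ ih => exact ih.succ

/-- The commutator is a derivation, so orders $a$ and $b$ add under products; `Nil x (a + 1)`
encodes order at most $a$. -/
theorem mul {a b : ℕ} {D D' : R} (h : Nil x (a + 1) D) (h' : Nil x (b + 1) D') :
    Nil x (a + b + 1) (D * D') := by
  have key : x * (D * D') - D * D' * x = (x * D - D * x) * D' + D * (x * D' - D' * x) := by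
    noncomm_ring
  induction hn : a + b generalizing a b D D' with
  | zero =>
    obtain ⟨rfl, rfl⟩ : a = 0 ∧ b = 0 := by omega
    simp only [Nil] at *
    rw [key, h, h', mul_zero, zero_mul, add_zero]
  | succ n ih =>
    change Nil x (n + 1) _
    rw [key]
    refine add ?_ ?_
    · cases a with
      | zero =>
        have h0 : x * D - D * x = 0 := h
        rw [h0, zero_mul]
        exact zero _
      | succ a => exact ih (a := a) (b := b) h h' (by noncomm_ring) (by omega)
    · cases b with
      | zero =>
        have h0 : x * D' - D' * x = 0 := h'
        rw [h0, mul_zero]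
        exact zero _
      | succ b => exact ih (a := a) (b := b) h h' (by noncomm_ring) (by omega)

end Nil

section Ad

variable [Algebra ℂ R]

/-- The commutator with `x`. -/
def ad : Module.End ℂ R := LinearMap.mulLeft ℂ x - LinearMap.mulRight ℂ x

theorem ad_apply (D : R) : ad x D = x * D - D * x := rfl

theorem nil_iff (n : ℕ) (D : R) : Nil x n D ↔ (ad x ^ n) D = 0 := by
  induction n generalizing D with
  | zero => rfl
  | succ n ih =>
    rw [pow_succ, Module.End.mul_apply, ← ih]
    rfl

variable {x}

theorem ad_pow_mul_left {c : R} (hc : Commute x c) (n : ℕ) (D : R) :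
    (ad x ^ n) (c * D) = c * (ad x ^ n) D := by
  induction n with
  | zero => rfl
  | succ n ih =>
    rw [pow_succ', Module.End.mul_apply, Module.End.mul_apply, ih, ad_apply, ad_apply, mul_sub,
      ← mul_assoc, ← mul_assoc, ← mul_assoc, hc.eq]

theorem ad_pow_mul {d : R} {a : ℂ} (h : d * x = x * d + a • 1) (n : ℕ) (D : R) :
    (ad x ^ n) (d * D) = d * (ad x ^ n) D - ((n : ℂ) * a) • (ad x ^ (n - 1)) D := by
  have h1 : ∀ D, ad x (d * D) = d * ad x D - a • D := fun D => by
    rw [ad_apply, ad_apply, mul_sub, ← mul_assoc d x D, h, add_mul, smul_one_mul, mul_assoc,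
      mul_assoc]
    abel
  induction n with
  | zero => simp
  | succ n ih =>
    rw [pow_succ', Module.End.mul_apply, ih, map_sub, map_smul, h1,
      Module.End.mul_apply, Nat.add_sub_cancel]
    cases n with
    | zero => simp
    | succ n =>
      rw [Nat.add_sub_cancel, ← Module.End.mul_apply (ad x) (ad x ^ n), ← pow_succ',
        sub_sub, ← add_smul]
      congr 2
      push_cast
      ring

variable {ι : Type*} {d : ι → R} {a : ι → ℂ}

/-- Each `d i` has a scalar commutator with $x$, so the top iterated commutator is the symbol times
a factorial, and the next one vanishes. -/
theorem ad_pow_list_prod (h : ∀ i, d i * x = x * d i + a i • 1) (L : List ι) :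
    (ad x ^ L.length) (L.map d).prod =
        (((-1) ^ L.length * (L.length.factorial : ℂ)) * (L.map a).prod) • 1 ∧
      (ad x ^ (L.length + 1)) (L.map d).prod = 0 := by
  have h1 : ad x 1 = 0 := by rw [ad_apply, mul_one, one_mul, sub_self]
  induction L with
  | nil => simpa using h1
  | cons i L ih =>
    have h2 : (ad x ^ (i :: L).length) ((i :: L).map d).prod =
        (((-1) ^ (i :: L).length * ((i :: L).length.factorial : ℂ)) *
          ((i :: L).map a).prod) • 1 := by
      rw [List.length_cons, List.map_cons, List.prod_cons, ad_pow_mul (h i), ih.2, mul_zero,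
        zero_sub, Nat.add_sub_cancel, ih.1, smul_smul, ← neg_smul, List.map_cons,
        List.prod_cons, Nat.factorial_succ]
      congr 1
      push_cast
      ring
    refine ⟨h2, ?_⟩
    rw [pow_succ', Module.End.mul_apply, h2, map_smul, h1, smul_zero]

theorem Nil.mul_list_prod (h : ∀ i, d i * x = x * d i + a i • 1) {c : R} (hc : Commute x c)
    (L : List ι) : Nil x (L.length + 1) (c * (L.map d).prod) := by
  rw [nil_iff, ad_pow_mul_left hc, (ad_pow_list_prod h L).2, mul_zero]

/-- The number of commutators is one less than the individual terms require: the vanishing symbol of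
the sum removes the leading one. -/
theorem Nil.sum_mul_list_prod (h : ∀ i, d i * x = x * d i + a i • 1) {κ : Type*}
    (s : Finset κ) {c : κ → R} (hc : ∀ j, Commute x (c j)) {L : κ → List ι} {m : ℕ}
    (hL : ∀ j, (L j).length = m) (h0 : ∑ j ∈ s, ((L j).map a).prod • c j = 0) :
    Nil x m (∑ j ∈ s, c j * ((L j).map d).prod) := by
  rw [nil_iff, map_sum]
  have h1 : ∀ j, (ad x ^ m) (c j * ((L j).map d).prod) =
      ((-1) ^ m * (m.factorial : ℂ)) • (((L j).map a).prod • c j) := fun j => by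
    rw [ad_pow_mul_left (hc j), ← hL j, (ad_pow_list_prod h (L j)).1, mul_smul_comm, mul_one,
      mul_smul]
  simp only [h1]
  rw [← Finset.smul_sum, h0, smul_zero]

end Ad

end Nil

/-! ### Differential operators and their order filtration. -/

namespace FunctionAlgebra

variable {N : ℕ} (A : FunctionAlgebra N)

theorem pderiv_mul_mulOp_lin (p : Fin N → ℝ) (i : Fin N) :
    A.pderiv i * A.mulOp (A.lin p) =
      A.mulOp (A.lin p) * A.pderiv i + ((p i : ℝ) : ℂ) • 1 := by
  apply LinearMap.ext
  intro g
  simp only [LinearMap.add_apply, Module.End.mul_apply, mulOp_apply, LinearMap.smul_apply,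
    pderiv_mul, pderiv_lin, smul_mul_assoc, one_mul, Module.End.one_apply]
  exact add_comm _ _

/-- Differential operators of order at most `n` with coefficients in `A`. -/
def diffOps (n : ℕ) : Submodule ℂ (Module.End ℂ A.Fn) :=
  Submodule.span ℂ {D | ∃ (c : A.Fn) (L : List (Fin N)), L.length ≤ n ∧
    D = A.mulOp c * A.lderiv L}

variable {A}

theorem mulOp_mul_lderiv_mem (c : A.Fn) {L : List (Fin N)} {n : ℕ} (h : L.length ≤ n) :
    A.mulOp c * A.lderiv L ∈ A.diffOps n := Submodule.subset_span ⟨c, L, h, rfl⟩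

theorem diffOps_mono {m n : ℕ} (h : m ≤ n) : A.diffOps m ≤ A.diffOps n :=
  Submodule.span_mono fun _ ⟨c, L, hL, hD⟩ => ⟨c, L, hL.trans h, hD⟩

theorem mulOp_mul_mem {n : ℕ} {D : Module.End ℂ A.Fn} (hD : D ∈ A.diffOps n) (c : A.Fn) :
    A.mulOp c * D ∈ A.diffOps n := by
  induction hD using Submodule.span_induction with
  | mem D hD =>
    obtain ⟨d, L, hL, rfl⟩ := hD
    rw [← mul_assoc, ← map_mul]
    exact mulOp_mul_lderiv_mem _ hL
  | zero => rw [mul_zero]; exact Submodule.zero_mem _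
  | add D D' _ _ h h' => rw [mul_add]; exact Submodule.add_mem _ h h'
  | smul a D _ h => rw [mul_smul_comm]; exact Submodule.smul_mem _ a h

theorem pderiv_mul_mem {n : ℕ} {D : Module.End ℂ A.Fn} (hD : D ∈ A.diffOps n) (i : Fin N) :
    A.pderiv i * D ∈ A.diffOps (n + 1) := by
  induction hD using Submodule.span_induction with
  | mem D hD =>
    obtain ⟨c, L, hL, rfl⟩ := hD
    have h : A.pderiv i * (A.mulOp c * A.lderiv L) =
        A.mulOp (A.pderiv i c) * A.lderiv L + A.mulOp c * A.lderiv (i :: L) := by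
      apply LinearMap.ext
      intro g
      simp [pderiv_mul]
    rw [h]
    exact Submodule.add_mem _ (mulOp_mul_lderiv_mem _ (by omega))
      (mulOp_mul_lderiv_mem _ (by simpa using hL))
  | zero => rw [mul_zero]; exact Submodule.zero_mem _
  | add D D' _ _ h h' => rw [mul_add]; exact Submodule.add_mem _ h h'
  | smul a D _ h => rw [mul_smul_comm]; exact Submodule.smul_mem _ a h

theorem lderiv_mul_mem {n : ℕ} {D : Module.End ℂ A.Fn} (hD : D ∈ A.diffOps n)
    (L : List (Fin N)) : A.lderiv L * D ∈ A.diffOps (L.length + n) := by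
  induction L with
  | nil => simpa using hD
  | cons i L ih =>
    rw [lderiv_cons, mul_assoc, List.length_cons, Nat.add_right_comm]
    exact pderiv_mul_mem ih i

theorem mul_mem_diffOps {m n : ℕ} {D D' : Module.End ℂ A.Fn} (hD : D ∈ A.diffOps m)
    (hD' : D' ∈ A.diffOps n) : D * D' ∈ A.diffOps (m + n) := by
  induction hD using Submodule.span_induction with
  | mem D hD =>
    obtain ⟨c, L, hL, rfl⟩ := hD
    rw [mul_assoc]
    exact mulOp_mul_mem (diffOps_mono (by omega) (lderiv_mul_mem hD' L)) c
  | zero => rw [zero_mul]; exact Submodule.zero_mem _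
  | add D D₁ _ _ h h' => rw [add_mul]; exact Submodule.add_mem _ h h'
  | smul a D _ h => rw [smul_mul_assoc]; exact Submodule.smul_mem _ a h

theorem exists_coeff_of_mem_diffOps {n : ℕ} {D : Module.End ℂ A.Fn} (hD : D ∈ A.diffOps n) :
    ∃ c : (t : ℕ) → (Fin t → Fin N) → A.Fn, ∀ g, D g =
      ∑ t ∈ Finset.range (n + 1), ∑ J : Fin t → Fin N, c t J * A.pderivs J g := by
  classical
  induction hD using Submodule.span_induction with
  | mem D hD =>
    obtain ⟨c, L, hL, rfl⟩ := hD
    refine ⟨fun t J => if List.ofFn J = L then c else 0, fun g => ?_⟩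
    dsimp only
    rw [Finset.sum_eq_single L.length, Finset.sum_eq_single L.get]
    · rw [List.ofFn_get, if_pos rfl, pderivs_eq_lderiv, List.ofFn_get]
      rfl
    · intro J _ hJ
      rw [if_neg, zero_mul]
      intro h
      exact hJ (List.ofFn_injective (h.trans (List.ofFn_get L).symm))
    · simp
    · intro t _ ht
      refine Finset.sum_eq_zero fun J _ => ?_
      rw [if_neg, zero_mul]
      rintro rfl
      exact ht (List.length_ofFn).symm
    · intro h
      exact absurd (Finset.mem_range.2 (by omega)) h
  | zero => exact ⟨fun _ _ => 0, fun g => by simp⟩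
  | add D D' _ _ h h' =>
    obtain ⟨c, hc⟩ := h
    obtain ⟨d, hd⟩ := h'
    exact ⟨fun t J => c t J + d t J, fun g => by
      simp only [LinearMap.add_apply, hc, hd, add_mul, Finset.sum_add_distrib]⟩
  | smul a D _ h =>
    obtain ⟨c, hc⟩ := h
    exact ⟨fun t J => a • c t J, fun g => by
      simp only [LinearMap.smul_apply, hc, smul_mul_assoc, Finset.smul_sum]⟩

/-- The coefficient of `α^r` is of order at most `r`. -/
def Graded (D : A.Op) : Prop := ∀ r, A.opCoeff r D ∈ A.diffOps r

namespace Graded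

theorem one : Graded (1 : A.Op) := fun r => by
  rw [opCoeff_one]
  split_ifs
  · simpa using mulOp_mul_lderiv_mem (A := A) 1 (L := []) (Nat.zero_le r)
  · exact Submodule.zero_mem _

theorem fnOp (f : A.Fn) : Graded (A.fnOp f) := fun r => by
  rw [opCoeff_fnOp]
  split_ifs
  · simpa using mulOp_mul_lderiv_mem (A := A) f (L := []) (Nat.zero_le r)
  · exact Submodule.zero_mem _

theorem add {D D' : A.Op} (h : Graded D) (h' : Graded D') : Graded (D + D') := fun r => by
  rw [map_add]
  exact Submodule.add_mem _ (h r) (h' r)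

theorem smul {D : A.Op} (h : Graded D) (c : ℂ) : Graded (c • D) := fun r => by
  rw [map_smul]
  exact Submodule.smul_mem _ c (h r)

theorem sub {D D' : A.Op} (h : Graded D) (h' : Graded D') : Graded (D - D') := by
  rw [sub_eq_add_neg, ← neg_one_smul ℂ D']
  exact h.add (h'.smul _)

theorem mul {D D' : A.Op} (h : Graded D) (h' : Graded D') : Graded (D * D') := fun r => by
  rw [opCoeff_mul]
  refine Submodule.sum_mem _ fun q hq => ?_
  have := mul_mem_diffOps (h q.1) (h' q.2)
  rwa [Finset.HasAntidiagonal.mem_antidiagonal.1 hq] at this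

end Graded

end FunctionAlgebra

/-! ### Orders of the homogeneous parts of $e^{-E}e^{E+Y}$. -/

namespace Coeffs

open FunctionAlgebra

variable {N : ℕ} {A : FunctionAlgebra N} (Γ : Coeffs A)

theorem opCoeff_yop_eq (i : Fin N) (r : ℕ) : A.opCoeff r (Γ.yop i) =
    ∑ m ∈ Finset.Icc 1 r, ∑ I : Fin m → Fin N,
      A.mulOp (Γ i (r - m) m I) * A.lderiv (List.ofFn I) := by
  rw [opCoeff_yop]
  simp only [A.pderivs_eq_lderiv]
  rfl

theorem graded_yop (i : Fin N) : Graded (Γ.yop i) := fun r => by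
  rw [opCoeff_yop_eq]
  refine Submodule.sum_mem _ fun m hm => Submodule.sum_mem _ fun I _ => ?_
  exact mulOp_mul_lderiv_mem _ (by rw [List.length_ofFn]; exact (Finset.mem_Icc.1 hm).2)

theorem graded_xop (i : Fin N) : Graded (Γ.xop i) := (Graded.fnOp _).add (Γ.graded_yop i)

/-- The coefficient of $\alpha^r$ in $Y$ has order $r$, but its leading symbol at $p$ is the trace
of $\Gamma_0^{i(r)}$ and vanishes. Along $p$ its order is therefore at most $r-1$. -/
theorem nil_linY (hΓ : Γ.IsTraceless) (p : Fin N → ℝ) (r : ℕ) :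
    Nil (A.mulOp (A.lin p)) r (A.opCoeff r (Γ.linY p)) := by
  rw [coeff_linY]
  simp only [opCoeff_yop_eq, Finset.smul_sum]
  rw [Finset.sum_comm]
  refine Nil.sum _ fun m hm => ?_
  rw [Finset.mem_Icc] at hm
  have hc : ∀ c : A.Fn, Commute (A.mulOp (A.lin p)) (A.mulOp c) := fun c =>
    (Commute.all (A.lin p) c).map A.mulOp
  rcases hm.2.lt_or_eq with hlt | rfl
  · refine Nil.mono (m := m + 1) ?_ hlt
    refine Nil.sum _ fun i _ => Nil.sum _ fun I _ => ?_
    have h1 := Nil.mul_list_prod (R := Module.End ℂ A.Fn) (A.pderiv_mul_mulOp_lin p)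
      (hc (((p i : ℝ) : ℂ) • Γ i (r - m) m I)) (List.ofFn I)
    rwa [List.length_ofFn, map_smul, smul_mul_assoc] at h1
  · have h1 := Nil.sum_mul_list_prod (R := Module.End ℂ A.Fn) (A.pderiv_mul_mulOp_lin p)
      (Finset.univ : Finset (Fin N × (Fin m → Fin N)))
      (c := fun j => A.mulOp (((p j.1 : ℝ) : ℂ) • Γ j.1 (m - m) m j.2)) (fun j => hc _)
      (L := fun j => List.ofFn j.2) (m := m) (fun j => List.length_ofFn) (by
        have h2 := congrArg A.mulOp (hΓ (m - m) m hm.1 p)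
        simp only [contract_eq, Finset.smul_sum, map_sum, map_zero] at h2
        rw [Fintype.sum_prod_type, ← h2]
        refine Finset.sum_congr rfl fun i _ => Finset.sum_congr rfl fun I _ => ?_
        rw [smul_comm, map_smul, map_smul, map_smul]
        rfl)
    rw [Fintype.sum_prod_type] at h1
    simp only [map_smul, smul_mul_assoc] at h1
    exact h1

/-- The part of degree `m` in `p` of `exp(-p_j x^j) exp(p_j x̂^j)`, times `m!`. -/
def vlin (p : Fin N → ℝ) (m : ℕ) : A.Op := twist (A.fnOp (A.lin p)) (Γ.linX p) m

theorem vlin_succ (p : Fin N → ℝ) (m : ℕ) : Γ.vlin p (m + 1) =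
    Γ.vlin p m * Γ.linX p - A.fnOp (A.lin p) * Γ.vlin p m := rfl

theorem vlin_eq (p : Fin N → ℝ) (m : ℕ) : Γ.vlin p m = (m.factorial : ℂ) • Γ.expOp m p := by
  rw [vlin, twist_eq_sum, expOp, Finset.smul_sum]
  refine Finset.sum_congr rfl fun q hq => ?_
  obtain rfl := Finset.HasAntidiagonal.mem_antidiagonal.1 hq
  rw [smul_smul, ← Nat.cast_smul_eq_nsmul ℂ, Nat.cast_add_choose, div_eq_mul_inv]

/-- Each increase of $m$ lowers the order along $p$ by one: it either takes a commutator with $E$ or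
multiplies by $Y$, whose order along $p$ is below its order in $\alpha$. With `q = 0` this becomes
vanishing below $\alpha^m$. -/
theorem nil_vlin (hΓ : Γ.IsTraceless) (p : Fin N → ℝ) (m r q : ℕ) (h : r < q + m) :
    Nil (A.mulOp (A.lin p)) q (A.opCoeff r (Γ.vlin p m)) := by
  induction m generalizing r q with
  | zero =>
    change Nil _ q (A.opCoeff r 1)
    rw [A.opCoeff_one]
    split_ifs
    · refine Nil.mono (m := 1) ?_ (by omega)
      change _ * 1 - 1 * _ = _
      rw [mul_one, one_mul, sub_self]
    · exact Nil.zero q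
  | succ m ih =>
    have h1 : Γ.vlin p (m + 1) = Γ.vlin p m * Γ.linY p +
        -(A.fnOp (A.lin p) * Γ.vlin p m - Γ.vlin p m * A.fnOp (A.lin p)) := by
      rw [vlin_succ, linX, mul_add]
      abel
    rw [h1, map_add, map_neg, map_sub, A.opCoeff_fnOp_mul, A.opCoeff_mul_fnOp]
    -- The commutator with $E$ is absorbed by one more allowed commutator: the induction hypothesis
    -- is used at `q + 1`.
    refine Nil.add ?_ (Nil.neg (ih r (q + 1) (by omega)))
    rw [A.opCoeff_mul]
    refine Nil.sum _ fun x hx => ?_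
    have hx' := Finset.HasAntidiagonal.mem_antidiagonal.1 hx
    rcases lt_or_ge x.1 m with hlt | hge
    · have h0 : A.opCoeff x.1 (Γ.vlin p m) = 0 := ih x.1 0 (by omega)
      rw [h0, zero_mul]
      exact Nil.zero q
    · rcases Nat.eq_zero_or_pos x.2 with h0 | hpos
      · rw [h0, Γ.orderGE_linY p 0 Nat.one_pos, mul_zero]
        exact Nil.zero q
      · refine Nil.mono (m := (x.1 - m) + (x.2 - 1) + 1) ?_ (by omega)
        refine Nil.mul (ih x.1 (x.1 - m + 1) (by omega)) ?_
        rw [Nat.sub_add_cancel hpos]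
        exact Γ.nil_linY hΓ p x.2

theorem opCoeff_vlin_eq_zero (hΓ : Γ.IsTraceless) (p : Fin N → ℝ) {m r : ℕ} (h : r < m) :
    A.opCoeff r (Γ.vlin p m) = 0 := Γ.nil_vlin hΓ p m r 0 (by omega)

theorem opCoeff_mul_linX_lin_pow (hΓ : Γ.IsTraceless) (D : A.Op) (p : Fin N → ℝ) (r q : ℕ) :
    A.opCoeff r (D * Γ.linX p) (A.lin p ^ q) = A.opCoeff r D (A.lin p ^ (q + 1)) := by
  rw [linX, mul_add, map_add, LinearMap.add_apply, A.opCoeff_mul_fnOp, Module.End.mul_apply,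
    A.mulOp_apply, ← pow_succ', coeff_mul_apply_eq_zero
      (fun r => Γ.coeff_linY_lin_pow hΓ r q p), add_zero]

/-- Since $Y$ kills powers of $p\cdot x$, the operators $p\cdot\hat x$ and $p\cdot x$ agree on them,
so the first step from the identity already gives zero. The case $q=0$ yields right stability of
unity. -/
theorem opCoeff_vlin_lin_pow (hΓ : Γ.IsTraceless) (p : Fin N → ℝ) (m r q : ℕ) :
    A.opCoeff r (Γ.vlin p (m + 1)) (A.lin p ^ q) = 0 := by
  rw [vlin_succ, map_sub, LinearMap.sub_apply, Γ.opCoeff_mul_linX_lin_pow hΓ,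
    A.opCoeff_fnOp_mul, Module.End.mul_apply, A.mulOp_apply]
  cases m with
  | zero =>
    change A.opCoeff r 1 _ - _ * A.opCoeff r 1 _ = 0
    rw [A.opCoeff_one]
    split_ifs
    · rw [Module.End.one_apply, Module.End.one_apply, pow_succ', sub_self]
    · simp
  | succ m => rw [opCoeff_vlin_lin_pow hΓ p m, opCoeff_vlin_lin_pow hΓ p m, mul_zero, sub_self]

/-- The tensor whose contraction is `vlin`. -/
def vlist : List (Fin N) → A.Op
  | [] => 1
  | i :: L => vlist L * Γ.xop i - A.fnOp (A.coord i) * vlist L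

theorem graded_vlist (L : List (Fin N)) : Graded (Γ.vlist L) := by
  induction L with
  | nil => exact Graded.one
  | cons i L ih => exact (ih.mul (Γ.graded_xop i)).sub ((Graded.fnOp _).mul ih)

theorem sum_mon_smul_vlist (p : Fin N → ℝ) (m : ℕ) :
    ∑ I : Fin m → Fin N, mon p (List.ofFn I) • Γ.vlist (List.ofFn I) = Γ.vlin p m := by
  induction m with
  | zero => simp [vlist, vlin, twist]
  | succ m ih =>
    rw [sum_fin_succ m fun L => mon p L • Γ.vlist L, vlin_succ, linX_eq, A.fnOp_lin,
      Finset.mul_sum, Finset.sum_mul, ← ih, ← Finset.sum_sub_distrib]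
    refine Finset.sum_congr rfl fun i _ => ?_
    rw [mul_smul_comm, smul_mul_assoc, Finset.sum_mul, Finset.mul_sum, ← smul_sub,
      ← Finset.sum_sub_distrib, Finset.smul_sum]
    refine Finset.sum_congr rfl fun I _ => ?_
    rw [mon_cons, mul_smul, vlist, smul_sub, smul_mul_assoc, mul_smul_comm]

end Coeffs

namespace FunctionAlgebra

variable {N : ℕ} (A : FunctionAlgebra N)

theorem lin_single (i : Fin N) : A.lin (Pi.single i 1) = A.coord i := by
  classical
  rw [lin, Finset.sum_eq_single i]
  · simp
  · intro j _ hj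
    simp [hj]
  · simp

theorem lderiv_ofFn_comp_perm {m : ℕ} (I : Fin m → Fin N) (σ : Equiv.Perm (Fin m)) (f : A.Fn) :
    A.lderiv (List.ofFn (I ∘ σ)) f = A.lderiv (List.ofFn I) f := by
  rw [A.lderiv_perm (ofFn_comp_perm I σ)]

end FunctionAlgebra

/-! ### Construction of the star product from $\Gamma$. -/

namespace Coeffs

open FunctionAlgebra

variable {N : ℕ} {A : FunctionAlgebra N} (Γ : Coeffs A)

theorem linX_single (i : Fin N) : Γ.linX (Pi.single i 1) = Γ.xop i := by
  classical
  rw [linX_eq, Finset.sum_eq_single i]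
  · simp
  · intro j _ hj
    simp [hj]
  · simp

theorem opCoeff_vlin_apply (p : Fin N → ℝ) (m r : ℕ) (g : A.Fn) :
    A.opCoeff r (Γ.vlin p m) g = ∑ I : Fin m → Fin N,
      mon p (List.ofFn I) • A.opCoeff r (Γ.vlist (List.ofFn I)) g := by
  rw [← sum_mon_smul_vlist, map_sum, LinearMap.sum_apply]
  simp only [map_smul, LinearMap.smul_apply]

/-- The pairing of `vlist` with derivatives depends on `vlin` only. -/
theorem sum_lderiv_mul_vlist (r m : ℕ) (f g : A.Fn) (c : (Fin m → Fin N) → A.Fn)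
    (h : ∀ p, A.opCoeff r (Γ.vlin p m) g = ∑ I, mon p (List.ofFn I) • c I) :
    ∑ I : Fin m → Fin N, A.lderiv (List.ofFn I) f * A.opCoeff r (Γ.vlist (List.ofFn I)) g =
      ∑ I : Fin m → Fin N, A.lderiv (List.ofFn I) f * c I := by
  rw [← sub_eq_zero, ← Finset.sum_sub_distrib]
  simp only [← mul_sub]
  refine sum_mul_eq_zero_of_contract_eq_zero
    (c := fun I => A.opCoeff r (Γ.vlist (List.ofFn I)) g - c I)
    (s := fun I => A.lderiv (List.ofFn I) f) (fun p => ?_)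
    fun I σ => A.lderiv_ofFn_comp_perm I σ f
  simp only [smul_sub, Finset.sum_sub_distrib]
  rw [← opCoeff_vlin_apply, h, sub_self]

/-- The bidifferential operators of the Weyl star product. -/
def weylC (r : ℕ) : A.Fn →ₗ[ℂ] A.Fn →ₗ[ℂ] A.Fn :=
  ∑ m ∈ Finset.range (r + 1), ((m.factorial : ℂ)⁻¹) • ∑ I : Fin m → Fin N,
    (LinearMap.mul ℂ A.Fn).compl₁₂ (A.lderiv (List.ofFn I))
      (A.opCoeff r (Γ.vlist (List.ofFn I)))

theorem weylC_apply (r : ℕ) (f g : A.Fn) : Γ.weylC r f g =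
    ∑ m ∈ Finset.range (r + 1), ((m.factorial : ℂ)⁻¹) • ∑ I : Fin m → Fin N,
      A.lderiv (List.ofFn I) f * A.opCoeff r (Γ.vlist (List.ofFn I)) g := by
  simp [weylC, LinearMap.sum_apply]

/-- The cutoff $m\le r$ bounds the derivatives on the first argument, and `graded_vlist` those on
the second. -/
theorem weylC_isBidiffOfOrder (r : ℕ) : A.IsBidiffOfOrder r r (Γ.weylC r) := by
  choose c hc using fun L : List (Fin N) =>
    exists_coeff_of_mem_diffOps (Γ.graded_vlist L r)
  refine ⟨fun s t I J => ((s.factorial : ℂ)⁻¹) • c (List.ofFn I) t J, fun f g => ?_⟩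
  rw [weylC_apply]
  refine Finset.sum_congr rfl fun s _ => ?_
  conv_rhs => rw [Finset.sum_comm]
  rw [Finset.smul_sum]
  refine Finset.sum_congr rfl fun I _ => ?_
  rw [hc, Finset.mul_sum, Finset.smul_sum]
  refine Finset.sum_congr rfl fun t _ => ?_
  rw [Finset.mul_sum, Finset.smul_sum]
  refine Finset.sum_congr rfl fun J _ => ?_
  rw [A.pderivs_eq_lderiv I, smul_mul_assoc, smul_mul_assoc, mul_left_comm, mul_assoc]

/-- Differentiating $(p\cdot x)^n$ turns the defining sum into the binomial expansion of
$(p\cdot\hat x)^n$. This contracted identity carries Weyl ordering. -/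
theorem weylC_lin_pow (hΓ : Γ.IsTraceless) (r n : ℕ) (p : Fin N → ℝ) (g : A.Fn) :
    Γ.weylC r (A.lin p ^ n) g = A.opCoeff r (Γ.linX p ^ n) g := by
  have h1 : ∀ m, ((m.factorial : ℂ)⁻¹) • ∑ I : Fin m → Fin N,
      A.lderiv (List.ofFn I) (A.lin p ^ n) * A.opCoeff r (Γ.vlist (List.ofFn I)) g =
      (n.choose m : ℂ) • (A.lin p ^ (n - m) * A.opCoeff r (Γ.vlin p m) g) := by
    intro m
    rw [opCoeff_vlin_apply, Finset.mul_sum, Finset.smul_sum, Finset.smul_sum]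
    refine Finset.sum_congr rfl fun I _ => ?_
    rw [A.lderiv_lin_pow, List.length_ofFn, smul_mul_assoc, mul_smul_comm, smul_smul, smul_smul,
      Nat.descFactorial_eq_factorial_mul_choose]
    congr 1
    have : (m.factorial : ℂ) ≠ 0 := Nat.cast_ne_zero.2 m.factorial_ne_zero
    push_cast
    field_simp
  have h2 : A.opCoeff r (Γ.linX p ^ n) g = ∑ m ∈ Finset.range (n + 1),
      (n.choose m : ℂ) • (A.lin p ^ (n - m) * A.opCoeff r (Γ.vlin p m) g) := by
    rw [pow_eq_sum_twist (A.fnOp (A.lin p)) (Γ.linX p) n, map_sum, LinearMap.sum_apply]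
    refine Finset.sum_congr rfl fun m _ => ?_
    rw [← Nat.cast_smul_eq_nsmul ℂ, map_smul, LinearMap.smul_apply, ← map_pow,
      A.opCoeff_fnOp_mul]
    rfl
  rw [weylC_apply, h2]
  simp only [h1]
  -- The sums end at $r$ and at $n$. In the common range, extra terms vanish on one side because the
  -- degree $m$ part is $O(\alpha^m)$, and on the other because $\binom nm=0$.
  trans ∑ m ∈ Finset.range (r + n + 1),
    (n.choose m : ℂ) • (A.lin p ^ (n - m) * A.opCoeff r (Γ.vlin p m) g)
  · refine Finset.sum_subset (Finset.range_mono (by omega)) fun m _ hm => ?_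
    rw [Γ.opCoeff_vlin_eq_zero hΓ p (by simpa using hm), LinearMap.zero_apply, mul_zero,
      smul_zero]
  · refine (Finset.sum_subset (Finset.range_mono (by omega)) fun m _ hm => ?_).symm
    rw [Nat.choose_eq_zero_of_lt (by simpa using hm), Nat.cast_zero, zero_smul]

theorem weylC_coord (hΓ : Γ.IsTraceless) (r : ℕ) (i : Fin N) (g : A.Fn) :
    Γ.weylC r (A.coord i) g = A.opCoeff r (Γ.xop i) g := by
  have := Γ.weylC_lin_pow hΓ r 1 (Pi.single i 1) g
  rwa [pow_one, pow_one, A.lin_single, linX_single] at this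

theorem weylC_one_left (hΓ : Γ.IsTraceless) (r : ℕ) (g : A.Fn) :
    Γ.weylC r 1 g = if r = 0 then g else 0 := by
  have := Γ.weylC_lin_pow hΓ r 0 0 g
  rw [pow_zero, pow_zero, A.opCoeff_one] at this
  rw [this]
  split_ifs <;> simp

theorem weylC_eq_sum_add (r : ℕ) (f g : A.Fn) : Γ.weylC r f g =
    (∑ m ∈ Finset.Icc 1 r, ((m.factorial : ℂ)⁻¹) • ∑ I : Fin m → Fin N,
      A.lderiv (List.ofFn I) f * A.opCoeff r (Γ.vlist (List.ofFn I)) g) +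
      if r = 0 then f * g else 0 := by
  rw [weylC_apply, Finset.range_eq_Ico, Finset.sum_eq_sum_Ico_succ_bot (Nat.succ_pos r), add_comm]
  congr 1
  simp only [vlist, List.ofFn_zero, A.opCoeff_one]
  split_ifs <;> simp

theorem weylC_one_right (hΓ : Γ.IsTraceless) (r : ℕ) (f : A.Fn) :
    Γ.weylC r f 1 = if r = 0 then f else 0 := by
  rw [weylC_eq_sum_add, Finset.sum_eq_zero, zero_add, mul_one]
  intro m hm
  rw [Γ.sum_lderiv_mul_vlist r m f 1 (fun _ => 0)]
  · simp
  · intro p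
    obtain ⟨m, rfl⟩ := Nat.exists_eq_add_of_le' (Finset.mem_Icc.1 hm).1
    have := Γ.opCoeff_vlin_lin_pow hΓ p m r 0
    rw [pow_zero] at this
    simp [this]

/-- The weight is exactly what makes $F-\Gamma/m=(-1)^{m+k}\Gamma$. For $m=1$, $F$ vanishes, and so
does $\Gamma_k$ unless $k=0$, where the sign is $-1$ as required. -/
theorem IsRecursive.opCoeff_vlin_coord {P : Fin N → Fin N → A.Fn} {Γ : Coeffs A}
    (h : Γ.IsRecursive P) (hΓ : Γ.IsTraceless) (p : Fin N → ℝ) {m r : ℕ} (hm : 1 ≤ m)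
    (hr : m ≤ r) (j : Fin N) : A.opCoeff r (Γ.vlin p m) (A.coord j) =
      ((m.factorial : ℂ) * (-1) ^ r) • Γ.contract j (r - m) m p := by
  obtain ⟨k, rfl⟩ := Nat.exists_eq_add_of_le hr
  rw [vlin_eq, map_smul, LinearMap.smul_apply, Γ.coeff_expOp_coord hΓ k m hm,
    Nat.add_sub_cancel_left, mul_smul]
  congr 1
  rcases hm.eq_or_lt with rfl | hm2
  · rw [F_one, zero_sub, Nat.cast_one, inv_one, one_smul]
    rcases Nat.eq_zero_or_pos k with rfl | hk
    · simp
    · have : Γ.contract j k 1 p = 0 := by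
        rw [contract]
        exact Finset.sum_eq_zero fun I _ => by rw [h.one j k I hk, smul_zero]
      rw [this, smul_zero, neg_zero]
  · have h0 := one_add_ne_zero k hm2
    have hm0 : (m : ℂ) ≠ 0 := Nat.cast_ne_zero.2 (by omega)
    rw [h.recursion j k m hm2, smul_smul, smul_smul, ← one_smul ℂ (Γ.F j k m p), smul_smul,
      smul_smul, ← sub_smul, weight]
    congr 1
    generalize (-1 : ℂ) ^ (m + k) = s at h0 ⊢
    rw [mul_one, mul_one, mul_div_left_comm, mul_div_assoc', mul_inv_cancel₀ hm0, one_sub_div h0,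
      add_sub_cancel_left, mul_div_assoc]

/-- Weak Hermiticity in coefficient form, before reality of $\Gamma$ is used; the sign matches the
conjugation of $\mathrm i^r$. -/
theorem IsRecursive.weylC_coord_right {P : Fin N → Fin N → A.Fn} {Γ : Coeffs A}
    (h : Γ.IsRecursive P) (hΓ : Γ.IsTraceless) (r : ℕ) (j : Fin N) (f : A.Fn) :
    Γ.weylC r f (A.coord j) = (-1 : ℂ) ^ r • A.opCoeff r (Γ.xop j) f := by
  rw [weylC_eq_sum_add, xop, map_add, LinearMap.add_apply, coeff_yop_apply, A.opCoeff_fnOp,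
    smul_add, add_comm]
  congr 1
  · split_ifs with h0
    · subst h0
      simp [mul_comm]
    · simp
  · rw [Finset.smul_sum]
    refine Finset.sum_congr rfl fun m hm => ?_
    rw [Finset.mem_Icc] at hm
    rw [Γ.sum_lderiv_mul_vlist r m f (A.coord j)
      (fun I => ((m.factorial : ℂ) * (-1) ^ r) • Γ j (r - m) m I), Finset.smul_sum,
      Finset.smul_sum]
    · refine Finset.sum_congr rfl fun I _ => ?_
      rw [mul_smul_comm, smul_smul, ← mul_assoc, inv_mul_cancel₀, one_mul, mul_comm (Γ j _ _ _)]
      exact Nat.cast_ne_zero.2 m.factorial_ne_zero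
    · intro p
      rw [h.opCoeff_vlin_coord hΓ p hm.1 hm.2, contract_eq, Finset.smul_sum]
      exact Finset.sum_congr rfl fun I _ => smul_comm _ _ _

theorem IsRecursive.weylC_one {P : Fin N → Fin N → A.Fn} {Γ : Coeffs A}
    (h : Γ.IsRecursive P) (f g : A.Fn) : Γ.weylC 1 f g = A.bracket P f g := by
  rw [weylC_eq_sum_add]
  simp only [Finset.Icc_self, Finset.sum_singleton, Nat.factorial_one, Nat.cast_one, inv_one,
    one_smul, one_ne_zero, if_false, add_zero, bracket]
  refine Fintype.sum_equiv (Equiv.funUnique (Fin 1) (Fin N)) _ _ fun I => ?_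
  have h1 : Γ.vlist (List.ofFn I) = Γ.yop (I 0) := by
    simp [vlist, xop]
  have h2 : A.opCoeff 1 (Γ.yop (I 0)) g = ∑ j, P (I 0) j * A.pderiv j g := by
    rw [coeff_yop_apply]
    simp only [Finset.Icc_self, Finset.sum_singleton]
    refine Fintype.sum_equiv (Equiv.funUnique (Fin 1) (Fin N)) _ _ fun J => ?_
    have h3 := h.base (I 0) J
    simp only [Nat.sub_self] at h3 ⊢
    rw [h3]
    simp
  rw [h1, h2, Finset.mul_sum]
  refine Finset.sum_congr rfl fun j _ => ?_
  simp only [List.ofFn_succ, List.ofFn_zero, lderiv_cons, lderiv_nil, mul_one,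
    Equiv.funUnique_apply]
  rw [← mul_assoc, mul_comm (A.pderiv _ _)]
  rfl

/-- The Weyl star product with coefficients `Γ`. -/
def weylStarProduct : StarProduct A where
  C := Γ.weylC
  C_zero f g := by
    rw [weylC_eq_sum_add]
    simp
  bidiff r := ⟨r, r, Γ.weylC_isBidiffOfOrder r⟩

end Coeffs

/-! ### Coefficient form of the star product axioms. -/

namespace StarProduct

variable {N : ℕ} {A : FunctionAlgebra N} (S : StarProduct A)

/-- The series of operators representing `f̂`. -/
def hatOp (f : A.Fn) : A.Op := A.opMk fun r => S.C r f

theorem toEnd_hatOp (f : A.Fn) : A.toEnd (S.hatOp f) = S.hat f := A.toEnd_mk _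

theorem opCoeff_hatOp (f : A.Fn) (r : ℕ) : A.opCoeff r (S.hatOp f) = S.C r f := A.opCoeff_opMk _ r

theorem coeff_star (f g : A.Fn) (r : ℕ) :
    PowerSeries.coeff r (S.star f g) = Complex.I ^ r • S.C r f g := A.coeff_opSeries_C _ _ _

theorem hat_eq_xhat_iff {i : Fin N} {Γ : Coeffs A} :
    S.hat (A.coord i) = Γ.xhat i ↔ S.hatOp (A.coord i) = Γ.xop i := by
  rw [← toEnd_hatOp, ← Γ.toEnd_xop, A.toEnd_injective.eq_iff]

theorem HasCoeffs.hatOp {S : StarProduct A} {Γ : Coeffs A} (h : S.HasCoeffs Γ) (i : Fin N) :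
    S.hatOp (A.coord i) = Γ.xop i := S.hat_eq_xhat_iff.1 (h.2 i)

theorem isWeyl_iff : S.IsWeyl ↔ ∀ (n : ℕ) (I : Fin n → Fin N) (f : A.Fn) (r : ℕ),
    S.C r (∏ a, A.coord (I a)) f = ((n.factorial : ℂ)⁻¹) • ∑ σ : Equiv.Perm (Fin n),
      A.opCoeff r ((List.ofFn fun a => S.hatOp (A.coord (I (σ a)))).prod) f := by
  have key : ∀ (n : ℕ) (I : Fin n → Fin N) (f : A.Fn) (r : ℕ),
      PowerSeries.coeff r (((n.factorial : ℂ)⁻¹) • ∑ σ : Equiv.Perm (Fin n),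
        (List.ofFn fun a => S.hat (A.coord (I (σ a)))).prod (PowerSeries.C f)) =
      Complex.I ^ r • ((n.factorial : ℂ)⁻¹) • ∑ σ : Equiv.Perm (Fin n),
        A.opCoeff r ((List.ofFn fun a => S.hatOp (A.coord (I (σ a)))).prod) f := by
    intro n I f r
    rw [PowerSeries.coeff_smul, map_sum, smul_comm (Complex.I ^ r)]
    refine congrArg (fun x => ((n.factorial : ℂ)⁻¹) • x) ?_
    rw [Finset.smul_sum]
    refine Finset.sum_congr rfl fun σ _ => ?_
    rw [← A.coeff_toEnd_C, map_list_prod, List.map_ofFn]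
    simp only [Function.comp_def, toEnd_hatOp]
  constructor
  · intro h n I f r
    have h1 := congrArg (PowerSeries.coeff r) (h n I f)
    rw [key, coeff_star] at h1
    exact smul_right_injective _ (pow_ne_zero r Complex.I_ne_zero) h1
  · intro h n I f
    ext1 r
    rw [key, coeff_star, h]

end StarProduct

/-! ### Weyl ordering by polarization, and existence. -/

namespace Coeffs

open FunctionAlgebra

variable {N : ℕ} {A : FunctionAlgebra N} (Γ : Coeffs A)

theorem sum_mon_smul_prod_coord (p : Fin N → ℝ) (n : ℕ) :
    ∑ I : Fin n → Fin N, mon p (List.ofFn I) • ∏ a, A.coord (I a) = A.lin p ^ n := by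
  have h : A.lin p ^ n = ∏ _a : Fin n, ∑ i, ((p i : ℝ) : ℂ) • A.coord i := by
    simp [lin, -Complex.coe_smul]
  rw [h, Finset.prod_univ_sum, Fintype.piFinset_univ]
  refine Finset.sum_congr rfl fun I _ => ?_
  rw [Finset.prod_smul, prod_eq_mon]

theorem sum_mon_smul_list_prod {R : Type*} [Ring R] [Algebra ℂ R] (p : Fin N → ℝ) (n : ℕ)
    (x : Fin N → R) : ∑ I : Fin n → Fin N, mon p (List.ofFn I) • ((List.ofFn I).map x).prod =
      (∑ i, ((p i : ℝ) : ℂ) • x i) ^ n := by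
  induction n with
  | zero => simp
  | succ n ih =>
    rw [sum_fin_succ n fun L => mon p L • (L.map x).prod, pow_succ', ← ih, Finset.sum_mul]
    refine Finset.sum_congr rfl fun i _ => ?_
    rw [Finset.mul_sum]
    refine Finset.sum_congr rfl fun I _ => ?_
    rw [mon_cons, List.map_cons, List.prod_cons, smul_mul_smul_comm]

/-- Every permutation contributes equally to the contraction, which cancels $1/n!$ and leaves a pure
power. -/
theorem sum_mon_smul_symmetrized (p : Fin N → ℝ) (n r : ℕ) (x : Fin N → A.Op) (f : A.Fn) :
    ∑ I : Fin n → Fin N, mon p (List.ofFn I) • ((n.factorial : ℂ)⁻¹) •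
      ∑ σ : Equiv.Perm (Fin n), A.opCoeff r ((List.ofFn fun a => x (I (σ a))).prod) f =
    A.opCoeff r ((∑ i, ((p i : ℝ) : ℂ) • x i) ^ n) f := by
  have hn : (n.factorial : ℂ) ≠ 0 := Nat.cast_ne_zero.2 n.factorial_ne_zero
  have h1 : ∀ σ : Equiv.Perm (Fin n), ∑ I : Fin n → Fin N, mon p (List.ofFn I) •
      A.opCoeff r ((List.ofFn fun a => x (I (σ a))).prod) f =
        A.opCoeff r ((∑ i, ((p i : ℝ) : ℂ) • x i) ^ n) f := by
    intro σ
    have h2 : ∀ I : Fin n → Fin N, mon p (List.ofFn I) •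
        A.opCoeff r ((List.ofFn fun a => x (I (σ a))).prod) f =
        mon p (List.ofFn (I ∘ σ)) •
          A.opCoeff r (((List.ofFn (I ∘ σ)).map x).prod) f := fun I => by
      rw [mon_perm p (ofFn_comp_perm I σ), List.map_ofFn]
      rfl
    simp only [h2]
    rw [sum_comp_perm σ fun I => mon p (List.ofFn I) •
      A.opCoeff r (((List.ofFn I).map x).prod) f, ← sum_mon_smul_list_prod,
      map_sum, LinearMap.sum_apply]
    simp only [map_smul, LinearMap.smul_apply]
  simp only [smul_comm _ ((n.factorial : ℂ)⁻¹), ← Finset.smul_sum]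
  simp only [Finset.smul_sum (r := mon p _)]
  rw [Finset.sum_comm]
  simp only [h1]
  rw [Finset.sum_const, Finset.card_univ, Fintype.card_perm, Fintype.card_fin,
    ← Nat.cast_smul_eq_nsmul ℂ, smul_smul, inv_mul_cancel₀ hn, one_smul]

theorem sum_mon_smul_C_prod_coord (C : A.Fn →ₗ[ℂ] A.Fn →ₗ[ℂ] A.Fn) (p : Fin N → ℝ) (n : ℕ)
    (f : A.Fn) : ∑ I : Fin n → Fin N, mon p (List.ofFn I) • C (∏ a, A.coord (I a)) f =
      C (A.lin p ^ n) f := by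
  rw [← sum_mon_smul_prod_coord, map_sum, LinearMap.sum_apply]
  simp only [map_smul, LinearMap.smul_apply]

theorem weylStarProduct_hatOp_coord (hΓ : Γ.IsTraceless) (i : Fin N) :
    Γ.weylStarProduct.hatOp (A.coord i) = Γ.xop i := op_ext fun r f => by
  rw [Γ.weylStarProduct.opCoeff_hatOp]
  exact Γ.weylC_coord hΓ r i f

/-- Both sides are symmetric in the indices, so it suffices to compare contractions, where both
become $(p\cdot\hat x)^n$. -/
theorem weylStarProduct_isWeyl (hΓ : Γ.IsTraceless) : Γ.weylStarProduct.IsWeyl := by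
  rw [StarProduct.isWeyl_iff]
  intro n I f r
  simp only [Γ.weylStarProduct_hatOp_coord hΓ]
  refine congrFun (eq_of_contract_eq (c := fun I => Γ.weylC r (∏ a, A.coord (I a)) f)
    (d := fun I => ((n.factorial : ℂ)⁻¹) • ∑ σ : Equiv.Perm (Fin n),
      A.opCoeff r ((List.ofFn fun a => Γ.xop (I (σ a))).prod) f) ?_ ?_ ?_) I
  · intro I σ
    have : ∏ a, A.coord ((I ∘ σ) a) = ∏ a, A.coord (I a) :=
      Equiv.prod_comp σ fun a => A.coord (I a)
    rw [this]
  · intro I τ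
    refine congrArg (fun x => ((n.factorial : ℂ)⁻¹) • x) ?_
    exact Fintype.sum_equiv (Equiv.mulLeft τ) _ _ fun σ => rfl
  · intro p
    rw [sum_mon_smul_C_prod_coord, Γ.weylC_lin_pow hΓ, sum_mon_smul_symmetrized, linX_eq]

theorem weylStarProduct_isWeylQuantization {P : Fin N → Fin N → A.Fn} (h : Γ.IsRecursive P)
    (hP : ∀ i j, A.conj (P i j) = P i j) (hP' : ∀ i j, P j i = -P i j) :
    Γ.weylStarProduct.IsWeylQuantization P := by
  have hΓ := h.traceless hP'
  have hr := h.real hP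
  refine ⟨fun f g => ?_, Γ.weylStarProduct_isWeyl hΓ, ⟨Γ.weylC_isBidiffOfOrder, Γ,
    ⟨h.symm, fun i => ?_⟩, fun i k j hk => h.one i k j hk⟩, fun j f => ?_, fun f => ⟨?_, ?_⟩⟩
  · change Γ.weylC 1 f g - Γ.weylC 1 g f = _
    rw [h.weylC_one, h.weylC_one, two_smul, sub_eq_add_neg]
    congr 1
    rw [bracket, bracket, ← Finset.sum_neg_distrib, Finset.sum_comm]
    refine Finset.sum_congr rfl fun i _ => ?_
    rw [← Finset.sum_neg_distrib]
    refine Finset.sum_congr rfl fun j _ => ?_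
    rw [hP' i j]
    ring
  · rw [StarProduct.hat_eq_xhat_iff, Γ.weylStarProduct_hatOp_coord hΓ]
  · ext1 r
    rw [StarProduct.coeff_star, conjSeries, PowerSeries.coeff_mk, StarProduct.coeff_star]
    change A.conj (Complex.I ^ r • Γ.weylC r (A.coord j) f) =
      Complex.I ^ r • Γ.weylC r (A.conj f) (A.coord j)
    rw [Γ.weylC_coord hΓ, h.weylC_coord_right hΓ, A.conj_smul, smul_smul, map_pow,
      Complex.conj_I, neg_pow, mul_comm]
    congr 1
    have h1 : A.conjOp (Γ.xop j) = Γ.xop j := by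
      rw [xop, map_add, A.conjOp_fnOp, A.conj_coord, conjOp_yop]
      congr 1
      refine op_ext fun r f => ?_
      rw [coeff_yop_apply, coeff_yop_apply]
      refine Finset.sum_congr rfl fun m hm => Finset.sum_congr rfl fun I _ => ?_
      have h2 := hr j (r - m) m I (Finset.mem_Icc.1 hm).1
      change A.conj (Γ j (r - m) m I) * _ = _
      rw [h2]
    conv_rhs => rw [← h1]
    rw [A.opCoeff_conjOp, A.conj_conj]
  · ext1 r
    rw [StarProduct.coeff_star, PowerSeries.coeff_C]
    change _ • Γ.weylC r f 1 = _
    rw [Γ.weylC_one_right hΓ]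
    split_ifs with h0 <;> simp [h0]
  · ext1 r
    rw [StarProduct.coeff_star, PowerSeries.coeff_C]
    change _ • Γ.weylC r 1 f = _
    rw [Γ.weylC_one_left hΓ]
    split_ifs with h0 <;> simp [h0]

end Coeffs

/-! ### Uniqueness: recovering $\Gamma$ from the axioms. -/

/-- The system is triangular: at $q=t$ the falling factorial kills larger indices and induction
kills smaller ones, leaving $t!\,a_t=0$. -/
theorem eq_zero_of_sum_descFactorial {V : Type*} [CommRing V] [Algebra ℂ V] (x : V)
    (s : Finset ℕ) (a : ℕ → V)
    (h : ∀ q, ∑ t ∈ s, (q.descFactorial t : ℂ) • (a t * x ^ (q - t)) = 0) {t : ℕ} (ht : t ∈ s) :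
    a t = 0 := by
  induction t using Nat.strong_induction_on with
  | _ t ih =>
    have h1 := h t
    rw [Finset.sum_eq_single_of_mem t ht, Nat.descFactorial_self, Nat.sub_self, pow_zero,
      mul_one] at h1
    · exact (smul_eq_zero.1 h1).resolve_left (Nat.cast_ne_zero.2 t.factorial_ne_zero)
    · intro u hu hut
      rcases hut.lt_or_gt with h2 | h2
      · rw [ih u h2 hu, zero_mul, smul_zero]
      · rw [Nat.descFactorial_of_lt h2, Nat.cast_zero, zero_smul]

namespace FunctionAlgebra

variable {N : ℕ} {A : FunctionAlgebra N}

/-- A differential operator that vanishes on the powers of linear functions is zero. -/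
theorem eq_zero_of_mem_diffOps {n : ℕ} {D : Module.End ℂ A.Fn} (hD : D ∈ A.diffOps n)
    (h : ∀ p q, D (A.lin p ^ q) = 0) : D = 0 := by
  obtain ⟨c, hc⟩ := exists_coeff_of_mem_diffOps hD
  have key : ∀ t ∈ Finset.range (n + 1), ∀ p : Fin N → ℝ,
      ∑ J, mon p (List.ofFn J) • c t J = 0 := by
    intro t ht p
    refine eq_zero_of_sum_descFactorial (A.lin p) (Finset.range (n + 1))
      (fun t => ∑ J, mon p (List.ofFn J) • c t J) (fun q => ?_) ht
    rw [← h p q, hc]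
    refine Finset.sum_congr rfl fun t _ => ?_
    rw [Finset.sum_mul, Finset.smul_sum]
    refine Finset.sum_congr rfl fun J _ => ?_
    rw [A.pderivs_eq_lderiv, A.lderiv_lin_pow, List.length_ofFn, smul_mul_assoc, mul_smul_comm,
      smul_smul]
  refine LinearMap.ext fun f => ?_
  rw [hc, LinearMap.zero_apply]
  refine Finset.sum_eq_zero fun t ht => ?_
  simp only [A.pderivs_eq_lderiv, mul_comm (c t _)]
  exact sum_mul_eq_zero_of_contract_eq_zero (key t ht) fun I σ => A.lderiv_ofFn_comp_perm I σ f

theorem ext_of_mem_diffOps {n : ℕ} {D D' : Module.End ℂ A.Fn} (hD : D ∈ A.diffOps n)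
    (hD' : D' ∈ A.diffOps n) (h : ∀ p q, D (A.lin p ^ q) = D' (A.lin p ^ q)) : D = D' := by
  have hs : D + (-1 : ℂ) • D' ∈ A.diffOps n :=
    Submodule.add_mem _ hD (Submodule.smul_mem _ _ hD')
  have h0 := eq_zero_of_mem_diffOps hs fun p q => by
    rw [LinearMap.add_apply, LinearMap.smul_apply, h, neg_one_smul]
    exact add_neg_cancel _
  refine LinearMap.ext fun f => ?_
  have h1 := LinearMap.congr_fun h0 f
  rw [LinearMap.add_apply, LinearMap.smul_apply, neg_one_smul] at h1
  exact add_neg_eq_zero.1 h1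

theorem IsBidiffOfOrder.flip_mem_diffOps {a b : ℕ} {C : A.Fn →ₗ[ℂ] A.Fn →ₗ[ℂ] A.Fn}
    (h : A.IsBidiffOfOrder a b C) (g : A.Fn) : C.flip g ∈ A.diffOps a := by
  obtain ⟨c, hc⟩ := h
  have : C.flip g = ∑ s ∈ Finset.range (a + 1), ∑ t ∈ Finset.range (b + 1),
      ∑ I : Fin s → Fin N, ∑ J : Fin t → Fin N,
        A.mulOp (c s t I J * A.pderivs J g) * A.lderiv (List.ofFn I) := by
    refine LinearMap.ext fun f => ?_
    rw [LinearMap.flip_apply, hc]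
    simp only [LinearMap.sum_apply, Module.End.mul_apply, mulOp_apply, A.pderivs_eq_lderiv]
    refine Finset.sum_congr rfl fun s _ => Finset.sum_congr rfl fun t _ =>
      Finset.sum_congr rfl fun I _ => Finset.sum_congr rfl fun J _ => mul_right_comm _ _ _
  rw [this]
  refine Submodule.sum_mem _ fun s hs => Submodule.sum_mem _ fun t _ =>
    Submodule.sum_mem _ fun I _ => Submodule.sum_mem _ fun J _ => mulOp_mul_lderiv_mem _ ?_
  rw [List.length_ofFn]
  exact Nat.lt_succ_iff.1 (Finset.mem_range.1 hs)

/-- Bidifferential operators are determined by powers of linear functions in the first argument. -/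
theorem bidiff_ext {a b a' b' : ℕ} {C C' : A.Fn →ₗ[ℂ] A.Fn →ₗ[ℂ] A.Fn}
    (h : A.IsBidiffOfOrder a b C) (h' : A.IsBidiffOfOrder a' b' C')
    (hC : ∀ p q g, C (A.lin p ^ q) g = C' (A.lin p ^ q) g) : C = C' := by
  refine LinearMap.ext fun f => LinearMap.ext fun g => ?_
  exact LinearMap.congr_fun (ext_of_mem_diffOps
    (diffOps_mono (le_max_left a a') (h.flip_mem_diffOps g))
    (diffOps_mono (le_max_right a a') (h'.flip_mem_diffOps g)) fun p q => hC p q g) f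

end FunctionAlgebra

namespace Coeffs

open FunctionAlgebra

variable {N : ℕ} {A : FunctionAlgebra N} {Γ Γ' : Coeffs A}

theorem eq_of_yop_eq (hΓ : Γ.IsSymm) (hΓ' : Γ'.IsSymm) {i : Fin N} (h : Γ.yop i = Γ'.yop i)
    {k m : ℕ} (hm : 1 ≤ m) : Γ i k m = Γ' i k m := by
  refine ext_contract hΓ hΓ' fun p => ?_
  have h1 := eq_zero_of_sum_descFactorial (A.lin p) (Finset.Icc 1 (k + m))
    (fun t => Γ.contract i (k + m - t) t p - Γ'.contract i (k + m - t) t p) (fun q => ?_)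
    (Finset.mem_Icc.2 ⟨hm, Nat.le_add_left m k⟩)
  · simpa only [Nat.add_sub_cancel, sub_eq_zero] using h1
  · simp only [sub_mul, smul_sub, Finset.sum_sub_distrib]
    rw [← coeff_yop_lin_pow, ← coeff_yop_lin_pow, h, sub_self]

theorem isTraceless_of_coeff_linY_lin_pow
    (h : ∀ p r q, A.opCoeff r (Γ.linY p) (A.lin p ^ q) = 0) : Γ.IsTraceless := by
  intro k m hm p
  have h1 := eq_zero_of_sum_descFactorial (A.lin p) (Finset.Icc 1 (k + m))
    (fun t => ∑ i, ((p i : ℝ) : ℂ) • Γ.contract i (k + m - t) t p) (fun q => ?_)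
    (Finset.mem_Icc.2 ⟨hm, Nat.le_add_left m k⟩)
  · simpa only [Nat.add_sub_cancel] using h1
  · rw [← h p (k + m) q, coeff_linY, LinearMap.sum_apply]
    simp only [LinearMap.smul_apply, coeff_yop_lin_pow, Finset.smul_sum]
    rw [Finset.sum_comm]
    refine Finset.sum_congr rfl fun t _ => ?_
    rw [Finset.sum_mul, Finset.smul_sum]
    refine Finset.sum_congr rfl fun i _ => ?_
    rw [smul_mul_assoc, smul_comm]

/-- The hypothesis combines Weyl ordering and Hermiticity. Multiplication by $e^{-p\cdot x}$ then
isolates the $m$-derivative term of $\hat x^j$, giving the second evaluation of the quantity in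
`coeff_expOp_coord`. -/
theorem coeff_expOp_of_forall_linX_pow (j : Fin N) (k m : ℕ) (hm : 1 ≤ m) (p : Fin N → ℝ)
    (h : ∀ q, A.opCoeff (m + k) (Γ.linX p ^ q) (A.coord j) =
      (-1 : ℂ) ^ (m + k) • A.conj (A.opCoeff (m + k) (Γ.xop j) (A.lin p ^ q))) :
    A.opCoeff (m + k) (Γ.expOp m p) (A.coord j) =
      (-1 : ℂ) ^ (m + k) • A.conj (Γ.contract j k m p) := by
  have h1 : ∀ q, A.opCoeff (m + k) (Γ.linX p ^ q) (A.coord j) = (-1 : ℂ) ^ (m + k) •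
      ∑ t ∈ Finset.Icc 1 (m + k), (q.descFactorial t : ℂ) •
        (A.conj (Γ.contract j (m + k - t) t p) * A.lin p ^ (q - t)) := by
    intro q
    rw [h, xop, map_add, A.opCoeff_fnOp, if_neg (by omega), zero_add, coeff_yop_lin_pow,
      A.conj_sum]
    simp only [A.conj_smul, A.conj_mul, A.conj_pow, A.conj_lin, Complex.conj_natCast]
  rw [coeff_expOp]
  simp only [h1, mul_smul_comm]
  simp only [smul_comm _ ((-1 : ℂ) ^ (m + k)), ← Finset.smul_sum]
  refine congrArg (fun x => (-1 : ℂ) ^ (m + k) • x) ?_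
  simp only [Finset.mul_sum, Finset.smul_sum]
  rw [Finset.sum_comm]
  have h3 : ∀ t ∈ Finset.Icc 1 (m + k), ∑ q ∈ Finset.HasAntidiagonal.antidiagonal m,
      (((q.1.factorial : ℂ) * (q.2.factorial : ℂ))⁻¹) • ((-A.lin p) ^ q.1 *
        (q.2.descFactorial t : ℂ) •
          (A.conj (Γ.contract j (m + k - t) t p) * A.lin p ^ (q.2 - t))) =
      if t = m then A.conj (Γ.contract j k m p) else 0 := by
    intro t _
    have h4 : ∀ q : ℕ × ℕ, (((q.1.factorial : ℂ) * (q.2.factorial : ℂ))⁻¹) • ((-A.lin p) ^ q.1 *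
        (q.2.descFactorial t : ℂ) •
          (A.conj (Γ.contract j (m + k - t) t p) * A.lin p ^ (q.2 - t))) =
        A.conj (Γ.contract j (m + k - t) t p) *
          ((((q.1.factorial : ℂ) * (q.2.factorial : ℂ))⁻¹) •
            ((-A.lin p) ^ q.1 * ((q.2.descFactorial t : ℂ) • A.lin p ^ (q.2 - t)))) := by
      intro q
      simp only [mul_smul_comm, smul_smul]
      congr 1
      ring
    simp only [h4]
    rw [← Finset.mul_sum, sum_antidiagonal_descFactorial]
    split_ifs with h
    · subst h
      rw [mul_one, Nat.add_sub_cancel_left]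
    · rw [mul_zero]
  simp only [← mul_smul_comm] at h3 ⊢
  rw [Finset.sum_congr rfl h3, Finset.sum_ite_eq', if_pos (by simp; omega)]

/-- Weak Hermiticity implies the recursion. -/
theorem isRecursive_of_hermitian {P : Fin N → Fin N → A.Fn}
    (hP : ∀ i j, A.conj (P i j) = P i j) (hsymm : Γ.IsSymm)
    (base : ∀ i (I : Fin 1 → Fin N), Γ i 0 1 I = P i (I 0))
    (one : ∀ i k (I : Fin 1 → Fin N), 1 ≤ k → Γ i k 1 I = 0)
    (h : ∀ j k m, 1 ≤ m → ∀ p, Γ.F j k m p - (m : ℂ)⁻¹ • Γ.contract j k m p =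
      (-1 : ℂ) ^ (m + k) • A.conj (Γ.contract j k m p)) : Γ.IsRecursive P := by
  have hc : Γ.conj.IsSymm := fun i k m I σ => by
    change A.conj _ = A.conj _
    rw [hsymm]
  have real : ∀ i k m, 1 ≤ m → Γ.conj i k m = Γ i k m := by
    intro i k m hm
    induction hn : k + m using Nat.strong_induction_on generalizing i k m with
    | _ n ih =>
      subst hn
      rcases hm.eq_or_lt with rfl | hm2
      · funext I
        change A.conj _ = _
        rcases Nat.eq_zero_or_pos k with rfl | hk
        · rw [base, hP]
        · rw [one i k I hk, A.conj_zero]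
      · refine ext_contract hc hsymm fun p => ?_
        have hF : Γ.conj.F i k m p = Γ.F i k m p :=
          F_congr (fun j k' m' hm' hlt => ih (k' + m') hlt j k' m' hm' rfl) i p
        have h1 := h i k m hm p
        have h2 := congrArg A.conj h1
        rw [sub_eq_add_neg, ← neg_smul, A.conj_add, conj_F, A.conj_smul, A.conj_smul, A.conj_conj,
          conj_contract, hF, map_neg, map_inv₀, Complex.conj_natCast, map_pow, map_neg, map_one]
          at h2
        rw [conj_contract] at h1
        -- By induction $F$ is real at this order, so subtracting the equation from its conjugate
        -- leaves this factor times $\overline\Gamma-\Gamma$. It is nonzero because $m\ge2$;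
        -- shifting `k` by one supplies the opposite sign.
        have hs : (m : ℂ)⁻¹ - (-1 : ℂ) ^ (m + k) ≠ 0 := by
          have h0 := one_add_ne_zero (k + 1) hm2
          have hm0 : (m : ℂ) ≠ 0 := Nat.cast_ne_zero.2 (by omega)
          rw [← add_assoc, pow_succ] at h0
          intro h3
          apply h0
          rw [← sub_eq_zero.1 h3]
          field_simp
          ring
        have h5 : ((m : ℂ)⁻¹ - (-1 : ℂ) ^ (m + k)) •
            (Γ.conj.contract i k m p - Γ.contract i k m p) = 0 := by
          rw [smul_sub, sub_smul, sub_smul, ← h1, ← h2]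
          module
        exact sub_eq_zero.1 ((smul_eq_zero.1 h5).resolve_left hs)
  refine ⟨hsymm, base, one, fun i k m hm p => ?_⟩
  have h1 := h i k m (by omega) p
  have h2 : A.conj (Γ.contract i k m p) = Γ.contract i k m p := by
    rw [conj_contract, contract_eq, contract_eq, real i k m (by omega)]
  rw [h2, sub_eq_iff_eq_add, ← add_smul] at h1
  have h0 := one_add_ne_zero k hm
  have hm0 : (m : ℂ) ≠ 0 := Nat.cast_ne_zero.2 (by omega)
  rw [h1, smul_smul, weight]
  generalize (-1 : ℂ) ^ (m + k) = s at h0 ⊢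
  have h3 : (m : ℂ) / (1 + s * m) * (s + (m : ℂ)⁻¹) = 1 := by
    rw [div_mul_eq_mul_div, mul_add, mul_inv_cancel₀ hm0, add_comm, mul_comm (m : ℂ) s,
      div_self h0]
  rw [h3, one_smul]

end Coeffs

namespace StarProduct

open FunctionAlgebra Coeffs

variable {N : ℕ} {A : FunctionAlgebra N} {S : StarProduct A} {Γ : Coeffs A}

theorem IsWeyl.C_lin_pow (h : S.IsWeyl) (hΓ : S.HasCoeffs Γ) (r n : ℕ) (p : Fin N → ℝ)
    (f : A.Fn) : S.C r (A.lin p ^ n) f = A.opCoeff r (Γ.linX p ^ n) f := by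
  rw [← sum_mon_smul_C_prod_coord]
  simp only [S.isWeyl_iff.1 h, hΓ.hatOp]
  rw [sum_mon_smul_symmetrized, linX_eq]

theorem HasCoeffs.C_coord (hΓ : S.HasCoeffs Γ) (r : ℕ) (i : Fin N) :
    S.C r (A.coord i) = A.opCoeff r (Γ.xop i) := by
  rw [← hΓ.hatOp, opCoeff_hatOp]

theorem StableUnity.C_one (h : S.StableUnity) (r : ℕ) (f : A.Fn) :
    S.C r f 1 = if r = 0 then f else 0 := by
  have h1 := congrArg (PowerSeries.coeff r) (h f).1
  rw [coeff_star, PowerSeries.coeff_C] at h1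
  refine smul_right_injective _ (pow_ne_zero r Complex.I_ne_zero) ?_
  dsimp only
  rw [h1]
  split_ifs with h0
  · rw [h0, pow_zero, one_smul]
  · rw [smul_zero]

/-- Stability of unity gives $(p\cdot\hat x)^n1=(p\cdot x)^n$ for all $n$. Comparing consecutive
powers shows that $Y$ kills every $(p\cdot x)^q$. -/
theorem isTraceless (hW : S.IsWeyl) (hU : S.StableUnity) (hΓ : S.HasCoeffs Γ) :
    Γ.IsTraceless := by
  have h1 : ∀ p r n, A.opCoeff r (Γ.linX p ^ n) 1 = if r = 0 then A.lin p ^ n else 0 :=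
    fun p r n => by rw [← hW.C_lin_pow hΓ, hU.C_one]
  refine isTraceless_of_coeff_linY_lin_pow fun p r q => ?_
  have h2 := h1 p r (q + 1)
  rw [pow_succ', A.opCoeff_mul, LinearMap.sum_apply,
    Finset.sum_eq_single_of_mem (r, 0) (by simp)] at h2
  · rw [Module.End.mul_apply, h1, if_pos rfl, linX, map_add, LinearMap.add_apply,
      A.opCoeff_fnOp] at h2
    split_ifs at h2 with h0
    · rw [mulOp_apply, pow_succ'] at h2
      exact left_eq_add.1 h2.symm
    · rwa [LinearMap.zero_apply, zero_add] at h2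
  · rintro ⟨a, b⟩ hab hne
    have hb : b ≠ 0 := by
      rintro rfl
      rw [Finset.HasAntidiagonal.mem_antidiagonal] at hab
      exact hne (by rw [← hab, Nat.add_zero])
    rw [Module.End.mul_apply, h1, if_neg hb, map_zero]

theorem HasCoeffs.C_one_coord_coord (hΓ : S.HasCoeffs Γ) (i j : Fin N) :
    S.C 1 (A.coord i) (A.coord j) = Γ i 0 1 fun _ => j := by
  rw [hΓ.C_coord, xop, map_add, A.opCoeff_fnOp, if_neg one_ne_zero, zero_add, coeff_yop_apply]
  simp only [Finset.Icc_self, Finset.sum_singleton]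
  rw [Finset.sum_eq_single fun _ => j]
  · simp [A.pderiv_coord]
  · intro I _ hI
    have : I 0 ≠ j := fun h => hI (funext fun a => by rw [Subsingleton.elim a 0, h])
    simp [A.pderiv_coord, this]
  · simp

/-- Tracelessness at $k=0$, $m=1$ is a vanishing quadratic form; polarize it. Quantization then
determines $\Gamma_0^{ij}$ completely, since it prescribes the antisymmetric part. -/
theorem base_antisymm (hΓ : Γ.IsTraceless) (i j : Fin N) :
    (Γ j 0 1 fun _ => i) = -Γ i 0 1 fun _ => j := by
  classical
  set T : Fin N → Fin N → A.Fn := fun i j => Γ i 0 1 fun _ => j with hT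
  have h : ∀ p : Fin N → ℝ, ∑ a, ∑ b, (((p a : ℝ) : ℂ) * ((p b : ℝ) : ℂ)) • T a b = 0 := by
    intro p
    rw [← hΓ 0 1 le_rfl p]
    refine Finset.sum_congr rfl fun a _ => ?_
    rw [contract, Finset.smul_sum]
    refine (Fintype.sum_equiv (Equiv.funUnique (Fin 1) (Fin N)) _ _ fun I => ?_).symm
    have : I = fun _ => I 0 := funext fun a => by rw [Subsingleton.elim a 0]
    rw [smul_smul, Fin.prod_univ_one]
    conv_lhs => rw [this]
    rfl
  have hq : ∀ p q : Fin N → ℝ, ∑ a, ∑ b, (((p a : ℝ) : ℂ) * ((q b : ℝ) : ℂ)) • T a b +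
      ∑ a, ∑ b, (((q a : ℝ) : ℂ) * ((p b : ℝ) : ℂ)) • T a b = 0 := by
    intro p q
    have h1 := h (p + q)
    have h2 : ∑ a, ∑ b, ((((p + q) a : ℝ) : ℂ) * (((p + q) b : ℝ) : ℂ)) • T a b =
        ∑ a, ∑ b, (((p a : ℝ) : ℂ) * ((p b : ℝ) : ℂ)) • T a b +
        (∑ a, ∑ b, (((p a : ℝ) : ℂ) * ((q b : ℝ) : ℂ)) • T a b +
        ∑ a, ∑ b, (((q a : ℝ) : ℂ) * ((p b : ℝ) : ℂ)) • T a b) +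
        ∑ a, ∑ b, (((q a : ℝ) : ℂ) * ((q b : ℝ) : ℂ)) • T a b := by
      simp only [← Finset.sum_add_distrib, ← add_smul, Pi.add_apply, Complex.ofReal_add]
      refine Finset.sum_congr rfl fun a _ => Finset.sum_congr rfl fun b _ => ?_
      congr 1
      ring
    rw [h2, h, h, zero_add, add_zero] at h1
    exact h1
  have hs : ∀ i j : Fin N, ∑ a, ∑ b, ((((Pi.single i 1 : Fin N → ℝ) a : ℝ) : ℂ) *
      (((Pi.single j 1 : Fin N → ℝ) b : ℝ) : ℂ)) • T a b = T i j := by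
    intro i j
    rw [Finset.sum_eq_single i, Finset.sum_eq_single j]
    · simp
    · intro b _ hb
      simp [hb]
    · simp
    · intro a _ ha
      simp [ha]
    · simp
  have := hq (Pi.single i 1) (Pi.single j 1)
  rw [hs, hs] at this
  exact (neg_eq_of_add_eq_zero_right this).symm

theorem HasCoeffs.eq (hΓ : S.HasCoeffs Γ) {Γ' : Coeffs A} (hΓ' : S.HasCoeffs Γ') (i : Fin N)
    {k m : ℕ} (hm : 1 ≤ m) : Γ i k m = Γ' i k m := by
  refine eq_of_yop_eq hΓ.1 hΓ'.1 ?_ hm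
  have h := (hΓ.hatOp i).symm.trans (hΓ'.hatOp i)
  rw [xop, xop] at h
  exact add_left_cancel h

theorem IsWeaklyHermitian.C_coord (h : S.IsWeaklyHermitian) (hΓ : S.HasCoeffs Γ) (r : ℕ)
    (j : Fin N) (f : A.Fn) :
    S.C r (A.conj f) (A.coord j) = (-1 : ℂ) ^ r • A.conj (A.opCoeff r (Γ.xop j) f) := by
  have h1 := congrArg (PowerSeries.coeff r) (h j f)
  rw [conjSeries, PowerSeries.coeff_mk, coeff_star, coeff_star, A.conj_smul, hΓ.C_coord, map_pow,
    Complex.conj_I, neg_pow, mul_comm, mul_smul] at h1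
  exact (smul_right_injective _ (pow_ne_zero r Complex.I_ne_zero) h1).symm

theorem IsWeylQuantization.isRecursive {P : Fin N → Fin N → A.Fn} (h : S.IsWeylQuantization P)
    (hP : ∀ i j, A.conj (P i j) = P i j) (hΓ : S.HasCoeffs Γ) : Γ.IsRecursive P := by
  have ht := isTraceless h.weyl h.stableUnity hΓ
  refine isRecursive_of_hermitian hP hΓ.1 (fun i I => ?_) (fun i k I hk => ?_)
    fun j k m hm p => ?_
  · have h1 := h.quantizes (A.coord i) (A.coord (I 0))
    have hI : I = fun _ => I 0 := funext fun a => by rw [Subsingleton.elim a 0]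
    rw [hΓ.C_one_coord_coord, hΓ.C_one_coord_coord, base_antisymm ht i, sub_neg_eq_add,
      ← two_smul ℂ, ← hI] at h1
    rw [smul_right_injective _ (two_ne_zero' ℂ) h1, bracket, Finset.sum_eq_single i,
      Finset.sum_eq_single (I 0)]
    · simp [A.pderiv_coord]
    · intro b _ hb
      simp [A.pderiv_coord, hb]
    · simp
    · intro a _ ha
      simp [A.pderiv_coord, ha]
    · simp
  -- Strict triangularity provides some coefficient family; the operators $\hat x^i$ identify it
  -- with the given one.
  · obtain ⟨Γ', hΓ', h0⟩ := h.strictlyTriangular.2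
    rw [hΓ.eq hΓ' i le_rfl, h0 i k I hk]
  · rw [← coeff_expOp_coord Γ ht k m hm]
    refine coeff_expOp_of_forall_linX_pow j k m hm p fun q => ?_
    rw [← h.weyl.C_lin_pow hΓ, ← h.weaklyHermitian.C_coord hΓ, A.conj_pow, A.conj_lin]

/-- Both coefficient families solve the same recursion, so the operators $\hat x^i$ coincide. Weyl
ordering then fixes the products with $(p\cdot x)^q$ on the left, which determine bidifferential
operators. -/
theorem IsWeylQuantization.unique {P : Fin N → Fin N → A.Fn} {S' : StarProduct A}
    (h : S.IsWeylQuantization P) (h' : S'.IsWeylQuantization P)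
    (hP : ∀ i j, A.conj (P i j) = P i j) : S = S' := by
  obtain ⟨Γ, hΓ, -⟩ := h.strictlyTriangular.2
  obtain ⟨Γ', hΓ', -⟩ := h'.strictlyTriangular.2
  have h1 : ∀ i, Γ.xop i = Γ'.xop i := by
    intro i
    rw [xop, xop]
    congr 1
    refine op_ext fun r f => ?_
    rw [coeff_yop_apply, coeff_yop_apply]
    refine Finset.sum_congr rfl fun m hm => ?_
    rw [(h.isRecursive hP hΓ).unique (h'.isRecursive hP hΓ') i (r - m) m (Finset.mem_Icc.1 hm).1]
  refine StarProduct.ext (funext fun r => ?_)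
  obtain ⟨a, b, hC⟩ := S.bidiff r
  obtain ⟨a', b', hC'⟩ := S'.bidiff r
  refine bidiff_ext hC hC' fun p q g => ?_
  rw [h.weyl.C_lin_pow hΓ, h'.weyl.C_lin_pow hΓ', linX_eq, linX_eq]
  simp only [h1]

end StarProduct

end WeylStar
theorem mainTheorem1 (N : ℕ) (A : WeylStar.FunctionAlgebra N) (P : Fin N → Fin N → A.Fn)
    (hP_real : ∀ i j, A.conj (P i j) = P i j) (hP_antisymm : ∀ i j, P j i = -P i j) :
    -- existence and uniqueness of the star product
    (∃! S : WeylStar.StarProduct A, S.IsWeylQuantization P) ∧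
    -- its coefficients, and the recursion that determines them
    (∀ S : WeylStar.StarProduct A, S.IsWeylQuantization P →
      (∃ Γ : WeylStar.Coeffs A, S.HasCoeffs Γ) ∧
      ∀ Γ : WeylStar.Coeffs A, S.HasCoeffs Γ →
        Γ.IsReal ∧ Γ.IsTraceless ∧
        (∀ i j, Γ i 0 1 ![j] = P i j) ∧
        (∀ i k j, 1 ≤ k → Γ i k 1 ![j] = 0) ∧
        (∀ i k m, 2 ≤ m → ∀ p : Fin N → ℝ,
          Γ.contract i k m p =
            ((m : ℂ) / (1 + (-1 : ℂ) ^ (m + k) * (m : ℂ))) • Γ.F i k m p)) ∧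
    -- `F` is built from the coefficients of lower order only
    (∀ (Γ Γ' : WeylStar.Coeffs A) (k m : ℕ),
      (∀ j k' m', 1 ≤ m' → k' + m' < k + m → Γ j k' m' = Γ' j k' m') →
      ∀ i (p : Fin N → ℝ), Γ.F i k m p = Γ'.F i k m p) ∧
    -- `F` is traceless
    (∀ Γ : WeylStar.Coeffs A, Γ.IsTraceless → ∀ (k m : ℕ) (p : Fin N → ℝ),
      ∑ i, ((p i : ℝ) : ℂ) • Γ.F i k m p = 0) := by
  refine ⟨⟨(WeylStar.Coeffs.solution P).weylStarProduct,
    (WeylStar.Coeffs.solution P).weylStarProduct_isWeylQuantization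
      (WeylStar.Coeffs.solution_isRecursive P) hP_real hP_antisymm,
    fun S hS => hS.unique ((WeylStar.Coeffs.solution P).weylStarProduct_isWeylQuantization
      (WeylStar.Coeffs.solution_isRecursive P) hP_real hP_antisymm) hP_real⟩,
    fun S hS => ⟨?_, fun Γ hΓ => ?_⟩, fun Γ Γ' k m h i p => WeylStar.Coeffs.F_congr h i p,
    fun Γ hΓ k m p => Γ.sum_smul_F_eq_zero hΓ k m p⟩
  · obtain ⟨Γ, hΓ, -⟩ := hS.strictlyTriangular.2
    exact ⟨Γ, hΓ⟩
  · have h := hS.isRecursive hP_real hΓ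
    exact ⟨h.real hP_real, h.traceless hP_antisymm, fun i j => h.base i ![j],
      fun i k j hk => h.one i k ![j] hk, h.recursion⟩

end
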